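/- Testing trees with few-copy measurements. Let $G=(V,E)$ be a tree on $n\ge 1$ vertices, let $r\ge 2$ be an integer, let $\varepsilon\in(0,\frac1{r+2})$, and let $\mathcal H=\bigotimes_{v\in V}\mathbb C^{d_v}$. Let $\mathsf{TTNS}(G,r)$ be the set of pure states $|\psi\rangle\langle\psi|$ on $\mathcal H$ such that, for every edge $e\in E$, the Schmidt rank of $|\psi\rangle$ with respect to the bipartition of $V$ obtained by removing $e$ is at most $r$. A $k$-round $(r+1)$-copy test performs, in each of $k$ rounds, a measurement (POVM with finitely many outcomes) on $r+1$ fresh copies of the unknown pure state, and accepts or rejects depending on all the outcomes; it uses $k(r+1)$ copies. It is adaptive if the measurement in a round may depend on the outcomes of the earlier rounds, and non-adaptive if the measurements are fixed in advance. It is successful with one-sided error at distance $\varepsilon$ if it accepts every state of $\mathsf{TTNS}(G,r)$ with probability $1$, and accepts every pure state whose trace distance $\frac12\|\cdot\|_1$ from every element of $\mathsf{TTNS}(G,r)$ is at least $\varepsilon$ with probability at most $1-\frac13$. There are absolute constants $C,c>0$ (independent of $G$, $n$, $r$, $\varepsilon$ and the physical dimensions $d_v$) such that the following hold. (i) For all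 physical dimensions $(d_v)_{v\in V}$ there is a non-adaptive $(r+1)$-copy test for $\mathsf{TTNS}(G,r)$ that is successful with one-sided error at distance $\varepsilon$ and uses at most $C\,(n-1)^r\,(r+1)!/\varepsilon^{2r}$ copies. (ii) There is a $d_0$, depending on $G$, $r$ and $\varepsilon$, such that whenever $d_v\ge d_0$ for all $v\in V$, every adaptive $(r+1)$-copy test for $\mathsf{TTNS}(G,r)$ that is successful with one-sided error at distance $\varepsilon$ uses at least $c\,(n-1)^{r-1}\,(r+1)!/\varepsilon^{2r}$ copies. -/

import Mathlib

open scoped Nat ComplexOrder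

noncomputable section

/-- The trace norm of a square matrix: the sum of its singular values, that is, of the square roots
of the eigenvalues of `Aᴴ * A`. -/
def traceNorm {κ : Type*} [Fintype κ] [DecidableEq κ] (A : Matrix κ κ ℂ) : ℝ :=
  ∑ i, Real.sqrt ((Matrix.isHermitian_conjTranspose_mul_self A).eigenvalues i)

/-- The trace distance `‖ρ - σ‖₁ / 2`. -/
def traceDist {κ : Type*} [Fintype κ] [DecidableEq κ] (ρ σ : Matrix κ κ ℂ) : ℝ :=
  traceNorm (ρ - σ) / 2

/-- The operator `|ψ⟩⟨ψ|`. -/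
def ketbra {κ : Type*} (ψ : κ → ℂ) : Matrix κ κ ℂ :=
  Matrix.vecMulVec ψ (star ψ)

/-- `ψ` is a unit vector of the Hilbert space `ℂ^κ` (with the standard inner product). -/
def IsUnitVector {κ : Type*} [Fintype κ] (ψ : κ → ℂ) : Prop :=
  star ψ ⬝ᵥ ψ = 1

/-- The pure states on `ℂ^κ`, as density operators. -/
def pureStates (κ : Type*) [Fintype κ] : Set (Matrix κ κ ℂ) :=
  {ρ | ∃ ψ : κ → ℂ, IsUnitVector ψ ∧ ρ = ketbra ψ}

/-- `ρ` has trace distance at least `ε` from every state of the property `P`. -/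
def IsFar {κ : Type*} [Fintype κ] [DecidableEq κ] (ε : ℝ) (P : Set (Matrix κ κ ℂ))
    (ρ : Matrix κ κ ℂ) : Prop :=
  ∀ σ ∈ P, ε ≤ traceDist ρ σ

/-- The operator `ρ ⊗ ⋯ ⊗ ρ` (`ℓ` factors) on `(ℂ^κ) ⊗ ⋯ ⊗ (ℂ^κ)`, in the product basis, which is
indexed by `Fin ℓ → κ`. -/
def tensorPow {κ : Type*} (ρ : Matrix κ κ ℂ) (ℓ : ℕ) : Matrix (Fin ℓ → κ) (Fin ℓ → κ) ℂ :=
  Matrix.of fun a b => ∏ i, ρ (a i) (b i)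

/-- A measurement (POVM) with finitely many outcomes on `ℂ^κ`. -/
structure POVM (κ : Type*) [Fintype κ] [DecidableEq κ] where
  numOutcomes : ℕ
  effect : Fin numOutcomes → Matrix κ κ ℂ
  posSemidef : ∀ x, (effect x).PosSemidef
  sum_eq_one : ∑ x, effect x = 1

/-- An adaptive `k`-round, `ℓ`-copy test on states of `ℂ^κ`: in each of the `k` rounds a POVM is
performed on `ℓ` fresh copies of the unknown state; it may depend on the outcomes of all the
previous rounds. After the last round the test accepts (`true`) or rejects (`false`), depending on
all the outcomes. -/
inductive AdaptiveTest (κ : Type*) [Fintype κ] [DecidableEq κ] (ℓ : ℕ) : ℕ → Type _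
  | output (accept : Bool) : AdaptiveTest κ ℓ 0
  | round {k : ℕ} (M : POVM (Fin ℓ → κ)) (next : Fin M.numOutcomes → AdaptiveTest κ ℓ k) :
      AdaptiveTest κ ℓ (k + 1)

namespace AdaptiveTest

variable {κ : Type*} [Fintype κ] [DecidableEq κ] {ℓ : ℕ}

/-- The probability that the test accepts, given copies of the state `ρ`. Outcome `x` of a POVM `M`
on `ℓ` copies has probability `Tr (M_x ρ^{⊗ ℓ})`. -/
def acceptProb (ρ : Matrix κ κ ℂ) : {k : ℕ} → AdaptiveTest κ ℓ k → ℝ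
  | _, output accept => if accept then 1 else 0
  | _, round M next =>
      ∑ x, (Matrix.trace (M.effect x * tensorPow ρ ℓ)).re * acceptProb ρ (next x)

/-- The POVM performed in each round is the one given by the list, whatever the outcomes of the
previous rounds. -/
def Performs : {k : ℕ} → AdaptiveTest κ ℓ k → List (POVM (Fin ℓ → κ)) → Prop
  | _, output _, L => L = []
  | _, round M next, L => ∃ L', L = M :: L' ∧ ∀ x, Performs (next x) L'

/-- The test is non-adaptive: its measurements are fixed in advance (the decision at the end may
depend on all the outcomes). -/
def IsNonadaptive {k : ℕ} (T : AdaptiveTest κ ℓ k) : Prop :=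
  ∃ L, T.Performs L

/-- The test has one-sided error and is successful for the property `P` of pure states, at distance
`ε`: it accepts every state in `P` with certainty, and the probability of accepting a pure state
that is `ε`-far from `P` is smaller by at least `1 / 3`. -/
def IsOneSidedTester {k : ℕ} (T : AdaptiveTest κ ℓ k) (P : Set (Matrix κ κ ℂ)) (ε : ℝ) : Prop :=
  (∀ ρ ∈ P, T.acceptProb ρ = 1) ∧
    ∀ ρ ∈ pureStates κ, IsFar ε P ρ → T.acceptProb ρ ≤ 1 - 1 / 3

/-- The total number of copies of the unknown state that a `k`-round, `ℓ`-copy test consumes. -/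
def numCopies {k : ℕ} (_T : AdaptiveTest κ ℓ k) : ℕ :=
  k * ℓ

end AdaptiveTest

/-- The product basis of `⨂_{v ∈ V} ℂ^{d v}`. -/
abbrev ProdIdx {V : Type*} (d : V → ℕ) : Type _ :=
  (v : V) → Fin (d v)

open scoped Classical in
/-- The Schmidt rank of a vector in `⨂_{v ∈ V} ℂ^{d v}` with respect to the bipartition
`S`, `V \ S`: the rank of its matrix of coefficients, with rows indexed by the product basis of the
subsystem `S` and columns by the product basis of the complementary subsystem. -/
def schmidtRank {V : Type*} [Fintype V] {d : V → ℕ} (S : Set V) (ψ : ProdIdx d → ℂ) : ℕ :=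
  Matrix.rank (Matrix.of
    fun (a : (v : {v // v ∈ S}) → Fin (d v)) (b : (v : {v // v ∉ S}) → Fin (d v)) =>
      ψ ((Equiv.piEquivPiSubtypeProd (fun v => v ∈ S) (fun v => Fin (d v))).symm (a, b)))

/-- The vertices that are still connected to `u` once the edge `uv` has been removed. -/
def edgeSide {V : Type*} (G : SimpleGraph V) (u v : V) : Set V :=
  {w | (G.deleteEdges {s(u, v)}).Reachable u w}

/-- The tree tensor network states on `G` of bond dimension at most `r`, with physical dimensions
`d`: the pure states whose Schmidt rank with respect to the cut determined by any edge of `G` is at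
most `r`. -/
def TTNS {V : Type*} [Fintype V] [DecidableEq V] (G : SimpleGraph V) (d : V → ℕ) (r : ℕ) :
    Set (Matrix (ProdIdx d) (ProdIdx d) ℂ) :=
  {ρ | ∃ ψ : ProdIdx d → ℂ, IsUnitVector ψ ∧
    (∀ u v, G.Adj u v → schmidtRank (edgeSide G u v) ψ ≤ r) ∧ ρ = ketbra ψ}

end

/-! Both bounds rest on one bipartite fact. Split X^{⊗(r+1)} into the component antisymmetric in
each of the two subsystems (`detForm`) and a rest. The component is orthogonal to Y^{⊗(r+1)} for
every Y of rank at most r (`detForm_eq_zero`, `star_detForm_dotProduct_tpow`); the rest lies in the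
span of these Y^{⊗(r+1)} (`tpow_sub_detForm_mem_span`); and the squared norm of the component is the
elementary symmetric polynomial e_{r+1} of the squared Schmidt coefficients, written as `injSum` /
(r+1)! (`sqNorm_detForm`). Put m = n - 1, the number of edges.

Upper bound. Each round projects onto the orthogonal complement of the span of (r+1)-st powers of
tree tensor network vectors, and the test rejects once such a component is seen. If on every cut
some r Schmidt terms capture all but less than ε²/m of the weight, truncating the cuts one by one
gives a vector of bond dimension at most r at squared distance below ε²; the squared errors add
because the cuts form a laminar family and each truncation is a projection
(`exists_hasCutRank_of_laminar`). So a far state has a cut with tail at least δ = ε²/m. There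
e_{r+1} ≥ δ^r / (2 r!) (`le_injSum_of_tail`), which bounds the rejection probability of a round from
below.

Lower bound. Take a holomorphic family of vectors whose normalizations the test accepts with
certainty. An outcome of a measurement either never occurs on the family or occurs for generic
members, and then the continuation must accept generic members. Hence adaptivity does not help: if Δ
is the squared distance of ψ^{⊗(r+1)} from the span of the powers of the family, k rounds accept ψ
with probability at least 1 - kΔ (`AdaptiveTest.one_sub_mul_le_acceptProb`). The hard state puts on
each edge a bipartite state with Schmidt spectrum 1 - x, x/D, …, x/D, where x is about ε²/m. Its
largest overlap with tree states is bounded by a product over the edges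
(`norm_star_prodVec_dotProduct_sq_le`), which makes it ε-far, while Δ ≤ m x^r / r!
(`exists_approx_tpow_prodVec`). So k is at least of order r! m^{r-1} / ε^{2r}. -/

noncomputable section

/-! ### Vectors with finitely many complex coordinates -/

/-- The squared Euclidean norm of a vector. -/
def sqNorm {κ : Type*} [Fintype κ] (v : κ → ℂ) : ℝ :=
  ∑ i, ‖v i‖ ^ 2

theorem sqNorm_nonneg {κ : Type*} [Fintype κ] (v : κ → ℂ) : 0 ≤ sqNorm v :=
  Finset.sum_nonneg fun _ _ => by positivity

theorem star_dotProduct_self {κ : Type*} [Fintype κ] (v : κ → ℂ) :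
    star v ⬝ᵥ v = (sqNorm v : ℂ) := by
  simp only [dotProduct, sqNorm, Pi.star_apply, Complex.ofReal_sum]
  refine Finset.sum_congr rfl fun i _ => ?_
  rw [Complex.star_def, ← Complex.normSq_eq_conj_mul_self, Complex.normSq_eq_norm_sq]

theorem isUnitVector_iff {κ : Type*} [Fintype κ] (v : κ → ℂ) :
    IsUnitVector v ↔ sqNorm v = 1 := by
  rw [IsUnitVector, star_dotProduct_self]
  norm_cast

theorem sqNorm_eq_zero {κ : Type*} [Fintype κ] {v : κ → ℂ} : sqNorm v = 0 ↔ v = 0 := by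
  rw [sqNorm, Finset.sum_eq_zero_iff_of_nonneg fun _ _ => by positivity]
  simp [funext_iff]

theorem sqNorm_smul {κ : Type*} [Fintype κ] (c : ℂ) (v : κ → ℂ) :
    sqNorm (c • v) = ‖c‖ ^ 2 * sqNorm v := by
  simp [sqNorm, mul_pow, Finset.mul_sum]

theorem star_dotProduct_comm {κ : Type*} [Fintype κ] (v w : κ → ℂ) :
    star (star v ⬝ᵥ w) = star w ⬝ᵥ v := by
  rw [Matrix.star_dotProduct, star_star]

theorem norm_star_dotProduct_sq_le {κ : Type*} [Fintype κ] (v w : κ → ℂ) :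
    ‖star v ⬝ᵥ w‖ ^ 2 ≤ sqNorm v * sqNorm w := by
  have h := norm_inner_le_norm (𝕜 := ℂ) (WithLp.toLp 2 v) (WithLp.toLp 2 w)
  have h1 : inner ℂ (WithLp.toLp 2 v) (WithLp.toLp 2 w) = star v ⬝ᵥ w := by
    rw [EuclideanSpace.inner_toLp_toLp, dotProduct_comm]
  have h2 (u : κ → ℂ) : ‖WithLp.toLp 2 u‖ ^ 2 = sqNorm u := by
    rw [EuclideanSpace.norm_sq_eq]; rfl
  rw [h1] at h
  calc _ ≤ (‖WithLp.toLp 2 v‖ * ‖WithLp.toLp 2 w‖) ^ 2 := by gcongr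
    _ = _ := by rw [mul_pow, h2, h2]

theorem sqNorm_sub {κ : Type*} [Fintype κ] (v w : κ → ℂ) :
    sqNorm (v - w) = sqNorm v + sqNorm w - 2 * (star v ⬝ᵥ w).re := by
  have h : star (v - w) ⬝ᵥ (v - w) =
      star v ⬝ᵥ v + star w ⬝ᵥ w - (star v ⬝ᵥ w + star (star v ⬝ᵥ w)) := by
    rw [star_dotProduct_comm]
    simp only [star_sub, sub_dotProduct, dotProduct_sub]
    ring
  rw [star_dotProduct_self, star_dotProduct_self, star_dotProduct_self] at h
  have h' := congrArg Complex.re h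
  simp only [Complex.ofReal_re, Complex.sub_re, Complex.add_re, Complex.star_def,
    Complex.conj_re] at h'
  rw [h']; ring

theorem sqNorm_comp_equiv {κ κ' : Type*} [Fintype κ] [Fintype κ'] (e : κ' ≃ κ) (v : κ → ℂ) :
    sqNorm (v ∘ e) = sqNorm v :=
  Equiv.sum_comp e fun i => ‖v i‖ ^ 2

/-- The vector `ψ ⊗ ⋯ ⊗ ψ` (`ℓ` factors), in the product basis. -/
def tpow {κ : Type*} (ψ : κ → ℂ) (ℓ : ℕ) : (Fin ℓ → κ) → ℂ :=
  fun x => ∏ i, ψ (x i)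

theorem tensorPow_ketbra {κ : Type*} (ψ : κ → ℂ) (ℓ : ℕ) :
    tensorPow (ketbra ψ) ℓ = ketbra (tpow ψ ℓ) := by
  ext a b
  simp [tensorPow, ketbra, tpow, Matrix.vecMulVec_apply, Finset.prod_mul_distrib]

theorem tpow_smul {κ : Type*} (c : ℂ) (ψ : κ → ℂ) (ℓ : ℕ) :
    tpow (c • ψ) ℓ = c ^ ℓ • tpow ψ ℓ := by
  ext x
  simp [tpow, Finset.prod_mul_distrib]

theorem star_tpow_dotProduct_tpow {κ : Type*} [Fintype κ] [DecidableEq κ] (ξ ψ : κ → ℂ) (ℓ : ℕ) :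
    star (tpow ξ ℓ) ⬝ᵥ tpow ψ ℓ = (star ξ ⬝ᵥ ψ) ^ ℓ := by
  have h := Finset.prod_univ_sum (fun _ : Fin ℓ => (Finset.univ : Finset κ))
    (fun _ j => star (ξ j) * ψ j)
  rw [Fintype.piFinset_univ] at h
  simp only [dotProduct, tpow, Pi.star_apply, star_prod, ← Finset.prod_mul_distrib]
  rw [← h]
  simp

theorem sqNorm_tpow {κ : Type*} [Fintype κ] [DecidableEq κ] (ψ : κ → ℂ) (ℓ : ℕ) :
    sqNorm (tpow ψ ℓ) = sqNorm ψ ^ ℓ := by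
  have h := star_tpow_dotProduct_tpow ψ ψ ℓ
  rw [star_dotProduct_self, star_dotProduct_self] at h
  exact_mod_cast h

theorem trace_mul_ketbra {κ : Type*} [Fintype κ] (M : Matrix κ κ ℂ) (t : κ → ℂ) :
    (M * ketbra t).trace = star t ⬝ᵥ (M.mulVec t) := by
  rw [ketbra, Matrix.mul_vecMulVec, Matrix.trace_vecMulVec, dotProduct_comm]

/-! ### The trace distance of pure states -/

theorem ketbra_mul_ketbra {κ : Type*} [Fintype κ] (ξ ψ : κ → ℂ) :
    ketbra ξ * ketbra ψ = (star ξ ⬝ᵥ ψ) • Matrix.vecMulVec ξ (star ψ) := by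
  rw [ketbra, ketbra, Matrix.vecMulVec_mul_vecMulVec, Matrix.vecMulVec_smul]

/-- Every eigenvalue μ of A*A is forced into {0, s²}, and s√μ = μ for both values. At s = 0 the
identity carries no information on the trace norm. -/
theorem traceNorm_of_sq {κ : Type*} [Fintype κ] [DecidableEq κ] (A : Matrix κ κ ℂ) (s : ℝ)
    (hs : 0 ≤ s) (h : (A.conjTranspose * A) * (A.conjTranspose * A) =
      ((s ^ 2 : ℝ) : ℂ) • (A.conjTranspose * A)) :
    s * traceNorm A = (A.conjTranspose * A).trace.re := by
  set hH := Matrix.isHermitian_conjTranspose_mul_self A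
  have htr : (A.conjTranspose * A).trace.re = ∑ i, hH.eigenvalues i := by
    rw [hH.trace_eq_sum_eigenvalues]
    simp
  rw [htr, traceNorm, Finset.mul_sum]
  refine Finset.sum_congr rfl fun i _ => ?_
  have hv := hH.mulVec_eigenvectorBasis i
  set v : κ → ℂ := (hH.eigenvectorBasis i).ofLp
  set μ : ℝ := hH.eigenvalues i
  have hv0 : v ≠ 0 := fun h0 => hH.eigenvectorBasis.toBasis.ne_zero i (by ext j; exact congrFun h0 j)
  have h1 := congrArg (fun B => B.mulVec v) h
  have hv' : (A.conjTranspose * A).mulVec v = (μ : ℂ) • v := hv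
  rw [← Matrix.mulVec_mulVec, Matrix.smul_mulVec, hv', Matrix.mulVec_smul, hv', smul_smul,
    smul_smul] at h1
  have h2 : (μ : ℂ) * μ = ((s ^ 2 : ℝ) : ℂ) * μ := smul_left_injective ℂ hv0 h1
  have h3 : μ * μ = s ^ 2 * μ := by exact_mod_cast h2
  have hμ : 0 ≤ μ := (Matrix.posSemidef_conjTranspose_mul_self A).eigenvalues_nonneg i
  rcases eq_or_ne μ 0 with h0 | h0
  · rw [h0]; simp
  · have : μ = s ^ 2 := mul_right_cancel₀ h0 h3
    change s * Real.sqrt μ = μ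
    rw [this, Real.sqrt_sq hs, sq]

theorem norm_star_dotProduct_sq_le_one {κ : Type*} [Fintype κ] {ξ ψ : κ → ℂ}
    (hξ : IsUnitVector ξ) (hψ : IsUnitVector ψ) : ‖star ξ ⬝ᵥ ψ‖ ^ 2 ≤ 1 := by
  have := norm_star_dotProduct_sq_le ξ ψ
  rwa [(isUnitVector_iff _).1 hξ, (isUnitVector_iff _).1 hψ, one_mul] at this

/-- The difference A of the two projections satisfies A³ = s²A and tr A² = 2s² with s² = 1 - |⟨ξ,
ψ⟩|², so `traceNorm_of_sq` gives trace norm 2s without diagonalizing A. For s = 0 one has A = 0. -/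
theorem traceDist_ketbra {κ : Type*} [Fintype κ] [DecidableEq κ] {ξ ψ : κ → ℂ}
    (hξ : IsUnitVector ξ) (hψ : IsUnitVector ψ) :
    traceDist (ketbra ξ) (ketbra ψ) = Real.sqrt (1 - ‖star ξ ⬝ᵥ ψ‖ ^ 2) := by
  set s := Real.sqrt (1 - ‖star ξ ⬝ᵥ ψ‖ ^ 2) with hs
  have hs2 : s ^ 2 = 1 - ‖star ξ ⬝ᵥ ψ‖ ^ 2 :=
    Real.sq_sqrt (by linarith [norm_star_dotProduct_sq_le_one hξ hψ])
  set A := ketbra ξ - ketbra ψ with hA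
  have hherm : A.conjTranspose = A := by
    simp [hA, ketbra, Matrix.conjTranspose_sub, Matrix.conjTranspose_vecMulVec]
  set z := star ξ ⬝ᵥ ψ with hz
  have hz' : star ψ ⬝ᵥ ξ = star z := by rw [hz, star_dotProduct_comm]
  have hzz : z * star z = ((1 - s ^ 2 : ℝ) : ℂ) := by
    rw [hs2, Complex.star_def, Complex.mul_conj, Complex.normSq_eq_norm_sq]; push_cast; ring
  have e1 : ketbra ξ * ketbra ξ = ketbra ξ := by
    rw [ketbra_mul_ketbra, show star ξ ⬝ᵥ ξ = 1 from hξ, one_smul]; rfl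
  have e2 : ketbra ψ * ketbra ψ = ketbra ψ := by
    rw [ketbra_mul_ketbra, show star ψ ⬝ᵥ ψ = 1 from hψ, one_smul]; rfl
  have e3 : ketbra ξ * ketbra ψ * ketbra ξ = ((1 - s ^ 2 : ℝ) : ℂ) • ketbra ξ := by
    rw [ketbra_mul_ketbra, Matrix.smul_mul, ketbra, Matrix.vecMulVec_mul_vecMulVec,
      hz', Matrix.vecMulVec_smul, smul_smul, ← hz, hzz]
  have e4 : ketbra ψ * ketbra ξ * ketbra ψ = ((1 - s ^ 2 : ℝ) : ℂ) • ketbra ψ := by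
    rw [ketbra_mul_ketbra, Matrix.smul_mul, ketbra, Matrix.vecMulVec_mul_vecMulVec,
      hz', Matrix.vecMulVec_smul, smul_smul, ← hz, mul_comm, hzz]
  have hcube : A * A * A = ((s ^ 2 : ℝ) : ℂ) • A := by
    have : A * A * A = ketbra ξ * ketbra ξ * ketbra ξ - ketbra ξ * ketbra ξ * ketbra ψ
        - ketbra ξ * ketbra ψ * ketbra ξ + ketbra ξ * (ketbra ψ * ketbra ψ)
        - ketbra ψ * (ketbra ξ * ketbra ξ) + ketbra ψ * ketbra ξ * ketbra ψ
        + ketbra ψ * ketbra ψ * ketbra ξ - ketbra ψ * ketbra ψ * ketbra ψ := by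
      rw [hA]; noncomm_ring
    rw [this, e1, e2, e1, e2, e3, e4, hA]
    push_cast
    module
  have hsq : (A.conjTranspose * A) * (A.conjTranspose * A) =
      ((s ^ 2 : ℝ) : ℂ) • (A.conjTranspose * A) := by
    rw [hherm, ← Matrix.mul_assoc, hcube, Matrix.smul_mul]
  have htr : (A.conjTranspose * A).trace.re = 2 * s ^ 2 := by
    have : A * A = ketbra ξ * ketbra ξ - ketbra ξ * ketbra ψ - ketbra ψ * ketbra ξ
        + ketbra ψ * ketbra ψ := by rw [hA]; noncomm_ring
    rw [hherm, this]
    simp only [Matrix.trace_add, Matrix.trace_sub, ketbra_mul_ketbra, Matrix.trace_smul,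
      Matrix.trace_vecMulVec]
    rw [show star ξ ⬝ᵥ ξ = 1 from hξ, show star ψ ⬝ᵥ ψ = 1 from hψ,
      dotProduct_comm ξ, dotProduct_comm ψ, dotProduct_comm ξ, dotProduct_comm ψ,
      show star ξ ⬝ᵥ ξ = 1 from hξ, show star ψ ⬝ᵥ ψ = 1 from hψ, ← hz, hz', smul_eq_mul,
      smul_eq_mul, smul_eq_mul, mul_comm (star z), hzz]
    simp [-Complex.ofReal_pow]
    ring
  have hmain := traceNorm_of_sq A s (Real.sqrt_nonneg _) hsq
  rw [htr] at hmain
  rcases eq_or_ne s 0 with h0 | h0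
  · have hz0 : (A.conjTranspose * A).trace = 0 := by
      have hp := (Matrix.posSemidef_conjTranspose_mul_self A).trace_nonneg
      rw [Complex.le_def] at hp
      apply Complex.ext
      · rw [htr, h0]; simp
      · exact hp.2.symm
    have hA0 : A = 0 := Matrix.trace_conjTranspose_mul_self_eq_zero_iff.1 hz0
    have hev : (Matrix.isHermitian_conjTranspose_mul_self A).eigenvalues = 0 := by
      rw [Matrix.IsHermitian.eigenvalues_eq_zero_iff, hA0]; simp
    rw [traceDist, ← hA, h0, traceNorm, hev]
    simp
  · have : traceNorm A = 2 * s := mul_left_cancel₀ h0 (by rw [hmain]; ring)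
    rw [traceDist, ← hA, this]; ring

/-! ### Outcome and acceptance probabilities -/

namespace POVM

variable {κ : Type*} [Fintype κ] [DecidableEq κ] (M : POVM κ)

theorem re_star_dotProduct_effect_nonneg (x : Fin M.numOutcomes) (t : κ → ℂ) :
    0 ≤ (star t ⬝ᵥ (M.effect x).mulVec t).re :=
  (Complex.le_def.1 ((M.posSemidef x).dotProduct_mulVec_nonneg t)).1

theorem sum_re_star_dotProduct_effect (t : κ → ℂ) :
    ∑ x, (star t ⬝ᵥ (M.effect x).mulVec t).re = sqNorm t := by
  rw [← Complex.re_sum, ← dotProduct_sum, ← Matrix.sum_mulVec, M.sum_eq_one, Matrix.one_mulVec,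
    star_dotProduct_self, Complex.ofReal_re]

theorem re_star_dotProduct_effect_pos {x : Fin M.numOutcomes} {t : κ → ℂ}
    (h : (M.effect x).mulVec t ≠ 0) : 0 < (star t ⬝ᵥ (M.effect x).mulVec t).re := by
  refine (M.re_star_dotProduct_effect_nonneg x t).lt_of_ne fun h0 => h ?_
  rw [← (M.posSemidef x).dotProduct_mulVec_zero_iff]
  exact Complex.ext h0.symm
    (Complex.le_def.1 ((M.posSemidef x).dotProduct_mulVec_nonneg t)).2.symm

end POVM

namespace AdaptiveTest

variable {κ : Type*} [Fintype κ] [DecidableEq κ] {ℓ : ℕ}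

theorem acceptProb_round {k : ℕ} (M : POVM (Fin ℓ → κ))
    (next : Fin M.numOutcomes → AdaptiveTest κ ℓ k) (ψ : κ → ℂ) :
    (round M next).acceptProb (ketbra ψ) =
      ∑ x, (star (tpow ψ ℓ) ⬝ᵥ (M.effect x).mulVec (tpow ψ ℓ)).re *
        (next x).acceptProb (ketbra ψ) := by
  simp only [acceptProb, tensorPow_ketbra, trace_mul_ketbra]

theorem acceptProb_nonneg {k : ℕ} (T : AdaptiveTest κ ℓ k) (ψ : κ → ℂ) :
    0 ≤ T.acceptProb (ketbra ψ) := by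
  induction T with
  | output b => cases b <;> simp [acceptProb]
  | round M next ih =>
    rw [acceptProb_round]
    exact Finset.sum_nonneg fun x _ => mul_nonneg (M.re_star_dotProduct_effect_nonneg x _) (ih x)

theorem acceptProb_le_one {k : ℕ} (T : AdaptiveTest κ ℓ k) {ψ : κ → ℂ} (hψ : IsUnitVector ψ) :
    T.acceptProb (ketbra ψ) ≤ 1 := by
  induction T with
  | output b => cases b <;> simp [acceptProb]
  | round M next ih =>
    rw [acceptProb_round]
    refine (Finset.sum_le_sum fun x _ => mul_le_of_le_one_right
      (M.re_star_dotProduct_effect_nonneg x _) (ih x)).trans ?_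
    rw [M.sum_re_star_dotProduct_effect, sqNorm_tpow, (isUnitVector_iff ψ).1 hψ, one_pow]

/-- A weighted average of numbers at most 1 can equal 1 only if every positively weighted one does.
-/
theorem acceptProb_next_eq_one {k : ℕ} (M : POVM (Fin ℓ → κ))
    (next : Fin M.numOutcomes → AdaptiveTest κ ℓ k) {ψ : κ → ℂ} (hψ : IsUnitVector ψ)
    (h : (round M next).acceptProb (ketbra ψ) = 1) (x : Fin M.numOutcomes)
    (hx : (M.effect x).mulVec (tpow ψ ℓ) ≠ 0) : (next x).acceptProb (ketbra ψ) = 1 := by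
  have hsum : ∑ x, (star (tpow ψ ℓ) ⬝ᵥ (M.effect x).mulVec (tpow ψ ℓ)).re *
      (1 - (next x).acceptProb (ketbra ψ)) = 0 := by
    simp only [mul_sub, Finset.sum_sub_distrib, mul_one]
    rw [← acceptProb_round, h, M.sum_re_star_dotProduct_effect, sqNorm_tpow,
      (isUnitVector_iff ψ).1 hψ, one_pow, sub_self]
  have h0 := (Finset.sum_eq_zero_iff_of_nonneg fun x _ => mul_nonneg
    (M.re_star_dotProduct_effect_nonneg x _)
      (sub_nonneg.2 ((next x).acceptProb_le_one hψ))).1 hsum x (Finset.mem_univ x)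
  have := (mul_eq_zero.1 h0).resolve_left (M.re_star_dotProduct_effect_pos hx).ne'
  linarith

end AdaptiveTest

/-! ### Perfect completeness on an irreducible family -/

/-- On the complex line joining a point of an open zero set to a point where f ≠ 0, the one-variable
identity theorem gives a contradiction. This plays the role of irreducibility of the family:
finitely many conditions, each satisfiable, hold together on an open dense set. -/
theorem Differentiable.dense_ne_zero {Θ : Type*} [NormedAddCommGroup Θ] [NormedSpace ℂ Θ]
    {f : Θ → ℂ} (hf : Differentiable ℂ f) (hne : ∃ θ, f θ ≠ 0) : Dense {θ | f θ ≠ 0} := by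
  obtain ⟨θ₁, hθ₁⟩ := hne
  refine dense_iff_inter_open.2 fun U hU ⟨θ₀, hθ₀⟩ => ?_
  by_contra hempty
  have hzero : ∀ θ ∈ U, f θ = 0 := fun θ hθ => by
    by_contra h
    exact hempty ⟨θ, hθ, h⟩
  have hline : Differentiable ℂ fun t : ℂ => θ₀ + t • (θ₁ - θ₀) := by fun_prop
  have hg : Differentiable ℂ fun t : ℂ => f (θ₀ + t • (θ₁ - θ₀)) := hf.comp hline
  have hev : (fun t : ℂ => f (θ₀ + t • (θ₁ - θ₀))) =ᶠ[nhds 0] fun _ => 0 := by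
    have hmem : (fun t : ℂ => θ₀ + t • (θ₁ - θ₀)) ⁻¹' U ∈ nhds (0 : ℂ) :=
      hline.continuous.continuousAt.preimage_mem_nhds (hU.mem_nhds (by simpa using hθ₀))
    filter_upwards [hmem] with t ht using hzero _ ht
  have := AnalyticOnNhd.eq_of_eventuallyEq
    (fun t _ => hg.analyticAt t) (fun _ _ => analyticAt_const) hev
  exact hθ₁ (by simpa using congrFun this 1)

theorem isOpen_ne_zero_of_differentiable {Θ : Type*} [NormedAddCommGroup Θ] [NormedSpace ℂ Θ]
    {f : Θ → ℂ} (hf : Differentiable ℂ f) : IsOpen {θ | f θ ≠ 0} :=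
  isOpen_ne_fun hf.continuous continuous_const

/-- Completeness is assumed only on an open dense set of parameters, because this is what survives
conditioning on an outcome. Outcomes impossible on the whole family (`bad`) have effects that
annihilate v, so together they have probability at most ‖ψ^{⊗ℓ} - v‖² on ψ. Every other outcome is
possible for generic θ, and induction applies to its continuation. The scalar c normalizes Φ θ. -/
theorem AdaptiveTest.one_sub_mul_le_acceptProb {κ : Type*} [Fintype κ] [DecidableEq κ] {ℓ : ℕ}
    {Θ : Type*} [NormedAddCommGroup Θ] [NormedSpace ℂ Θ] {Φ : Θ → κ → ℂ}
    (hΦ : ∀ i, Differentiable ℂ fun θ => Φ θ i) (hne : ∃ θ, Φ θ ≠ 0)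
    {ψ : κ → ℂ} (hψ : IsUnitVector ψ) {v : (Fin ℓ → κ) → ℂ}
    (hv : v ∈ Submodule.span ℂ (Set.range fun θ => tpow (Φ θ) ℓ))
    {k : ℕ} (T : AdaptiveTest κ ℓ k) {U : Set Θ} (hUo : IsOpen U) (hUd : Dense U)
    (hU : ∀ θ ∈ U, ∀ c : ℂ, IsUnitVector (c • Φ θ) → T.acceptProb (ketbra (c • Φ θ)) = 1) :
    1 - k * sqNorm (tpow ψ ℓ - v) ≤ T.acceptProb (ketbra ψ) := by
  induction T generalizing U with
  | output b =>
    obtain ⟨θ₁, hθ₁⟩ := hne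
    obtain ⟨i, hi⟩ := Function.ne_iff.1 hθ₁
    -- A rejecting leaf is refuted by any parameter in U whose vector is nonzero.
    obtain ⟨θ, hθU, hθ⟩ := (hUd.inter_of_isOpen_left ((hΦ i).dense_ne_zero ⟨θ₁, hi⟩) hUo).nonempty
    have hpos : 0 < sqNorm (Φ θ) := (sqNorm_nonneg _).lt_of_ne fun h0 =>
      hθ (by rw [sqNorm_eq_zero.1 h0.symm]; rfl)
    have := hU θ hθU ((Real.sqrt (sqNorm (Φ θ)))⁻¹ : ℝ) (by
      rw [isUnitVector_iff, sqNorm_smul, Complex.norm_real, Real.norm_eq_abs, sq_abs, inv_pow,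
        Real.sq_sqrt hpos.le, inv_mul_cancel₀ hpos.ne'])
    cases b
    · simp [acceptProb] at this
    · simp [acceptProb]
  | @round k M next ih =>
    set D := sqNorm (tpow ψ ℓ - v) with hD
    set t := tpow ψ ℓ with ht
    have htn : sqNorm t = 1 := by rw [ht, sqNorm_tpow, (isUnitVector_iff ψ).1 hψ, one_pow]
    let bad : Fin M.numOutcomes → Prop := fun x => ∀ θ, (M.effect x).mulVec (tpow (Φ θ) ℓ) = 0
    have hgood : ∀ x, ¬ bad x → 1 - k * D ≤ (next x).acceptProb (ketbra ψ) := by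
      intro x hx
      simp only [bad, not_forall] at hx
      obtain ⟨θ₁, hθ₁⟩ := hx
      obtain ⟨y, hy⟩ := Function.ne_iff.1 hθ₁
      have hdiff : Differentiable ℂ fun θ => (M.effect x).mulVec (tpow (Φ θ) ℓ) y := by
        simp only [Matrix.mulVec, dotProduct, tpow]
        fun_prop
      refine ih x (hUo.inter (isOpen_ne_zero_of_differentiable hdiff))
        (hUd.inter_of_isOpen_left (hdiff.dense_ne_zero ⟨θ₁, hy⟩) hUo) fun θ hθ c hc => ?_
      refine acceptProb_next_eq_one M next hc (hU θ hθ.1 c hc) x fun h0 => ?_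
      rw [tpow_smul, Matrix.mulVec_smul, smul_eq_zero] at h0
      rcases h0 with h0 | h0
      · rw [isUnitVector_iff, sqNorm_smul] at hc
        rcases ℓ.eq_zero_or_pos with hl | hl
        · subst hl; simp at h0
        · rw [pow_eq_zero_iff hl.ne'] at h0
          simp [h0] at hc
      · exact hθ.2 (by rw [h0]; rfl)
    have hbad : ∀ x, bad x → (star t ⬝ᵥ (M.effect x).mulVec t).re =
        (star (t - v) ⬝ᵥ (M.effect x).mulVec (t - v)).re := by
      intro x hx
      have h0 : (M.effect x).mulVec v = 0 := by
        have hle : Submodule.span ℂ (Set.range fun θ => tpow (Φ θ) ℓ) ≤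
            LinearMap.ker (M.effect x).mulVecLin := by
          rw [Submodule.span_le]
          rintro _ ⟨θ, rfl⟩
          exact hx θ
        exact hle hv
      have h1 : star v ⬝ᵥ (M.effect x).mulVec t = 0 := by
        rw [Matrix.dotProduct_mulVec]
        have : Matrix.vecMul (star v) (M.effect x) = star ((M.effect x).mulVec v) := by
          rw [Matrix.star_mulVec, (M.posSemidef x).isHermitian.eq]
        rw [this, h0, star_zero, zero_dotProduct]
      rw [Matrix.mulVec_sub, h0, sub_zero, star_sub, sub_dotProduct, h1, sub_zero]
    classical
    have hbadsum : ∑ x with bad x, (star t ⬝ᵥ (M.effect x).mulVec t).re ≤ D := by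
      rw [hD, ← M.sum_re_star_dotProduct_effect]
      refine (Finset.sum_congr rfl fun x hx => hbad x (Finset.mem_filter.1 hx).2).trans_le ?_
      exact Finset.sum_le_univ_sum_of_nonneg fun x => M.re_star_dotProduct_effect_nonneg x _
    have htot := M.sum_re_star_dotProduct_effect t
    rw [htn, ← Finset.sum_filter_add_sum_filter_not Finset.univ bad] at htot
    rw [acceptProb_round, ← Finset.sum_filter_add_sum_filter_not Finset.univ bad]
    have hb0 : 0 ≤ ∑ x with bad x, (star t ⬝ᵥ (M.effect x).mulVec t).re :=
      Finset.sum_nonneg fun x _ => M.re_star_dotProduct_effect_nonneg x _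
    have h1 : 0 ≤ ∑ x with bad x, (star t ⬝ᵥ (M.effect x).mulVec t).re *
        (next x).acceptProb (ketbra ψ) :=
      Finset.sum_nonneg fun x _ => mul_nonneg (M.re_star_dotProduct_effect_nonneg x _)
        ((next x).acceptProb_nonneg ψ)
    have h2 : (∑ x with ¬ bad x, (star t ⬝ᵥ (M.effect x).mulVec t).re) * (1 - k * D) ≤
        ∑ x with ¬ bad x, (star t ⬝ᵥ (M.effect x).mulVec t).re *
          (next x).acceptProb (ketbra ψ) := by
      rw [Finset.sum_mul]
      exact Finset.sum_le_sum fun x hx => mul_le_mul_of_nonneg_left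
        (hgood x (Finset.mem_filter.1 hx).2) (M.re_star_dotProduct_effect_nonneg x _)
    have hD0 : 0 ≤ k * D := mul_nonneg (Nat.cast_nonneg _) (sqNorm_nonneg _)
    -- Since g ≥ 1 - D, the loss D of this round is added to the loss k * D of the later ones.
    set g := ∑ x with ¬ bad x, (star t ⬝ᵥ (M.effect x).mulVec t).re
    have hg1 : g * (k * D) ≤ k * D := mul_le_of_le_one_left hD0 (by linarith)
    push_cast
    nlinarith

/-! ### Matrices of bounded rank -/

/-- The columns of U form an orthonormal basis of the range of M, so U U* is the projection onto
that range. -/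
theorem Matrix.exists_orthonormal_columns {m n : Type*} [Fintype m] [Fintype n] [DecidableEq m]
    [DecidableEq n] (M : Matrix m n ℂ) :
    ∃ U : Matrix m (Fin M.rank) ℂ, U.conjTranspose * U = 1 ∧ U * (U.conjTranspose * M) = M := by
  set K := LinearMap.range (Matrix.toEuclideanLin M) with hK
  have hrank : Module.finrank ℂ K = M.rank := by
    rw [Matrix.rank_eq_finrank_range_toLin M (EuclideanSpace.basisFun m ℂ).toBasis
      (EuclideanSpace.basisFun n ℂ).toBasis]
    rfl
  let b : OrthonormalBasis (Fin M.rank) ℂ K :=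
    (stdOrthonormalBasis ℂ K).reindex (finCongr hrank)
  have hinner (v w : EuclideanSpace ℂ m) : inner ℂ v w = ∑ i, star (v i) * w i := by
    rw [EuclideanSpace.inner_eq_star_dotProduct, dotProduct_comm]; rfl
  refine ⟨Matrix.of fun i k => (b k : EuclideanSpace ℂ m) i, ?_, ?_⟩
  · ext k l
    have h := orthonormal_iff_ite.1 b.orthonormal k l
    rw [Submodule.coe_inner, hinner] at h
    simpa [Matrix.mul_apply, Matrix.one_apply] using h
  · ext i j
    have hmem : (WithLp.toLp 2 fun i => M i j : EuclideanSpace ℂ m) ∈ K := by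
      refine ⟨WithLp.toLp 2 (Pi.single j 1), ?_⟩
      ext i
      simp [Matrix.toEuclideanLin]
    have h := b.sum_repr' ⟨_, hmem⟩
    have h' := congrArg (fun v : K => (v : EuclideanSpace ℂ m) i) h
    simp only [Submodule.coe_sum, Submodule.coe_smul, WithLp.ofLp_sum, Finset.sum_apply,
      Submodule.coe_inner, hinner, WithLp.ofLp_smul, Pi.smul_apply, smul_eq_mul] at h'
    simp only [Matrix.mul_apply, Matrix.conjTranspose_apply, Matrix.of_apply]
    rw [← h']
    exact Finset.sum_congr rfl fun k _ => mul_comm _ _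

theorem Matrix.exists_mul_eq_of_rank_le {m n : Type*} [Fintype m] [Fintype n] [DecidableEq m]
    [DecidableEq n] (M : Matrix m n ℂ) {r : ℕ} (h : M.rank ≤ r) :
    ∃ (A : Matrix m (Fin r) ℂ) (B : Matrix (Fin r) n ℂ), A * B = M := by
  obtain ⟨U, -, hU⟩ := M.exists_orthonormal_columns
  refine ⟨Matrix.of fun i k => if hk : (k : ℕ) < M.rank then U i ⟨k, hk⟩ else 0,
    Matrix.of fun k j => if hk : (k : ℕ) < M.rank then (U.conjTranspose * M) ⟨k, hk⟩ j else 0, ?_⟩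
  conv_rhs => rw [← hU]
  ext i j
  simp only [Matrix.mul_apply (M := U), Matrix.mul_apply (M := Matrix.of _), Matrix.of_apply]
  symm
  apply Finset.sum_of_injOn (Fin.castLE h) (Fin.castLE_injective h).injOn (fun _ _ => by simp)
  · intro k _ hk
    have : ¬ (k : ℕ) < M.rank := fun hlt => hk ⟨⟨k, hlt⟩, by simp, rfl⟩
    simp [this]
  · intro k _
    simp

theorem Matrix.rank_mul_le_card {m n : Type*} [Fintype m] [Fintype n] {r : ℕ}
    (A : Matrix m (Fin r) ℂ) (B : Matrix (Fin r) n ℂ) : (A * B).rank ≤ r :=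
  (Matrix.rank_mul_le_left A B).trans (by simpa using A.rank_le_card_width)

/-- With P the projection onto the range of X, this is Cauchy–Schwarz for tr X = tr (P X), as the
squared Frobenius norm of P is its trace, the rank. -/
theorem Matrix.norm_trace_sq_le {m : Type*} [Fintype m] [DecidableEq m] (X : Matrix m m ℂ) :
    ‖X.trace‖ ^ 2 ≤ X.rank * ∑ i, ∑ j, ‖X i j‖ ^ 2 := by
  obtain ⟨U, hU1, hU2⟩ := X.exists_orthonormal_columns
  set P := U * U.conjTranspose with hP
  have hPX : P * X = X := by rw [hP, Matrix.mul_assoc, hU2]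
  have hPh : P.conjTranspose = P := by rw [hP]; simp
  have hPP : P * P = P := by
    rw [hP, Matrix.mul_assoc, ← Matrix.mul_assoc U.conjTranspose, hU1, Matrix.one_mul]
  have htr : P.trace = X.rank := by
    rw [hP, Matrix.trace_mul_comm, hU1]; simp
  have h1 : X.trace = star (fun p : m × m => P p.1 p.2) ⬝ᵥ fun p : m × m => X p.1 p.2 := by
    conv_lhs => rw [← hPX, ← hPh]
    simp only [Matrix.trace, Matrix.diag_apply, Matrix.mul_apply, dotProduct, Fintype.sum_prod_type,
      Matrix.conjTranspose_apply, Pi.star_apply]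
    exact Finset.sum_comm
  have h2 : ((sqNorm fun p : m × m => P p.1 p.2 : ℝ) : ℂ) = X.rank := by
    rw [← star_dotProduct_self, ← htr]
    conv_rhs => rw [← hPP]
    conv_rhs => enter [1, 1]; rw [← hPh]
    simp only [Matrix.trace, Matrix.diag_apply, Matrix.mul_apply, dotProduct, Fintype.sum_prod_type,
      Matrix.conjTranspose_apply, Pi.star_apply]
    exact Finset.sum_comm
  have h3 : (sqNorm fun p : m × m => P p.1 p.2) = X.rank := by exact_mod_cast h2
  rw [h1]
  refine (norm_star_dotProduct_sq_le _ _).trans_eq ?_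
  rw [h3, sqNorm, Fintype.sum_prod_type]

/-! ### Schmidt rank across a cut -/

/-- `ξ` is a sum of `r` products of a function of the coordinates in `S` and a function of the
other coordinates. -/
def HasCutRank {V : Type*} {α : V → Type*} (S : Set V) (r : ℕ) (ξ : ((v : V) → α v) → ℂ) : Prop :=
  ∃ A B : Fin r → ((v : V) → α v) → ℂ, (∀ k, DependsOn (A k) S) ∧ (∀ k, DependsOn (B k) Sᶜ) ∧
    ∀ x, ξ x = ∑ k, A k x * B k x

theorem HasCutRank.compl {V : Type*} {α : V → Type*} {S : Set V} {r : ℕ}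
    {ξ : ((v : V) → α v) → ℂ} (h : HasCutRank S r ξ) : HasCutRank Sᶜ r ξ := by
  obtain ⟨A, B, hA, hB, h⟩ := h
  exact ⟨B, A, hB, by simpa using hA, fun x => by simp only [h x, mul_comm]⟩

theorem HasCutRank.smul {V : Type*} {α : V → Type*} {S : Set V} {r : ℕ}
    {ξ : ((v : V) → α v) → ℂ} (h : HasCutRank S r ξ) (c : ℂ) : HasCutRank S r (c • ξ) := by
  obtain ⟨A, B, hA, hB, h⟩ := h
  refine ⟨fun k => c • A k, B, fun k x y hxy => ?_, hB, fun x => ?_⟩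
  · simp [hA k hxy]
  · simp [h x, Finset.mul_sum, mul_assoc]

theorem schmidtRank_le_iff {V : Type*} [Fintype V] {d : V → ℕ} (S : Set V) (ψ : ProdIdx d → ℂ)
    (r : ℕ) : schmidtRank S ψ ≤ r ↔ HasCutRank S r ψ := by
  classical
  rw [schmidtRank]
  constructor
  · intro h
    obtain ⟨A, B, hAB⟩ := Matrix.exists_mul_eq_of_rank_le _ h
    refine ⟨fun k x => A (fun v => x v) k, fun k x => B k (fun v => x v), fun k x y hxy => ?_,
      fun k x y hxy => ?_, fun x => ?_⟩
    · have : (fun v : {v // v ∈ S} => x v) = fun v : {v // v ∈ S} => y v := funext fun v => hxy v v.2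
      simp only [this]
    · have : (fun v : {v // v ∉ S} => x v) = fun v : {v // v ∉ S} => y v := funext fun v => hxy v v.2
      simp only [this]
    · have := congrFun (congrFun hAB fun v => x v) fun v => x v
      rw [Matrix.mul_apply] at this
      rw [this, Matrix.of_apply]
      congr 1
      exact (((Equiv.piEquivPiSubtypeProd (fun v => v ∈ S) (fun v => Fin (d v))).symm_apply_apply
        x)).symm
  · rintro ⟨A, B, hA, hB, h⟩
    set e := Equiv.piEquivPiSubtypeProd (fun v => v ∈ S) (fun v => Fin (d v)) with he
    have he1 (a b) (v : V) (hv : v ∈ S) : e.symm (a, b) v = a ⟨v, hv⟩ := by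
      simp [he, Equiv.piEquivPiSubtypeProd, hv]
    have he2 (a b) (v : V) (hv : v ∉ S) : e.symm (a, b) v = b ⟨v, hv⟩ := by
      simp [he, Equiv.piEquivPiSubtypeProd, hv]
    -- A base point fills in the coordinates that A k and B k ignore; if there is none, the matrix
    -- has no entries.
    rcases isEmpty_or_nonempty (ProdIdx d) with hemp | ⟨⟨x₀⟩⟩
    · convert (Nat.zero_le r)
      refine (congrArg Matrix.rank (?_ : _ = (0 : Matrix _ _ ℂ))).trans Matrix.rank_zero
      ext a b
      exact hemp.elim (e.symm (a, b))
    · convert Matrix.rank_mul_le_card (Matrix.of fun a k => A k (e.symm (a, (e x₀).2)))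
        (Matrix.of fun k b => B k (e.symm ((e x₀).1, b)))
      ext a b
      rw [Matrix.mul_apply, Matrix.of_apply, h]
      refine Finset.sum_congr rfl fun k _ => ?_
      rw [Matrix.of_apply, Matrix.of_apply]
      congr 1
      · exact hA k fun v hv => by rw [he1 _ _ _ hv, he1 _ _ _ hv]
      · exact hB k fun v hv => by rw [he2 _ _ _ hv, he2 _ _ _ hv]

/-! ### Symmetrization and polarization -/

/-- Polarization by inclusion–exclusion: in the sum over J with signs (-1)^|Jᶜ|, the coefficient of
an index map p is the sum over J containing its image, which vanishes unless p is surjective, that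
is, a permutation. -/
theorem MultilinearMap.sum_perm_eq_zero {R M N : Type*} [CommRing R] [AddCommGroup M] [Module R M]
    [AddCommGroup N] [Module R N] {ℓ : ℕ} (T : MultilinearMap R (fun _ : Fin ℓ => M) N)
    (Z : Fin ℓ → M) (h : ∀ J : Finset (Fin ℓ), T (fun _ => ∑ k ∈ J, Z k) = 0) :
    ∑ π : Equiv.Perm (Fin ℓ), T (fun i => Z (π i)) = 0 := by
  classical
  have key : ∑ J : Finset (Fin ℓ), (-1 : ℤ) ^ Jᶜ.card • T (fun _ => ∑ k ∈ J, Z k) =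
      ∑ p : Fin ℓ → Fin ℓ, (if Function.Surjective p then (1 : ℤ) else 0) •
        T (fun i => Z (p i)) := by
    have h1 : ∀ J : Finset (Fin ℓ), T (fun _ => ∑ k ∈ J, Z k) =
        ∑ p : Fin ℓ → Fin ℓ, (if Finset.univ.image p ⊆ J then (1 : ℤ) else 0) •
          T (fun i => Z (p i)) := by
      intro J
      rw [MultilinearMap.map_sum_finset T (fun _ => Z) fun _ => J]
      simp only [ite_smul, one_smul, zero_smul]
      rw [← Finset.sum_filter]
      refine Finset.sum_congr ?_ fun _ _ => rfl
      ext p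
      simp [Finset.image_subset_iff]
    simp only [h1, Finset.smul_sum, smul_smul]
    rw [Finset.sum_comm]
    refine Finset.sum_congr rfl fun p _ => ?_
    rw [← Finset.sum_smul]
    congr 1
    have h2 := Finset.sum_powerset_neg_one_pow_card (x := (Finset.univ.image p)ᶜ)
    simp only [mul_ite, mul_one, mul_zero]
    rw [← Finset.sum_filter]
    trans ∑ m ∈ ((Finset.univ.image p)ᶜ).powerset, (-1 : ℤ) ^ m.card
    · refine Finset.sum_nbij' compl compl (fun J hJ => ?_) (fun J hJ => ?_) (by simp) (by simp)
        (by simp)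
      · rw [Finset.mem_powerset]
        exact Finset.compl_subset_compl.2 (Finset.mem_filter.1 hJ).2
      · rw [Finset.mem_powerset] at hJ
        exact Finset.mem_filter.2 ⟨Finset.mem_univ _, Finset.subset_compl_comm.1 hJ⟩
    · rw [h2]
      refine if_congr ?_ rfl rfl
      simp [Finset.eq_univ_iff_forall, Function.Surjective]
  simp only [h, smul_zero, Finset.sum_const_zero, ite_smul, one_smul, zero_smul] at key
  rw [← Finset.sum_filter] at key
  rw [key]
  refine Finset.sum_bij' (fun π _ => (π : Fin ℓ → Fin ℓ))
    (fun p hp => Equiv.ofBijective p ((Finite.injective_iff_bijective).1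
      (Finite.injective_iff_surjective.2 (Finset.mem_filter.1 hp).2)))
    (fun π _ => Finset.mem_filter.2 ⟨Finset.mem_univ _, π.surjective⟩) (fun _ _ => Finset.mem_univ _)
    (fun π _ => by ext; simp) (fun p _ => by ext; simp) (fun _ _ => rfl)

/-! ### The antisymmetric component of a tensor power -/

/-- `X` is a sum of `r` product functions: as a matrix, it has rank at most `r`. -/
def HasRankLE {α β : Type*} (r : ℕ) (X : α × β → ℂ) : Prop :=
  ∃ (A : Fin r → α → ℂ) (B : Fin r → β → ℂ), ∀ p, X p = ∑ k, A k p.1 * B k p.2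

section detForm

variable {α β : Type*} {ℓ : ℕ}

/-- The action of a permutation of the tensor factors on the second subsystem only. -/
def permSnd (σ : Equiv.Perm (Fin ℓ)) : (Fin ℓ → α × β) ≃ (Fin ℓ → α × β) where
  toFun y i := ((y i).1, (y (σ i)).2)
  invFun y i := ((y i).1, (y (σ.symm i)).2)
  left_inv y := by ext i <;> simp
  right_inv y := by ext i <;> simp

theorem permSnd_apply (σ : Equiv.Perm (Fin ℓ)) (y : Fin ℓ → α × β) (i : Fin ℓ) :
    permSnd σ y i = ((y i).1, (y (σ i)).2) := rfl

/-- The component of `X ⊗ ⋯ ⊗ X` that is antisymmetric in each of the two subsystems. -/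
def detForm (X : α × β → ℂ) (ℓ : ℕ) : (Fin ℓ → α × β) → ℂ :=
  fun y => (ℓ ! : ℂ)⁻¹ * (Matrix.of fun i j => X ((y j).1, (y i).2)).det

theorem detForm_eq_sum (X : α × β → ℂ) (y : Fin ℓ → α × β) :
    detForm X ℓ y = (ℓ ! : ℂ)⁻¹ * ∑ σ : Equiv.Perm (Fin ℓ),
      ((Equiv.Perm.sign σ : ℤ) : ℂ) * tpow X ℓ (permSnd σ y) := by
  rw [detForm, Matrix.det_apply']
  rfl

theorem detForm_permSnd (X : α × β → ℂ) (σ : Equiv.Perm (Fin ℓ)) (y : Fin ℓ → α × β) :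
    detForm X ℓ (permSnd σ y) = ((Equiv.Perm.sign σ : ℤ) : ℂ) * detForm X ℓ y := by
  have := Matrix.det_permute σ (Matrix.of fun i j => X ((y j).1, (y i).2))
  rw [detForm, detForm, mul_left_comm, ← this]
  rfl

theorem detForm_comp_perm (X : α × β → ℂ) (σ : Equiv.Perm (Fin ℓ)) (y : Fin ℓ → α × β) :
    detForm X ℓ (fun i => y (σ i)) = detForm X ℓ y := by
  have := Matrix.det_submatrix_equiv_self σ (Matrix.of fun i j => X ((y j).1, (y i).2))
  rw [detForm, detForm, ← this]
  rfl

theorem tpow_comp_perm {κ : Type*} (X : κ → ℂ) (σ : Equiv.Perm (Fin ℓ)) (y : Fin ℓ → κ) :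
    tpow X ℓ (fun i => y (σ i)) = tpow X ℓ y :=
  Equiv.prod_comp σ fun i => X (y i)

theorem detForm_eq_zero {r : ℕ} (hr : r < ℓ) {X : α × β → ℂ} (hX : HasRankLE r X) :
    detForm X ℓ = 0 := by
  obtain ⟨A, B, h⟩ := hX
  ext y
  have hM : (Matrix.of fun i j : Fin ℓ => X ((y j).1, (y i).2)) =
      (Matrix.of fun (i : Fin ℓ) (k : Fin r) => B k (y i).2) *
        (Matrix.of fun (k : Fin r) (j : Fin ℓ) => A k (y j).1) := by
    ext i j
    simp [Matrix.mul_apply, h, mul_comm]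
  have hrank := Matrix.rank_mul_le_card (Matrix.of fun (i : Fin ℓ) (k : Fin r) => B k (y i).2)
    (Matrix.of fun (k : Fin r) (j : Fin ℓ) => A k (y j).1)
  rw [← hM] at hrank
  have hdet : (Matrix.of fun i j : Fin ℓ => X ((y j).1, (y i).2)).det = 0 := by
    by_contra hne
    have := Matrix.rank_of_isUnit _ ((Matrix.isUnit_iff_isUnit_det _).2 (isUnit_iff_ne_zero.2 hne))
    rw [Fintype.card_fin] at this
    omega
  rw [detForm, hdet, mul_zero]
  rfl

theorem sum_detForm_eq_of_alternating [Fintype α] [Fintype β] [DecidableEq α] [DecidableEq β]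
    (X : α × β → ℂ) (C : (Fin ℓ → α × β) → ℂ)
    (hC : ∀ σ y, C (permSnd σ y) = ((Equiv.Perm.sign σ : ℤ) : ℂ) * C y) :
    ∑ y, C y * detForm X ℓ y = ∑ y, C y * tpow X ℓ y := by
  have h1 : ∀ σ : Equiv.Perm (Fin ℓ), ∑ y, C y * (((Equiv.Perm.sign σ : ℤ) : ℂ) *
      tpow X ℓ (permSnd σ y)) = ∑ y, C y * tpow X ℓ y := by
    intro σ
    rw [← Equiv.sum_comp (permSnd σ) fun y => C y * tpow X ℓ y]
    refine Finset.sum_congr rfl fun y _ => ?_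
    rw [hC]
    ring
  simp only [detForm_eq_sum, Finset.mul_sum, mul_left_comm _ ((ℓ ! : ℂ)⁻¹)]
  rw [Finset.sum_comm]
  simp only [← Finset.mul_sum, h1, Finset.sum_const]
  rw [Finset.card_univ, Fintype.card_perm, Fintype.card_fin, nsmul_eq_mul, inv_mul_cancel_left₀]
  exact_mod_cast Nat.factorial_ne_zero ℓ

/-- `detForm` behaves as an orthogonal projection of the tensor power, so only the antisymmetric
component of the other vector contributes to the overlap. -/
theorem star_detForm_dotProduct_tpow [Fintype α] [Fintype β] [DecidableEq α] [DecidableEq β]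
    (X Y : α × β → ℂ) :
    star (detForm X ℓ) ⬝ᵥ tpow Y ℓ = star (detForm X ℓ) ⬝ᵥ detForm Y ℓ := by
  refine (sum_detForm_eq_of_alternating Y _ fun σ y => ?_).symm
  simp [detForm_permSnd]

/-- By duality, let f vanish on the powers of all Y of rank at most r. Its coefficients, symmetrized
over the r + 1 factors, are alternating in the second subsystem: by polarization they are
combinations of values of f on powers of partial sums of product vectors, and these sums have rank
at most r as soon as two of the second factors coincide. Hence f sees only the antisymmetric
component of X^{⊗(r+1)}. -/
theorem tpow_sub_detForm_mem_span [Fintype α] [Fintype β] [DecidableEq α] [DecidableEq β] {r : ℕ}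
    (X : α × β → ℂ) : tpow X (r + 1) - detForm X (r + 1) ∈
      Submodule.span ℂ ((fun Y => tpow Y (r + 1)) '' {Y : α × β → ℂ | HasRankLE r Y}) := by
  classical
  by_contra hmem
  obtain ⟨f, hf, hker⟩ := Submodule.exists_le_ker_of_notMem hmem
  set c : (Fin (r + 1) → α × β) → ℂ := fun y => f (Pi.single y 1) with hc
  have hfc : ∀ x, f x = ∑ y, c y * x y := by
    intro x
    conv_lhs => rw [pi_eq_sum_univ' x]
    simp [hc, map_sum, mul_comm]
  let T : MultilinearMap ℂ (fun _ : Fin (r + 1) => α × β → ℂ) ℂ :=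
    ∑ y, c y • (MultilinearMap.mkPiAlgebra ℂ (Fin (r + 1)) ℂ).compLinearMap
      fun i => LinearMap.proj (y i)
  have hT : ∀ Z, T Z = ∑ y, c y * ∏ i, Z i (y i) := by
    intro Z
    simp [T]
  have hTrank : ∀ Y, HasRankLE r Y → T (fun _ => Y) = 0 := by
    intro Y hY
    rw [hT]
    have : f (tpow Y (r + 1)) = 0 := hker (Submodule.subset_span ⟨Y, hY, rfl⟩)
    rw [hfc] at this
    exact this
  let emb : α → (β → ℂ) →ₗ[ℂ] (α × β → ℂ) := fun a =>
    { toFun := fun v p => if p.1 = a then v p.2 else 0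
      map_add' := fun v w => by ext p; simp only [Pi.add_apply]; split_ifs <;> simp
      map_smul' := fun t v => by ext p; simp }
  have hemb : ∀ a v p, emb a v p = if p.1 = a then v p.2 else 0 := fun _ _ _ => rfl
  let S : (Fin (r + 1) → α) → MultilinearMap ℂ (fun _ : Fin (r + 1) => β → ℂ) ℂ := fun a =>
    (∑ π : Equiv.Perm (Fin (r + 1)), T.domDomCongr π).compLinearMap fun k => emb (a k)
  have hS : ∀ a v, S a v = ∑ π : Equiv.Perm (Fin (r + 1)), T fun i => emb (a (π i)) (v (π i)) := by
    intro a v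
    simp [S]
  have halt : ∀ a v i j, v i = v j → i ≠ j → S a v = 0 := by
    intro a v i j hij hne
    rw [hS]
    refine T.sum_perm_eq_zero (fun k => emb (a k) (v k)) fun J => hTrank _ ?_
    obtain ⟨i', rfl⟩ := Fin.exists_succAbove_eq hne
    -- Since v i = v j, the term of j is merged into that of i; the r remaining indices are
    -- enumerated by `j.succAbove`.
    refine ⟨fun k x => (if j.succAbove k ∈ J then if x = a (j.succAbove k) then 1 else 0 else 0) +
      if k = i' then (if j ∈ J then if x = a j then 1 else 0 else 0) else 0,
      fun k => v (j.succAbove k), fun p => ?_⟩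
    have hJ : (∑ k ∈ J, emb (a k) (v k)) p =
        ∑ k, if k ∈ J then (if p.1 = a k then v k p.2 else 0) else 0 := by
      rw [Finset.sum_apply, Finset.sum_ite_mem, Finset.univ_inter]
      rfl
    rw [hJ, Fin.sum_univ_succAbove _ j, ← hij]
    simp only [add_mul, Finset.sum_add_distrib, ite_mul, one_mul, zero_mul, Finset.sum_ite_eq',
      Finset.mem_univ, if_true]
    rw [add_comm]
  let g : (Fin (r + 1) → α) → AlternatingMap ℂ (β → ℂ) ℂ (Fin (r + 1)) := fun a =>
    { S a with map_eq_zero_of_eq' := halt a }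
  -- C sums c over simultaneous permutations of the factors; its values are those of the alternating
  -- maps g on basis vectors.
  set C : (Fin (r + 1) → α × β) → ℂ := fun y => ∑ π : Equiv.Perm (Fin (r + 1)), c fun i => y (π i)
    with hCdef
  have hCg : ∀ y, C y = g (fun i => (y i).1) fun i => Pi.single (y i).2 1 := by
    intro y
    change _ = S _ _
    rw [hS, hCdef]
    refine Finset.sum_congr rfl fun π _ => ?_
    rw [hT, Finset.sum_eq_single fun i => y (π i)]
    · simp [hemb]
    · intro z _ hz
      obtain ⟨i, hi⟩ := Function.ne_iff.1 hz
      rw [Finset.prod_eq_zero (Finset.mem_univ i), mul_zero]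
      rw [hemb]
      split_ifs with h1
      · rw [Pi.single_apply, if_neg]
        exact fun h2 => hi (Prod.ext h1 h2)
      · rfl
    · simp
  have hC : ∀ σ y, C (permSnd σ y) = ((Equiv.Perm.sign σ : ℤ) : ℂ) * C y := by
    intro σ y
    rw [hCg, hCg]
    have := (g fun i => (y i).1).map_perm (fun i => Pi.single (y i).2 (1 : ℂ)) σ
    simp only [permSnd_apply]
    refine this.trans ?_
    rw [Units.smul_def, zsmul_eq_mul]
  have hsymm : ∀ x : (Fin (r + 1) → α × β) → ℂ,
      (∀ (π : Equiv.Perm (Fin (r + 1))) y, x (fun i => y (π i)) = x y) →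
      ((r + 1)! : ℂ) * f x = ∑ y, C y * x y := by
    intro x hx
    simp only [hCdef, Finset.sum_mul]
    rw [Finset.sum_comm]
    have : ∀ π : Equiv.Perm (Fin (r + 1)), ∑ y, c (fun i => y (π i)) * x y = f x := by
      intro π
      rw [hfc, ← Equiv.sum_comp (Equiv.arrowCongr π.symm (Equiv.refl (α × β))) fun y => c y * x y]
      refine Finset.sum_congr rfl fun y _ => ?_
      have e : (Equiv.arrowCongr π.symm (Equiv.refl (α × β))) y = fun i => y (π i) := by
        ext i <;> simp
      rw [e, hx]
    simp only [this, Finset.sum_const]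
    rw [Finset.card_univ, Fintype.card_perm, Fintype.card_fin, nsmul_eq_mul]
  have hfin : f (tpow X (r + 1)) = f (detForm X (r + 1)) := by
    have h0 : ((r + 1)! : ℂ) ≠ 0 := by exact_mod_cast Nat.factorial_ne_zero (r + 1)
    apply mul_left_cancel₀ h0
    rw [hsymm _ fun π y => tpow_comp_perm X π y, hsymm _ fun π y => detForm_comp_perm X π y]
    exact (sum_detForm_eq_of_alternating X C hC).symm
  rw [map_sub, hfin, sub_self] at hf
  exact hf rfl

end detForm

/-! ### Sums over injective tuples -/

/-- The sum of `∏ j, w (s j)` over all injective `k`-tuples `s` that avoid `A`. -/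
def injSum {ι : Type*} [Fintype ι] [DecidableEq ι] (w : ι → ℝ) : ℕ → Finset ι → ℝ
  | 0, _ => 1
  | k + 1, A => ∑ i ∈ Aᶜ, w i * injSum w k (insert i A)

section injSum

variable {ι : Type*} [Fintype ι] [DecidableEq ι] {w : ι → ℝ}

theorem sum_injective_prod (w : ι → ℝ) (k : ℕ) (A : Finset ι) :
    (∑ s : Fin k → ι, if Function.Injective s ∧ ∀ j, s j ∉ A then ∏ j, w (s j) else 0) =
      injSum w k A := by
  induction k generalizing A with
  | zero => simp [injSum, Function.injective_of_subsingleton]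
  | succ k ih =>
    rw [injSum, ← (Fin.consEquiv fun _ => ι).sum_comp, Fintype.sum_prod_type]
    rw [← Finset.sum_subset (Finset.subset_univ Aᶜ)]
    · refine Finset.sum_congr rfl fun i hi => ?_
      rw [← ih, Finset.mul_sum]
      refine Finset.sum_congr rfl fun s _ => ?_
      rw [mul_ite, mul_zero]
      refine if_congr ?_ ?_ rfl
      · simp only [Fin.consEquiv, Equiv.coe_fn_mk, Fin.cons_injective_iff, Fin.forall_fin_succ,
          Fin.cons_zero, Fin.cons_succ, Set.mem_range, not_exists, Finset.mem_insert, not_or]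
        have := Finset.mem_compl.1 hi
        constructor
        · rintro ⟨⟨h1, h2⟩, h3, h4⟩
          exact ⟨h2, fun j => ⟨h1 j, h4 j⟩⟩
        · rintro ⟨h1, h2⟩
          exact ⟨⟨fun j => (h2 j).1, h1⟩, this, fun j => (h2 j).2⟩
      · simp [Fin.consEquiv, Fin.prod_univ_succ]
    · intro i _ hi
      refine Finset.sum_eq_zero fun s _ => if_neg fun h => ?_
      have := h.2 0
      simp only [Fin.consEquiv, Equiv.coe_fn_mk, Fin.cons_zero] at this
      exact hi (Finset.mem_compl.2 this)

theorem injSum_nonneg (hw : ∀ i, 0 ≤ w i) (k : ℕ) (A : Finset ι) : 0 ≤ injSum w k A := by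
  induction k generalizing A with
  | zero => exact zero_le_one
  | succ k ih => exact Finset.sum_nonneg fun i _ => mul_nonneg (hw i) (ih _)

/-- The entries are chosen one at a time; at most r indices are excluded at each choice, so weight
at least δ is still available. -/
theorem pow_le_injSum (hw : ∀ i, 0 ≤ w i) {δ : ℝ} (hδ : 0 ≤ δ) {r : ℕ}
    (htail : ∀ A : Finset ι, A.card ≤ r → δ ≤ ∑ i ∈ Aᶜ, w i) (k : ℕ) (A : Finset ι)
    (hA : A.card + k ≤ r + 1) : δ ^ k ≤ injSum w k A := by
  induction k generalizing A with
  | zero => simp [injSum]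
  | succ k ih =>
    calc δ ^ (k + 1) = δ * δ ^ k := pow_succ' _ _
      _ ≤ (∑ i ∈ Aᶜ, w i) * δ ^ k := by gcongr; exact htail A (by omega)
      _ = ∑ i ∈ Aᶜ, w i * δ ^ k := Finset.sum_mul _ _ _
      _ ≤ _ := Finset.sum_le_sum fun i _ => mul_le_mul_of_nonneg_left
        (ih _ (by have := Finset.card_insert_le i A; omega)) (hw i)

/-- The left side counts only the tuples that contain i₀, which may sit in any of the k + 1
positions. -/
theorem mul_injSum_insert_le (hw : ∀ i, 0 ≤ w i) (i₀ : ι) (k : ℕ) (A : Finset ι) (hA : i₀ ∉ A) :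
    (k + 1) * (w i₀ * injSum w k (insert i₀ A)) ≤ injSum w (k + 1) A := by
  induction k generalizing A with
  | zero =>
    simp only [injSum, mul_one, Nat.cast_zero, zero_add, one_mul]
    exact Finset.single_le_sum (f := w) (fun i _ => hw i) (Finset.mem_compl.2 hA)
  | succ k ih =>
    have hcompl : Aᶜ = insert i₀ (insert i₀ A)ᶜ := by
      ext i
      simp only [Finset.mem_compl, Finset.mem_insert, not_or]
      by_cases h : i = i₀ <;> simp [h, hA]
    have hrec : injSum w (k + 1 + 1) A = ∑ i ∈ Aᶜ, w i * injSum w (k + 1) (insert i A) := rfl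
    rw [hrec, hcompl, Finset.sum_insert (by simp)]
    have h1 : ((k + 1 : ℕ) : ℝ) * (w i₀ * injSum w (k + 1) (insert i₀ A)) ≤
        ∑ i ∈ (insert i₀ A)ᶜ, w i * injSum w (k + 1) (insert i A) := by
      rw [injSum, Finset.mul_sum, Finset.mul_sum]
      refine Finset.sum_le_sum fun i hi => ?_
      rw [Finset.mem_compl, Finset.mem_insert, not_or] at hi
      have := ih (insert i A) (by simp [Ne.symm hi.1, hA])
      rw [Finset.insert_comm] at this
      calc _ = w i * ((k + 1) * (w i₀ * injSum w k (insert i (insert i₀ A)))) := by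
            push_cast; ring
        _ ≤ _ := mul_le_mul_of_nonneg_left this (hw i)
    push_cast at h1 ⊢
    linarith

/-- Bounding every entry by δ would lose a factor. If some weight is at least 1/2, its r + 1
possible positions give the factor (r + 1)/2 and the other r entries give δ^r. Otherwise the first
entry ranges over weight 1, the second over at least 1/2 and the others over at least δ; the
resulting δ^(r-1)/2 suffices because δ(r + 1) ≤ 1. -/
theorem le_injSum_of_tail (hw : ∀ i, 0 ≤ w i) (hsum : ∑ i, w i = 1) {δ : ℝ} (hδ : 0 ≤ δ) {r : ℕ}
    (hr : 1 ≤ r) (hδr : δ * (r + 1) ≤ 1)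
    (htail : ∀ A : Finset ι, A.card ≤ r → δ ≤ ∑ i ∈ Aᶜ, w i) :
    (r + 1) * δ ^ r / 2 ≤ injSum w (r + 1) ∅ := by
  by_cases h : ∃ i₀, 1 / 2 ≤ w i₀
  · obtain ⟨i₀, hi₀⟩ := h
    refine le_trans ?_ (mul_injSum_insert_le hw i₀ r ∅ (by simp))
    have h1 := pow_le_injSum hw hδ htail r (insert i₀ ∅) (by simp; omega)
    calc _ = (r + 1) * (1 / 2 * δ ^ r) := by ring
      _ ≤ _ := by gcongr
  · push Not at h
    obtain ⟨r, rfl⟩ : ∃ r', r = r' + 1 := ⟨r - 1, by omega⟩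
    have h2 : ∀ i, δ ^ r / 2 ≤ injSum w (r + 1) (insert i ∅) := by
      intro i
      have htl : 1 / 2 ≤ ∑ j ∈ ({i} : Finset ι)ᶜ, w j := by
        have := Finset.sum_add_sum_compl {i} w
        rw [hsum, Finset.sum_singleton] at this
        linarith [h i]
      rw [injSum, insert_empty_eq]
      calc δ ^ r / 2 = 1 / 2 * δ ^ r := by ring
        _ ≤ (∑ j ∈ ({i} : Finset ι)ᶜ, w j) * δ ^ r := by gcongr
        _ = ∑ j ∈ ({i} : Finset ι)ᶜ, w j * δ ^ r := Finset.sum_mul _ _ _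
        _ ≤ _ := Finset.sum_le_sum fun j _ => mul_le_mul_of_nonneg_left
          (pow_le_injSum hw hδ htail r _ (by
            have := Finset.card_insert_le j ({i} : Finset ι)
            simp at this; omega)) (hw j)
    rw [injSum, Finset.compl_empty]
    calc _ = (δ * ((r + 1 : ℕ) + 1)) * (δ ^ r / 2) := by ring
      _ ≤ 1 * (δ ^ r / 2) := by gcongr
      _ = ∑ i, w i * (δ ^ r / 2) := by rw [← Finset.sum_mul, hsum]
      _ ≤ _ := Finset.sum_le_sum fun i _ => mul_le_mul_of_nonneg_left (h2 i) (hw i)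

theorem injSum_le_pow (hw : ∀ i, 0 ≤ w i) (k : ℕ) (A : Finset ι) :
    injSum w k A ≤ (∑ i ∈ Aᶜ, w i) ^ k := by
  induction k generalizing A with
  | zero => simp [injSum]
  | succ k ih =>
    rw [injSum, pow_succ', Finset.sum_mul]
    refine Finset.sum_le_sum fun i _ => mul_le_mul_of_nonneg_left ((ih _).trans ?_) (hw i)
    refine pow_le_pow_left₀ (Finset.sum_nonneg fun i _ => hw i) ?_ k
    exact Finset.sum_le_sum_of_subset_of_nonneg
      (Finset.compl_subset_compl.2 (Finset.subset_insert i A)) fun i _ _ => hw i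

/-- An injective tuple uses i₀ at most once, so some k of its k + 1 entries avoid i₀, and the
remaining entry contributes total weight at most 1. -/
theorem injSum_le_mul_pow (hw : ∀ i, 0 ≤ w i) (hsum : ∑ i, w i = 1) (i₀ : ι) (k : ℕ)
    (A : Finset ι) : injSum w (k + 1) A ≤ (k + 1) * (∑ i ∈ {i₀}ᶜ, w i) ^ k := by
  set x := ∑ i ∈ {i₀}ᶜ, w i with hx
  have hx0 : 0 ≤ x := Finset.sum_nonneg fun i _ => hw i
  have hw0 : w i₀ ≤ 1 := hsum ▸ Finset.single_le_sum (fun i _ => hw i) (Finset.mem_univ i₀)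
  induction k generalizing A with
  | zero =>
    simp only [injSum, mul_one, Nat.cast_zero, zero_add, pow_zero]
    rw [← hsum]
    exact Finset.sum_le_univ_sum_of_nonneg hw
  | succ k ih =>
    have h0 : ∀ i, 0 ≤ w i * injSum w (k + 1) (insert i A) :=
      fun i => mul_nonneg (hw i) (injSum_nonneg hw _ _)
    have h1 : injSum w (k + 1) (insert i₀ A) ≤ x ^ (k + 1) := by
      refine (injSum_le_pow hw _ _).trans (pow_le_pow_left₀ (Finset.sum_nonneg fun i _ => hw i) ?_ _)
      exact Finset.sum_le_sum_of_subset_of_nonneg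
        (Finset.compl_subset_compl.2 (by simp)) fun i _ _ => hw i
    rw [injSum]
    calc _ ≤ ∑ i, w i * injSum w (k + 1) (insert i A) := Finset.sum_le_univ_sum_of_nonneg h0
      _ = w i₀ * injSum w (k + 1) (insert i₀ A) +
          ∑ i ∈ {i₀}ᶜ, w i * injSum w (k + 1) (insert i A) := by
        rw [← Finset.sum_add_sum_compl {i₀}, Finset.sum_singleton]
      _ ≤ 1 * x ^ (k + 1) + ∑ i ∈ {i₀}ᶜ, w i * ((k + 1) * x ^ k) := by
        refine add_le_add (mul_le_mul hw0 h1 (injSum_nonneg hw _ _) zero_le_one) ?_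
        exact Finset.sum_le_sum fun i _ => mul_le_mul_of_nonneg_left (ih _) (hw i)
      _ = _ := by
        rw [← Finset.sum_mul, ← hx]
        push_cast
        ring

end injSum

/-! ### The norm of the antisymmetric component -/

theorem sum_pi_prod {ι κ R : Type*} [Fintype ι] [DecidableEq ι] [Fintype κ] [CommSemiring R]
    (f : ι → κ → R) : ∑ x : ι → κ, ∏ i, f i (x i) = ∏ i, ∑ j, f i j := by
  rw [Finset.prod_univ_sum, Fintype.piFinset_univ]

theorem det_of_eq_ite {ι : Type*} [DecidableEq ι] {ℓ : ℕ} (s : Fin ℓ → ι)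
    [Decidable (Function.Injective s)] :
    (Matrix.of fun i j => if s i = s j then (1 : ℂ) else 0).det =
      if Function.Injective s then 1 else 0 := by
  split_ifs with h
  · convert Matrix.det_one (n := Fin ℓ) (R := ℂ)
    ext i j
    simp [Matrix.one_apply, h.eq_iff]
  · simp only [Function.Injective, not_forall] at h
    obtain ⟨i, j, hij, hne⟩ := h
    exact Matrix.det_zero_of_row_eq hne (by ext k; simp [hij])

/-- Summing out the second subsystem leaves entries of the reduced matrix; expanded in its
eigenbasis u, orthonormality retains only the tuples s with s ∘ σ = s. -/
theorem sum_star_tpow_permSnd_mul_tpow {α β ι : Type*} [Fintype α] [Fintype β] [DecidableEq α]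
    [DecidableEq β] [Fintype ι] [DecidableEq ι] {ℓ : ℕ} (X : α × β → ℂ) (w : ι → ℝ)
    (u : ι → α → ℂ) (hu : ∀ s s', star (u s) ⬝ᵥ u s' = if s = s' then 1 else 0)
    (hX : ∀ a a', ∑ b, X (a, b) * star (X (a', b)) = ∑ s, w s * (u s a * star (u s a')))
    (σ : Equiv.Perm (Fin ℓ)) :
    ∑ y, star (tpow X ℓ (permSnd σ y)) * tpow X ℓ y =
      ∑ s : Fin ℓ → ι, (∏ i, (w (s i) : ℂ)) * ∏ i, if s (σ i) = s i then 1 else 0 := by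
  have h1 : ∀ y : Fin ℓ → α × β, star (tpow X ℓ (permSnd σ y)) * tpow X ℓ y =
      ∏ i, X ((y i).1, (y i).2) * star (X ((y (σ.symm i)).1, (y i).2)) := by
    intro y
    rw [Finset.prod_mul_distrib, mul_comm, tpow, tpow, star_prod]
    congr 1
    rw [← Equiv.prod_comp σ fun i => star (X ((y (σ.symm i)).1, (y i).2))]
    simp [permSnd_apply]
  simp only [h1]
  rw [← (Equiv.arrowProdEquivProdArrow (Fin ℓ) (fun _ => α) fun _ => β).symm.sum_comp,
    Fintype.sum_prod_type]
  simp only [Equiv.arrowProdEquivProdArrow, Equiv.coe_fn_symm_mk]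
  have h2 : ∀ a : Fin ℓ → α, ∑ b : Fin ℓ → β,
      ∏ i, X (a i, b i) * star (X (a (σ.symm i), b i)) =
      ∑ s : Fin ℓ → ι, (∏ i, (w (s i) : ℂ)) *
        ∏ i, star (u (s (σ i)) (a i)) * u (s i) (a i) := by
    intro a
    rw [sum_pi_prod fun i b => X (a i, b) * star (X (a (σ.symm i), b))]
    simp only [hX]
    rw [← sum_pi_prod fun i s => (w s : ℂ) * (u s (a i) * star (u s (a (σ.symm i))))]
    refine Finset.sum_congr rfl fun s _ => ?_
    rw [Finset.prod_mul_distrib, Finset.prod_mul_distrib, Finset.prod_mul_distrib]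
    congr 1
    rw [mul_comm, ← Equiv.prod_comp σ fun i => star (u (s i) (a (σ.symm i)))]
    simp
  simp only [h2]
  rw [Finset.sum_comm]
  refine Finset.sum_congr rfl fun s _ => ?_
  rw [← Finset.mul_sum, sum_pi_prod fun i a => star (u (s (σ i)) a) * u (s i) a]
  congr 1
  exact Finset.prod_congr rfl fun i _ => hu _ _

/-- For a fixed tuple s, the signed count of the σ with s ∘ σ = s is the determinant of the matrix
[s i = s j], which is 1 if s is injective and 0 otherwise. -/
theorem star_detForm_dotProduct_self {α β ι : Type*} [Fintype α] [Fintype β] [DecidableEq α]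
    [DecidableEq β] [Fintype ι] [DecidableEq ι] {ℓ : ℕ} (X : α × β → ℂ) (w : ι → ℝ)
    (u : ι → α → ℂ) (hu : ∀ s s', star (u s) ⬝ᵥ u s' = if s = s' then 1 else 0)
    (hX : ∀ a a', ∑ b, X (a, b) * star (X (a', b)) = ∑ s, w s * (u s a * star (u s a'))) :
    star (detForm X ℓ) ⬝ᵥ tpow X ℓ = ((injSum w ℓ ∅ / ℓ ! : ℝ) : ℂ) := by
  classical
  have h1 : star (detForm X ℓ) ⬝ᵥ tpow X ℓ = (ℓ ! : ℂ)⁻¹ * ∑ σ : Equiv.Perm (Fin ℓ),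
      ((Equiv.Perm.sign σ : ℤ) : ℂ) * ∑ y, star (tpow X ℓ (permSnd σ y)) * tpow X ℓ y := by
    simp only [dotProduct, Pi.star_apply, detForm_eq_sum, Finset.mul_sum, star_mul', star_sum,
      Finset.sum_mul]
    rw [Finset.sum_comm]
    refine Finset.sum_congr rfl fun σ _ => Finset.sum_congr rfl fun y _ => ?_
    simp
    ring
  simp only [h1, sum_star_tpow_permSnd_mul_tpow X w u hu hX, Finset.mul_sum]
  rw [Finset.sum_comm, ← sum_injective_prod, Finset.sum_div, Complex.ofReal_sum]
  refine Finset.sum_congr rfl fun s _ => ?_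
  have h2 := det_of_eq_ite s
  rw [Matrix.det_apply'] at h2
  simp only [Matrix.of_apply] at h2
  have h3 : ∑ σ : Equiv.Perm (Fin ℓ), (ℓ ! : ℂ)⁻¹ * (((Equiv.Perm.sign σ : ℤ) : ℂ) *
      ((∏ i, (w (s i) : ℂ)) * ∏ i, if s (σ i) = s i then 1 else 0)) =
      (ℓ ! : ℂ)⁻¹ * (∏ i, (w (s i) : ℂ)) * ∑ σ : Equiv.Perm (Fin ℓ),
        ((Equiv.Perm.sign σ : ℤ) : ℂ) * ∏ i, if s (σ i) = s i then 1 else 0 := by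
    rw [Finset.mul_sum]
    exact Finset.sum_congr rfl fun σ _ => by ring
  rw [h3, h2]
  by_cases hs : Function.Injective s
  · simp [hs, div_eq_inv_mul]
  · simp [hs]

theorem sqNorm_detForm {α β ι : Type*} [Fintype α] [Fintype β] [DecidableEq α]
    [DecidableEq β] [Fintype ι] [DecidableEq ι] {ℓ : ℕ} (X : α × β → ℂ) (w : ι → ℝ)
    (u : ι → α → ℂ) (hu : ∀ s s', star (u s) ⬝ᵥ u s' = if s = s' then 1 else 0)
    (hX : ∀ a a', ∑ b, X (a, b) * star (X (a', b)) = ∑ s, w s * (u s a * star (u s a'))) :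
    sqNorm (detForm X ℓ) = injSum w ℓ ∅ / ℓ ! := by
  have := star_detForm_dotProduct_self (ℓ := ℓ) X w u hu hX
  rw [star_detForm_dotProduct_tpow, star_dotProduct_self] at this
  exact_mod_cast this

/-! ### Projective measurements -/

theorem star_dotProduct_mulVec_of_isHermitian {κ : Type*} [Fintype κ] {Q : Matrix κ κ ℂ}
    (hQ : Q.conjTranspose = Q) (v w : κ → ℂ) :
    star (Q.mulVec v) ⬝ᵥ w = star v ⬝ᵥ Q.mulVec w := by
  rw [Matrix.star_mulVec, hQ, Matrix.dotProduct_mulVec]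

theorem star_dotProduct_mulVec_self {κ : Type*} [Fintype κ] {Q : Matrix κ κ ℂ}
    (hQ : Q.conjTranspose = Q) (hQQ : Q * Q = Q) (v : κ → ℂ) :
    star v ⬝ᵥ Q.mulVec v = (sqNorm (Q.mulVec v) : ℂ) := by
  rw [← star_dotProduct_self, star_dotProduct_mulVec_of_isHermitian hQ, Matrix.mulVec_mulVec, hQQ]

theorem Matrix.posSemidef_of_projection {κ : Type*} [Fintype κ] {Q : Matrix κ κ ℂ}
    (hQ : Q.conjTranspose = Q) (hQQ : Q * Q = Q) : Q.PosSemidef := by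
  have := Matrix.posSemidef_conjTranspose_mul_self Q
  rwa [hQ, hQQ] at this

theorem exists_projection_orthogonal {κ : Type*} [Fintype κ] [DecidableEq κ] (F : Set (κ → ℂ)) :
    ∃ Q : Matrix κ κ ℂ, Q.conjTranspose = Q ∧ Q * Q = Q ∧ (∀ f ∈ F, Q.mulVec f = 0) ∧
      ∀ w : κ → ℂ, (∀ f ∈ F, star f ⬝ᵥ w = 0) → Q.mulVec w = w := by
  set K : Submodule ℂ (EuclideanSpace ℂ κ) := Submodule.span ℂ (WithLp.toLp 2 '' F) with hK
  set P := Kᗮ.starProjection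
  set Q := (Matrix.toEuclideanCLM (n := κ) (𝕜 := ℂ)).symm P with hQ
  have hPQ : Matrix.toEuclideanCLM (n := κ) (𝕜 := ℂ) Q = P := by rw [hQ, StarAlgEquiv.apply_symm_apply]
  have hvec : ∀ v : κ → ℂ, Q.mulVec v = (P (WithLp.toLp 2 v)).ofLp := by
    intro v
    rw [← hPQ, Matrix.ofLp_toEuclideanCLM]
  have hproj : IsStarProjection P := isStarProjection_starProjection
  refine ⟨Q, ?_, ?_, ?_, ?_⟩
  · apply (Matrix.toEuclideanCLM (n := κ) (𝕜 := ℂ)).injective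
    rw [← Matrix.star_eq_conjTranspose]
    refine ((Matrix.toEuclideanCLM (n := κ) (𝕜 := ℂ)).map_star' Q).trans ?_
    exact (congrArg star hPQ).trans (hproj.isSelfAdjoint.star_eq.trans hPQ.symm)
  · apply (Matrix.toEuclideanCLM (n := κ) (𝕜 := ℂ)).injective
    have h := hproj.isIdempotentElem.eq
    rw [← hPQ] at h
    exact (map_mul (Matrix.toEuclideanCLM (n := κ) (𝕜 := ℂ)) Q Q).trans h
  · intro f hf
    have hmem : WithLp.toLp 2 f ∈ K := Submodule.subset_span ⟨f, hf, rfl⟩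
    rw [hvec, Submodule.starProjection_orthogonal_apply_eq_zero hmem]
    rfl
  · intro w hw
    have hmem : WithLp.toLp 2 w ∈ Kᗮ := by
      rw [Submodule.mem_orthogonal]
      intro u hu
      induction hu using Submodule.span_induction with
      | mem u hu =>
        obtain ⟨f, hf, rfl⟩ := hu
        rw [EuclideanSpace.inner_toLp_toLp, dotProduct_comm]
        exact hw f hf
      | zero => exact inner_zero_left _
      | add a b _ _ ha hb => rw [inner_add_left, ha, hb, add_zero]
      | smul c a _ ha => rw [inner_smul_left, ha, mul_zero]
    rw [hvec, Submodule.starProjection_eq_self_iff.2 hmem]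

/-- The two-outcome measurement of a projection: outcome `1` has effect `Q`. -/
def POVM.ofProjection {κ : Type*} [Fintype κ] [DecidableEq κ] (Q : Matrix κ κ ℂ)
    (hQ : Q.conjTranspose = Q) (hQQ : Q * Q = Q) : POVM κ where
  numOutcomes := 2
  effect := ![1 - Q, Q]
  posSemidef x := by
    have h1 : (1 - Q).conjTranspose = 1 - Q := by simp [hQ]
    have h2 : (1 - Q) * (1 - Q) = 1 - Q := by
      rw [sub_mul, one_mul, mul_sub, mul_one, hQQ, sub_self, sub_zero]
    fin_cases x
    · exact Matrix.posSemidef_of_projection h1 h2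
    · exact Matrix.posSemidef_of_projection hQ hQQ
  sum_eq_one := by simp [Fin.sum_univ_two]

namespace AdaptiveTest

variable {κ : Type*} [Fintype κ] [DecidableEq κ] {ℓ : ℕ}

/-- Perform the measurement `M` in each of `k` rounds, and accept if the flag `b` is set and all
the outcomes are `x₀`. -/
def iterate (M : POVM (Fin ℓ → κ)) (x₀ : Fin M.numOutcomes) : (k : ℕ) → Bool → AdaptiveTest κ ℓ k
  | 0, b => output b
  | k + 1, b => round M fun x => iterate M x₀ k (b && decide (x = x₀))

theorem iterate_performs (M : POVM (Fin ℓ → κ)) (x₀ : Fin M.numOutcomes) (k : ℕ) (b : Bool) :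
    (iterate M x₀ k b).Performs (List.replicate k M) := by
  induction k generalizing b with
  | zero => rfl
  | succ k ih => exact ⟨_, rfl, fun x => ih _⟩

theorem acceptProb_iterate (M : POVM (Fin ℓ → κ)) (x₀ : Fin M.numOutcomes) (k : ℕ) (b : Bool)
    (ψ : κ → ℂ) : (iterate M x₀ k b).acceptProb (ketbra ψ) =
      if b then (star (tpow ψ ℓ) ⬝ᵥ (M.effect x₀).mulVec (tpow ψ ℓ)).re ^ k else 0 := by
  induction k generalizing b with
  | zero => cases b <;> simp [iterate, acceptProb]
  | succ k ih =>
    rw [iterate, acceptProb_round]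
    simp only [ih]
    cases b
    · simp
    · simp only [Bool.true_and, decide_eq_true_eq, mul_ite, mul_zero, Finset.sum_ite_eq',
        Finset.mem_univ, if_true]
      rw [pow_succ']

/-- If every `ε`-far state has overlap at least `p` with the orthogonal complement of the span of
the `ℓ`-th tensor powers of the states in the property, then there are non-adaptive one-sided
testers with `k` rounds as soon as `(1 - p) ^ k ≤ 2 / 3`. -/
theorem exists_isOneSidedTester (F : Set (κ → ℂ)) (P : Set (Matrix κ κ ℂ))
    (hP : ∀ ρ ∈ P, ∃ ξ ∈ F, IsUnitVector ξ ∧ ρ = ketbra ξ) (ε p : ℝ)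
    (hfar : ∀ ψ : κ → ℂ, IsUnitVector ψ → IsFar ε P (ketbra ψ) →
      ∃ w : (Fin ℓ → κ) → ℂ, (∀ ξ ∈ F, star (tpow ξ ℓ) ⬝ᵥ w = 0) ∧ 0 < sqNorm w ∧
        p * sqNorm w ≤ ‖star w ⬝ᵥ tpow ψ ℓ‖ ^ 2)
    (k : ℕ) (hk : (1 - p) ^ k ≤ 2 / 3) :
    ∃ T : AdaptiveTest κ ℓ k, T.IsNonadaptive ∧ T.IsOneSidedTester P ε := by
  obtain ⟨Q, hQ, hQQ, hQF, hQw⟩ := exists_projection_orthogonal ((fun ξ => tpow ξ ℓ) '' F)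
  set M := POVM.ofProjection Q hQ hQQ
  let x₀ : Fin M.numOutcomes := (0 : Fin 2)
  have hprob : ∀ ψ : κ → ℂ, IsUnitVector ψ →
      (star (tpow ψ ℓ) ⬝ᵥ (M.effect x₀).mulVec (tpow ψ ℓ)).re =
        1 - sqNorm (Q.mulVec (tpow ψ ℓ)) := by
    intro ψ hψ
    have h1 : M.effect x₀ = 1 - Q := rfl
    rw [h1, Matrix.sub_mulVec, Matrix.one_mulVec, dotProduct_sub, star_dotProduct_self,
      star_dotProduct_mulVec_self hQ hQQ, sqNorm_tpow, (isUnitVector_iff ψ).1 hψ]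
    simp
  refine ⟨iterate M x₀ k true, ⟨_, iterate_performs M x₀ k true⟩, fun ρ hρ => ?_,
    fun ρ hρ hρfar => ?_⟩
  · obtain ⟨ξ, hξF, hξ, rfl⟩ := hP ρ hρ
    rw [acceptProb_iterate, if_pos rfl, hprob ξ hξ, hQF _ ⟨ξ, hξF, rfl⟩]
    simp [sqNorm]
  · obtain ⟨ψ, hψ, rfl⟩ := hρ
    rw [acceptProb_iterate, if_pos rfl, hprob ψ hψ]
    obtain ⟨w, hwF, hw0, hw⟩ := hfar ψ hψ hρfar
    have hw' : Q.mulVec w = w := hQw w (by rintro _ ⟨ξ, hξ, rfl⟩; exact hwF ξ hξ)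
    -- Cauchy–Schwarz between w = Q w and the projected tensor power.
    have h1 : p ≤ sqNorm (Q.mulVec (tpow ψ ℓ)) := by
      have h2 := norm_star_dotProduct_sq_le w (Q.mulVec (tpow ψ ℓ))
      rw [← star_dotProduct_mulVec_of_isHermitian hQ, hw'] at h2
      have h3 := hw.trans h2
      rw [mul_comm] at h3
      exact le_of_mul_le_mul_left h3 hw0
    have h0 : 0 ≤ 1 - sqNorm (Q.mulVec (tpow ψ ℓ)) := by
      rw [← hprob ψ hψ]
      exact M.re_star_dotProduct_effect_nonneg _ _
    calc _ ≤ (1 - p) ^ k := pow_le_pow_left₀ h0 (by linarith) k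
      _ ≤ _ := hk.trans (by norm_num)

end AdaptiveTest

/-! ### Singular values and truncation across one cut -/

/-- Spectral theorem for the reduced matrix X X*: w holds the squared Schmidt coefficients, zeros
included, and u the Schmidt vectors. -/
theorem exists_singular_basis {α β : Type*} [Fintype α] [Fintype β] [DecidableEq α]
    (X : α × β → ℂ) : ∃ (w : α → ℝ) (u : α → α → ℂ), (∀ s, 0 ≤ w s) ∧
      (∀ s s', star (u s) ⬝ᵥ u s' = if s = s' then 1 else 0) ∧
      ∀ a a', ∑ b, X (a, b) * star (X (a', b)) = ∑ s, w s * (u s a * star (u s a')) := by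
  set M : Matrix α β ℂ := Matrix.of fun a b => X (a, b) with hM
  have hps : (M * M.conjTranspose).PosSemidef := Matrix.posSemidef_self_mul_conjTranspose M
  have hH := hps.isHermitian
  refine ⟨hH.eigenvalues, fun s => (hH.eigenvectorBasis s).ofLp, hps.eigenvalues_nonneg,
    fun s s' => ?_, fun a a' => ?_⟩
  · have := orthonormal_iff_ite.1 hH.eigenvectorBasis.orthonormal s s'
    rw [← this, EuclideanSpace.inner_eq_star_dotProduct, dotProduct_comm]
  · have h := hH.spectral_theorem
    have h' := congrFun (congrFun h a) a'
    rw [Unitary.conjStarAlgAut_apply, Matrix.mul_apply, Matrix.mul_apply] at h'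
    simp only [Matrix.mul_diagonal, Matrix.conjTranspose_apply, Matrix.star_apply,
      Matrix.IsHermitian.eigenvectorUnitary_apply, hM, Matrix.of_apply, Function.comp] at h'
    rw [h']
    refine Finset.sum_congr rfl fun s _ => ?_
    simp
    ring

theorem sum_singular_eq_sqNorm {α β ι : Type*} [Fintype α] [Fintype β] [DecidableEq ι] [Fintype ι]
    (X : α × β → ℂ) (w : ι → ℝ) (u : ι → α → ℂ)
    (hu : ∀ s s', star (u s) ⬝ᵥ u s' = if s = s' then 1 else 0)
    (hX : ∀ a a', ∑ b, X (a, b) * star (X (a', b)) = ∑ s, w s * (u s a * star (u s a'))) :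
    ∑ s, w s = sqNorm X := by
  have h : ∑ a, ∑ b, X (a, b) * star (X (a, b)) = ∑ s, (w s : ℂ) := by
    simp only [hX]
    rw [Finset.sum_comm]
    refine Finset.sum_congr rfl fun s _ => ?_
    rw [← Finset.mul_sum]
    have := hu s s
    rw [if_pos rfl] at this
    simp only [dotProduct, Pi.star_apply] at this
    simp only [mul_comm (u s _), this, mul_one]
  have h2 : ∑ a, ∑ b, X (a, b) * star (X (a, b)) = (sqNorm X : ℂ) := by
    rw [← star_dotProduct_self, dotProduct, Fintype.sum_prod_type]
    simp only [Pi.star_apply, mul_comm]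
  rw [h2] at h
  exact_mod_cast h.symm

/-- The index set of the product basis, split along a bipartition of the vertices. -/
def cutEquiv {V : Type*} (d : V → ℕ) (S : Set V) [DecidablePred (· ∈ S)] :
    ProdIdx d ≃ ((v : {v // v ∈ S}) → Fin (d v)) × ((v : {v // v ∉ S}) → Fin (d v)) :=
  Equiv.piEquivPiSubtypeProd (fun v => v ∈ S) (fun v => Fin (d v))

section cut

variable {V : Type*} {d : V → ℕ} (S : Set V) [DecidablePred (· ∈ S)]

theorem cutEquiv_symm_apply_mem (a b) {v : V} (hv : v ∈ S) :
    (cutEquiv d S).symm (a, b) v = a ⟨v, hv⟩ := by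
  simp [cutEquiv, Equiv.piEquivPiSubtypeProd, hv]

theorem cutEquiv_symm_apply_notMem (a b) {v : V} (hv : v ∉ S) :
    (cutEquiv d S).symm (a, b) v = b ⟨v, hv⟩ := by
  simp [cutEquiv, Equiv.piEquivPiSubtypeProd, hv]

theorem HasCutRank.hasRankLE {S} [DecidablePred (· ∈ S)] {r : ℕ} {ψ : ProdIdx d → ℂ}
    (h : HasCutRank S r ψ) : HasRankLE r (ψ ∘ (cutEquiv d S).symm) := by
  obtain ⟨A, B, hA, hB, h⟩ := h
  rcases isEmpty_or_nonempty (ProdIdx d) with hemp | ⟨⟨x₀⟩⟩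
  · exact ⟨0, 0, fun p => hemp.elim ((cutEquiv d S).symm p)⟩
  · refine ⟨fun k a => A k ((cutEquiv d S).symm (a, (cutEquiv d S x₀).2)),
      fun k b => B k ((cutEquiv d S).symm ((cutEquiv d S x₀).1, b)), fun p => ?_⟩
    rw [Function.comp_apply, h]
    refine Finset.sum_congr rfl fun k _ => ?_
    congr 1
    · exact hA k fun v hv => by
        rw [cutEquiv_symm_apply_mem S _ _ hv, cutEquiv_symm_apply_mem S _ _ hv]
    · exact hB k fun v hv => by
        rw [cutEquiv_symm_apply_notMem S _ _ hv, cutEquiv_symm_apply_notMem S _ _ hv]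

variable [Fintype V]

/-- The operator `K ⊗ 1` with respect to the bipartition `S`, `V \ S`. -/
def cutOp (K : Matrix ((v : {v // v ∈ S}) → Fin (d v)) ((v : {v // v ∈ S}) → Fin (d v)) ℂ) :
    Matrix (ProdIdx d) (ProdIdx d) ℂ :=
  (Matrix.kronecker K (1 : Matrix ((v : {v // v ∉ S}) → Fin (d v)) _ ℂ)).submatrix
    (cutEquiv d S) (cutEquiv d S)

variable (K : Matrix ((v : {v // v ∈ S}) → Fin (d v)) ((v : {v // v ∈ S}) → Fin (d v)) ℂ)

theorem cutOp_conjTranspose (hK : K.conjTranspose = K) :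
    (cutOp S K).conjTranspose = cutOp S K := by
  rw [cutOp, Matrix.conjTranspose_submatrix, Matrix.kronecker, Matrix.conjTranspose_kronecker, hK,
    Matrix.conjTranspose_one]

variable [DecidableEq V]

theorem cutOp_mulVec (ξ : ProdIdx d → ℂ) (x : ProdIdx d) :
    (cutOp S K).mulVec ξ x =
      ∑ a, K (cutEquiv d S x).1 a * ξ ((cutEquiv d S).symm (a, (cutEquiv d S x).2)) := by
  rw [Matrix.mulVec, dotProduct, ← (cutEquiv d S).symm.sum_comp, Fintype.sum_prod_type]
  refine Finset.sum_congr rfl fun a _ => ?_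
  rw [Finset.sum_eq_single (cutEquiv d S x).2]
  · simp [cutOp]
  · intro b _ hb
    simp [cutOp, Ne.symm hb]
  · simp

theorem cutOp_mul_self (hK : K * K = K) : cutOp S K * cutOp S K = cutOp S K := by
  rw [cutOp, Matrix.submatrix_mul_equiv, Matrix.kronecker, ← Matrix.mul_kronecker_mul, hK,
    Matrix.one_mul]

/-- An operator on S acts on the factors of one side of the cut only: on those of S' if S ⊆ S', on
those of its complement if S and S' are disjoint. The number of product terms is unchanged. -/
theorem HasCutRank.cutOp_mulVec {S' : Set V} {r : ℕ} {ξ : ProdIdx d → ℂ} (h : HasCutRank S' r ξ)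
    (hS : S ⊆ S' ∨ Disjoint S S') : HasCutRank S' r ((cutOp S K).mulVec ξ) := by
  have key : ∀ S' : Set V, S ⊆ S' → HasCutRank S' r ξ →
      HasCutRank S' r ((cutOp S K).mulVec ξ) := by
    rintro S' hS ⟨A, B, hA, hB, h⟩
    refine ⟨fun k x => ∑ a, K (cutEquiv d S x).1 a *
      A k ((cutEquiv d S).symm (a, (cutEquiv d S x).2)), B, fun k x y hxy => ?_, hB, fun x => ?_⟩
    · have h1 : (cutEquiv d S x).1 = (cutEquiv d S y).1 := funext fun v => hxy v (hS v.2)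
      dsimp only
      rw [h1]
      refine Finset.sum_congr rfl fun a _ => ?_
      congr 1
      refine hA k fun v hv => ?_
      by_cases hvS : v ∈ S
      · rw [cutEquiv_symm_apply_mem S _ _ hvS, cutEquiv_symm_apply_mem S _ _ hvS]
      · rw [cutEquiv_symm_apply_notMem S _ _ hvS, cutEquiv_symm_apply_notMem S _ _ hvS]
        exact hxy v hv
    · rw [_root_.cutOp_mulVec]
      simp only [h, Finset.mul_sum, Finset.sum_mul]
      rw [Finset.sum_comm]
      refine Finset.sum_congr rfl fun k _ => Finset.sum_congr rfl fun a _ => ?_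
      have : B k ((cutEquiv d S).symm (a, (cutEquiv d S x).2)) = B k x := by
        refine hB k fun v hv => ?_
        rw [cutEquiv_symm_apply_notMem S _ _ fun hvS => hv (hS hvS)]
        rfl
      rw [this]
      ring
  rcases hS with hS | hS
  · exact key S' hS h
  · have := (key S'ᶜ (Set.subset_compl_iff_disjoint_right.2 hS) h.compl).compl
    rwa [compl_compl] at this

theorem hasCutRank_cutOp_mulVec {ι : Type*} (T : Finset ι) {r : ℕ} (hT : T.card ≤ r)
    (u : ι → ((v : {v // v ∈ S}) → Fin (d v)) → ℂ)
    (hK : K = Matrix.of fun a a' => ∑ s ∈ T, u s a * star (u s a')) (ξ : ProdIdx d → ℂ) :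
    HasCutRank S r ((cutOp S K).mulVec ξ) := by
  let f : Fin T.card → ι := fun k => T.equivFin.symm k
  refine ⟨fun k x => if hk : (k : ℕ) < T.card then u (f ⟨k, hk⟩) (cutEquiv d S x).1 else 0,
    fun k x => if hk : (k : ℕ) < T.card then ∑ a, star (u (f ⟨k, hk⟩) a) *
      ξ ((cutEquiv d S).symm (a, (cutEquiv d S x).2)) else 0, fun k x y hxy => ?_,
    fun k x y hxy => ?_, fun x => ?_⟩
  · have h1 : (cutEquiv d S x).1 = (cutEquiv d S y).1 := funext fun v => hxy v v.2
    simp only [h1]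
  · have h1 : (cutEquiv d S x).2 = (cutEquiv d S y).2 := funext fun v => hxy v v.2
    simp only [h1]
  · rw [cutOp_mulVec, hK]
    simp only [Matrix.of_apply, Finset.sum_mul]
    rw [Finset.sum_comm, ← Finset.sum_coe_sort T, ← T.equivFin.symm.sum_comp]
    apply Finset.sum_of_injOn (Fin.castLE hT) (Fin.castLE_injective hT).injOn (fun _ _ => by simp)
    · intro k _ hk
      have : ¬ (k : ℕ) < T.card := fun hlt => hk ⟨⟨k, hlt⟩, by simp, rfl⟩
      simp [this]
    · intro k _
      simp [f, Finset.mul_sum, mul_assoc]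

/-- Q is the projection onto the Schmidt vectors u s, s ∈ T, tensored with the identity. It loses
exactly the weight outside T, and being local to S it does not raise the rank of cuts S' that
contain S or are disjoint from S. -/
theorem exists_cut_projection {r : ℕ} (ψ : ProdIdx d → ℂ)
    (w : ((v : {v // v ∈ S}) → Fin (d v)) → ℝ)
    (u : ((v : {v // v ∈ S}) → Fin (d v)) → ((v : {v // v ∈ S}) → Fin (d v)) → ℂ)
    (hu : ∀ s s', star (u s) ⬝ᵥ u s' = if s = s' then 1 else 0)
    (hX : ∀ a a', ∑ b, ψ ((cutEquiv d S).symm (a, b)) * star (ψ ((cutEquiv d S).symm (a', b))) =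
      ∑ s, w s * (u s a * star (u s a')))
    (T : Finset ((v : {v // v ∈ S}) → Fin (d v))) (hT : T.card ≤ r) :
    ∃ Q : Matrix (ProdIdx d) (ProdIdx d) ℂ, Q.conjTranspose = Q ∧ Q * Q = Q ∧
      sqNorm (ψ - Q.mulVec ψ) = ∑ s ∈ Tᶜ, w s ∧ (∀ ξ, HasCutRank S r (Q.mulVec ξ)) ∧
      ∀ S' : Set V, (S ⊆ S' ∨ Disjoint S S') → ∀ ξ, HasCutRank S' r ξ →
        HasCutRank S' r (Q.mulVec ξ) := by
  set K : Matrix ((v : {v // v ∈ S}) → Fin (d v)) ((v : {v // v ∈ S}) → Fin (d v)) ℂ :=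
    Matrix.of fun a a' => ∑ s ∈ T, u s a * star (u s a') with hK
  have hKh : K.conjTranspose = K := by
    ext a a'
    simp [hK, mul_comm]
  have hKK : K * K = K := by
    ext a a'
    simp only [hK, Matrix.mul_apply, Matrix.of_apply, Finset.sum_mul, Finset.mul_sum]
    have h1 : ∀ s s', ∑ c, u s a * star (u s c) * (u s' c * star (u s' a')) =
        (u s a * star (u s' a')) * if s = s' then 1 else 0 := by
      intro s s'
      rw [← hu s s', dotProduct, Finset.mul_sum]
      refine Finset.sum_congr rfl fun c _ => ?_
      rw [Pi.star_apply]
      ring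
    rw [Finset.sum_comm]
    refine Finset.sum_congr rfl fun s hs => ?_
    rw [Finset.sum_comm]
    simp only [h1, mul_ite, mul_one, mul_zero, Finset.sum_ite_eq', hs, if_true]
  have hQ := cutOp_conjTranspose S K hKh
  have hQQ := cutOp_mul_self S K hKK
  refine ⟨cutOp S K, hQ, hQQ, ?_, hasCutRank_cutOp_mulVec S K T hT u hK,
    fun S' hS' ξ hξ => hξ.cutOp_mulVec S K hS'⟩
  have h1 : star ψ ⬝ᵥ (cutOp S K).mulVec ψ = ((∑ s ∈ T, w s : ℝ) : ℂ) := by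
    rw [dotProduct, ← (cutEquiv d S).symm.sum_comp, Fintype.sum_prod_type]
    simp only [cutOp_mulVec, Equiv.apply_symm_apply, Pi.star_apply, Finset.mul_sum]
    have h2 : ∀ a, ∑ b, ∑ a', star (ψ ((cutEquiv d S).symm (a, b))) *
        (K a a' * ψ ((cutEquiv d S).symm (a', b))) =
        ∑ s' ∈ T, ∑ s, ∑ a', (w s : ℂ) * ((star (u s a) * u s' a) * (star (u s' a') * u s a')) := by
      intro a
      rw [Finset.sum_comm]
      have h3 : ∀ a', ∑ b, star (ψ ((cutEquiv d S).symm (a, b))) *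
          (K a a' * ψ ((cutEquiv d S).symm (a', b))) =
          ∑ s' ∈ T, ∑ s, (w s : ℂ) * ((star (u s a) * u s' a) * (star (u s' a') * u s a')) := by
        intro a'
        have h4 : ∀ b, star (ψ ((cutEquiv d S).symm (a, b))) *
            (K a a' * ψ ((cutEquiv d S).symm (a', b))) = K a a' *
            (ψ ((cutEquiv d S).symm (a', b)) * star (ψ ((cutEquiv d S).symm (a, b)))) :=
          fun b => by ring
        simp only [h4]
        rw [← Finset.mul_sum, hX, hK, Matrix.of_apply, Finset.sum_mul]
        refine Finset.sum_congr rfl fun s' _ => ?_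
        rw [Finset.mul_sum]
        exact Finset.sum_congr rfl fun s _ => by ring
      simp only [h3]
      rw [Finset.sum_comm]
      exact Finset.sum_congr rfl fun s' _ => Finset.sum_comm
    simp only [h2]
    rw [Finset.sum_comm, Complex.ofReal_sum]
    refine Finset.sum_congr rfl fun s' _ => ?_
    rw [Finset.sum_comm]
    have h5 : ∀ s, ∑ a, ∑ a', (w s : ℂ) * ((star (u s a) * u s' a) * (star (u s' a') * u s a')) =
        if s = s' then (w s : ℂ) else 0 := by
      intro s
      have e1 := hu s s'
      have e2 := hu s' s
      simp only [dotProduct, Pi.star_apply] at e1 e2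
      simp only [← Finset.mul_sum, ← Finset.sum_mul, e1, e2]
      by_cases h : s = s' <;> simp [h]
    simp only [h5, Finset.sum_ite_eq', Finset.mem_univ, if_true]
  have h6 : sqNorm ψ = ∑ s, w s := by
    rw [sum_singular_eq_sqNorm (ψ ∘ (cutEquiv d S).symm) w u hu hX, sqNorm_comp_equiv]
  have h7 : sqNorm ((cutOp S K).mulVec ψ) = ∑ s ∈ T, w s := by
    rw [star_dotProduct_mulVec_self hQ hQQ] at h1
    exact_mod_cast h1
  rw [sqNorm_sub, h1, h6, h7, Complex.ofReal_re, ← Finset.sum_add_sum_compl T w]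
  ring

end cut

/-! ### Truncation across a laminar family of cuts -/

/-- ψ - Qξ is the sum of ψ - Qψ and Q(ψ - ξ), which are orthogonal, and Q is a contraction. Squared
errors therefore add, which avoids the loss of a triangle inequality. -/
theorem sqNorm_sub_projection_le {κ : Type*} [Fintype κ] {Q : Matrix κ κ ℂ}
    (hQ : Q.conjTranspose = Q) (hQQ : Q * Q = Q) (ψ ξ : κ → ℂ) :
    sqNorm (ψ - Q.mulVec ξ) ≤ sqNorm (ψ - Q.mulVec ψ) + sqNorm (ψ - ξ) := by
  have h1 : star (ψ - Q.mulVec ψ) ⬝ᵥ Q.mulVec (ξ - ψ) = 0 := by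
    rw [← star_dotProduct_mulVec_of_isHermitian hQ, Matrix.mulVec_sub, Matrix.mulVec_mulVec, hQQ,
      sub_self, star_zero, zero_dotProduct]
  have h2 : ψ - Q.mulVec ξ = (ψ - Q.mulVec ψ) - Q.mulVec (ξ - ψ) := by
    rw [Matrix.mulVec_sub]; abel
  rw [h2, sqNorm_sub, h1, Complex.zero_re, mul_zero, sub_zero]
  have h3 := norm_star_dotProduct_sq_le (ψ - ξ) (Q.mulVec (ξ - ψ))
  have h4 : star (ψ - ξ) ⬝ᵥ Q.mulVec (ξ - ψ) = -(sqNorm (Q.mulVec (ξ - ψ)) : ℂ) := by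
    rw [← star_dotProduct_mulVec_self hQ hQQ, ← neg_sub ξ ψ, star_neg, neg_dotProduct]
  rw [h4, norm_neg, Complex.norm_real, Real.norm_eq_abs, sq_abs, sq] at h3
  have h5 := sqNorm_nonneg (Q.mulVec (ξ - ψ))
  have h6 := sqNorm_nonneg (ψ - ξ)
  have : sqNorm (Q.mulVec (ξ - ψ)) ≤ sqNorm (ψ - ξ) := by
    rcases h5.eq_or_lt with h | h
    · rw [← h]; exact h6
    · exact le_of_mul_le_mul_right h3 h
  linarith

theorem exists_hasCutRank_of_laminar {V E : Type*} [Fintype V] [DecidableEq V] {d : V → ℕ} {r : ℕ}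
    (ψ : ProdIdx d → ℂ) (S : E → Set V) (size : E → ℕ) (t : E → ℝ)
    (hlam : ∀ e e', size e ≤ size e' → e ≠ e' → S e ⊆ S e' ∨ Disjoint (S e) (S e'))
    (hproj : ∀ e, ∃ Q : Matrix (ProdIdx d) (ProdIdx d) ℂ, Q.conjTranspose = Q ∧ Q * Q = Q ∧
      sqNorm (ψ - Q.mulVec ψ) ≤ t e ∧ (∀ ξ, HasCutRank (S e) r (Q.mulVec ξ)) ∧
      ∀ S' : Set V, (S e ⊆ S' ∨ Disjoint (S e) S') → ∀ ξ, HasCutRank S' r ξ →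
        HasCutRank S' r (Q.mulVec ξ)) (F : Finset E) :
    ∃ ξ, sqNorm (ψ - ξ) ≤ ∑ e ∈ F, t e ∧ ∀ e ∈ F, HasCutRank (S e) r ξ := by
  classical
  -- The smallest set is inserted last, so its projection acts after those of the larger sets, each
  -- of which contains it or is disjoint from it; the ranks already achieved are kept.
  induction F using Finset.induction_on_min_value (f := size) with
  | empty => exact ⟨ψ, by simp [sqNorm], by simp⟩
  | insert e F he hmin ih =>
    obtain ⟨ξ, hξ, hF⟩ := ih
    obtain ⟨Q, hQ, hQQ, ht, hr, hpres⟩ := hproj e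
    refine ⟨Q.mulVec ξ, ?_, ?_⟩
    · rw [Finset.sum_insert he]
      exact (sqNorm_sub_projection_le hQ hQQ ψ ξ).trans (add_le_add ht hξ)
    · intro e' he'
      rcases Finset.mem_insert.1 he' with rfl | he'
      · exact hr ξ
      · exact hpres _ (hlam e e' (hmin e' he') (by rintro rfl; exact he he')) ξ (hF e' he')

/-! ### The two sides of an edge of a tree -/

section tree

variable {V : Type*} {G : SimpleGraph V}

theorem edgeSide_subset {u v : V} {A : Set V} (hu : u ∈ A)
    (hA : ∀ a b, G.Adj a b → s(a, b) ≠ s(u, v) → a ∈ A → b ∈ A) : edgeSide G u v ⊆ A := by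
  have key : ∀ {a b : V}, (G.deleteEdges {s(u, v)}).Walk a b → a ∈ A → b ∈ A := by
    intro a b p
    induction p with
    | nil => exact id
    | cons hab _ ih =>
      rw [SimpleGraph.deleteEdges_adj] at hab
      exact fun ha => ih (hA _ _ hab.1 hab.2 ha)
  rintro w ⟨p⟩
  exact key p hu

theorem mem_edgeSide_iff_of_adj {u v x y : V} (h : G.Adj x y) (hne : s(x, y) ≠ s(u, v)) :
    x ∈ edgeSide G u v ↔ y ∈ edgeSide G u v := by
  have hadj : (G.deleteEdges {s(u, v)}).Adj x y := by
    rw [SimpleGraph.deleteEdges_adj]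
    exact ⟨h, hne⟩
  exact ⟨fun hx => SimpleGraph.Reachable.trans hx hadj.reachable,
    fun hy => SimpleGraph.Reachable.trans hy hadj.symm.reachable⟩

theorem left_mem_edgeSide (u v : V) : u ∈ edgeSide G u v :=
  SimpleGraph.Reachable.refl u

theorem right_notMem_edgeSide (hG : G.IsAcyclic) {u v : V} (h : G.Adj u v) :
    v ∉ edgeSide G u v := by
  have := SimpleGraph.isAcyclic_iff_forall_isBridge.1 hG ((G.mem_edgeSet).2 h)
  exact (SimpleGraph.isBridge_iff.1 this)

theorem edgeSide_compl (hG : G.IsTree) {u v : V} (h : G.Adj u v) :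
    (edgeSide G u v)ᶜ = edgeSide G v u := by
  have hv := right_notMem_edgeSide hG.isAcyclic h
  apply Set.Subset.antisymm
  · intro w hw
    have hreach : ∀ a b, G.Adj a b → a ∈ edgeSide G u v ∪ edgeSide G v u →
        b ∈ edgeSide G u v ∪ edgeSide G v u := by
      intro a b hab ha
      by_cases he : s(a, b) = s(u, v)
      · rcases Sym2.eq_iff.1 he with ⟨rfl, rfl⟩ | ⟨rfl, rfl⟩
        · exact Or.inr (left_mem_edgeSide _ _)
        · exact Or.inl (left_mem_edgeSide _ _)
      · rcases ha with ha | ha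
        · exact Or.inl ((mem_edgeSide_iff_of_adj hab he).1 ha)
        · exact Or.inr ((mem_edgeSide_iff_of_adj hab (by rwa [Sym2.eq_swap (a := v)])).1 ha)
    have hall : ∀ {a b : V}, G.Walk a b → a ∈ edgeSide G u v ∪ edgeSide G v u →
        b ∈ edgeSide G u v ∪ edgeSide G v u := by
      intro a b p
      induction p with
      | nil => exact id
      | cons hab _ ih => exact fun ha => ih (hreach _ _ hab ha)
    obtain ⟨p⟩ := hG.connected.preconnected u w
    exact (hall p (Or.inl (left_mem_edgeSide _ _))).resolve_left hw
  · refine edgeSide_subset hv fun a b hab hne ha hb => ha ?_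
    exact (mem_edgeSide_iff_of_adj hab (by rwa [Sym2.eq_swap (a := u)])).2 hb

/-- The four cases record whether each edge lies on the chosen side of the other. A side that the
other edge does not meet lies entirely on one side of that edge; if both edges lie on the chosen
sides, these cover all vertices, which the common outside vertex o forbids. -/
theorem edgeSide_laminar (hG : G.IsTree) {u v x y o : V} (huv : G.Adj u v) (hxy : G.Adj x y)
    (hne : s(u, v) ≠ s(x, y)) (ho : o ∉ edgeSide G u v) (ho' : o ∉ edgeSide G x y) :
    edgeSide G u v ⊆ edgeSide G x y ∨ edgeSide G x y ⊆ edgeSide G u v ∨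
      Disjoint (edgeSide G u v) (edgeSide G x y) := by
  have h1 := mem_edgeSide_iff_of_adj huv hne
  have h2 := mem_edgeSide_iff_of_adj hxy hne.symm
  by_cases hu : u ∈ edgeSide G x y <;> by_cases hx : x ∈ edgeSide G u v
  · exfalso
    -- The far side of uv would lie inside the chosen side of xy, and o belongs to the former but
    -- not to the latter.
    have hsub : edgeSide G v u ⊆ edgeSide G v u ∩ edgeSide G x y := by
      refine edgeSide_subset ⟨left_mem_edgeSide _ _, h1.1 hu⟩ fun a b hab he ha => ?_
      have hb := (mem_edgeSide_iff_of_adj hab he).1 ha.1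
      refine ⟨hb, (mem_edgeSide_iff_of_adj hab fun he' => ?_).1 ha.2⟩
      have ha1 := ha.1
      rw [← edgeSide_compl hG huv] at ha1
      rcases Sym2.eq_iff.1 he' with ⟨rfl, rfl⟩ | ⟨rfl, rfl⟩
      · exact ha1 hx
      · exact ha1 (h2.1 hx)
    exact ho' (hsub (by rw [← edgeSide_compl hG huv]; exact ho)).2
  · left
    refine (edgeSide_subset (A := edgeSide G u v ∩ edgeSide G x y)
      ⟨left_mem_edgeSide _ _, hu⟩ fun a b hab he ha => ?_).trans Set.inter_subset_right
    refine ⟨(mem_edgeSide_iff_of_adj hab he).1 ha.1,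
      (mem_edgeSide_iff_of_adj hab fun he' => ?_).1 ha.2⟩
    rcases Sym2.eq_iff.1 he' with ⟨rfl, rfl⟩ | ⟨rfl, rfl⟩
    · exact hx ha.1
    · exact hx (h2.2 ha.1)
  · right; left
    refine (edgeSide_subset (A := edgeSide G x y ∩ edgeSide G u v)
      ⟨left_mem_edgeSide _ _, hx⟩ fun a b hab he ha => ?_).trans Set.inter_subset_right
    refine ⟨(mem_edgeSide_iff_of_adj hab he).1 ha.1,
      (mem_edgeSide_iff_of_adj hab fun he' => ?_).1 ha.2⟩
    rcases Sym2.eq_iff.1 he' with ⟨rfl, rfl⟩ | ⟨rfl, rfl⟩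
    · exact hu ha.1
    · exact hu (h1.2 ha.1)
  · right; right
    rw [← Set.subset_compl_iff_disjoint_right]
    refine (edgeSide_subset (A := edgeSide G u v ∩ (edgeSide G x y)ᶜ)
      ⟨left_mem_edgeSide _ _, hu⟩ fun a b hab he ha => ?_).trans Set.inter_subset_right
    refine ⟨(mem_edgeSide_iff_of_adj hab he).1 ha.1,
      fun hb => ha.2 ((mem_edgeSide_iff_of_adj hab fun he' => ?_).2 hb)⟩
    rcases Sym2.eq_iff.1 he' with ⟨rfl, rfl⟩ | ⟨rfl, rfl⟩
    · exact hx ha.1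
    · exact hx (h2.2 ha.1)

/-- The edges of a tree can be oriented away from a root, so that the far sides of the edges form a
laminar family. -/
theorem exists_laminar_orientation [Finite V] (hG : G.IsTree) :
    ∃ p : G.edgeSet → V × V, (∀ e, G.Adj (p e).1 (p e).2) ∧ (∀ e, s((p e).1, (p e).2) = e) ∧
      ∀ e e', (edgeSide G (p e).1 (p e).2).ncard ≤ (edgeSide G (p e').1 (p e').2).ncard → e ≠ e' →
        edgeSide G (p e).1 (p e).2 ⊆ edgeSide G (p e').1 (p e').2 ∨
          Disjoint (edgeSide G (p e).1 (p e).2) (edgeSide G (p e').1 (p e').2) := by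
  obtain ⟨o⟩ := hG.connected.nonempty
  have hex : ∀ e : G.edgeSet, ∃ p : V × V, G.Adj p.1 p.2 ∧ s(p.1, p.2) = e ∧
      o ∉ edgeSide G p.1 p.2 := by
    rintro ⟨e, he⟩
    induction e using Sym2.ind with
    | _ u v =>
      have huv : G.Adj u v := he
      by_cases ho : o ∈ edgeSide G u v
      · refine ⟨(v, u), huv.symm, Sym2.eq_swap, ?_⟩
        rw [← edgeSide_compl hG huv]
        exact fun h => h ho
      · exact ⟨(u, v), huv, rfl, ho⟩
  choose p hadj hp ho using hex
  refine ⟨p, hadj, hp, fun e e' hcard hne => ?_⟩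
  rcases edgeSide_laminar hG (hadj e) (hadj e')
    (fun h => hne (Subtype.ext (by rw [← hp e, ← hp e', h]))) (ho e) (ho e') with h | h | h
  · exact Or.inl h
  · exact Or.inl (Set.eq_of_subset_of_ncard_le h hcard (Set.toFinite _)).symm.subset
  · exact Or.inr h

theorem hasCutRank_edgeSide_of_orientation {α : V → Type*} (hG : G.IsTree)
    {p : G.edgeSet → V × V} (hp : ∀ e, s((p e).1, (p e).2) = e) {r : ℕ}
    {ξ : ((v : V) → α v) → ℂ} (h : ∀ e, HasCutRank (edgeSide G (p e).1 (p e).2) r ξ) {u v : V}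
    (huv : G.Adj u v) : HasCutRank (edgeSide G u v) r ξ := by
  have he := h ⟨s(u, v), huv⟩
  rcases Sym2.eq_iff.1 (hp ⟨s(u, v), huv⟩) with ⟨h1, h2⟩ | ⟨h1, h2⟩
  · rwa [h1, h2] at he
  · rw [h1, h2, ← edgeSide_compl hG huv] at he
    have := he.compl
    rwa [compl_compl] at this

end tree

/-! ### The upper bound -/

/-- With N = ‖ξ‖² and a = Re ⟨ψ, ξ⟩, the left side is N(2a - N) = a² - (a - N)². Normalizing ξ thus
keeps the squared overlap with ψ at least 1 - ‖ψ - ξ‖². -/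
theorem sqNorm_mul_one_sub_le {κ : Type*} [Fintype κ] {ψ : κ → ℂ} (hψ : sqNorm ψ = 1)
    (ξ : κ → ℂ) : sqNorm ξ * (1 - sqNorm (ψ - ξ)) ≤ ‖star ψ ⬝ᵥ ξ‖ ^ 2 := by
  rw [sqNorm_sub, hψ, ← Complex.normSq_eq_norm_sq, Complex.normSq_apply]
  nlinarith [sq_nonneg ((star ψ ⬝ᵥ ξ).re - sqNorm ξ), sq_nonneg (star ψ ⬝ᵥ ξ).im]

theorem exists_unit_smul {κ : Type*} [Fintype κ] {ξ : κ → ℂ} (hξ : 0 < sqNorm ξ) :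
    ∃ c : ℂ, ‖c‖ ^ 2 * sqNorm ξ = 1 ∧ IsUnitVector (c • ξ) := by
  have h : ‖(((Real.sqrt (sqNorm ξ))⁻¹ : ℝ) : ℂ)‖ ^ 2 * sqNorm ξ = 1 := by
    rw [Complex.norm_real, Real.norm_eq_abs, sq_abs, inv_pow, Real.sq_sqrt hξ.le,
      inv_mul_cancel₀ hξ.ne']
  exact ⟨_, h, by rw [isUnitVector_iff, sqNorm_smul, h]⟩

section upper

variable {V : Type*} [Fintype V] [DecidableEq V]

theorem not_isFar_of_approx {d : V → ℕ} {G : SimpleGraph V} {r : ℕ} {ε : ℝ} (hε : 0 < ε)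
    (hε1 : ε < 1) {ψ ξ : ProdIdx d → ℂ} (hψ : IsUnitVector ψ)
    (hξ : ∀ u v, G.Adj u v → HasCutRank (edgeSide G u v) r ξ) (hlt : sqNorm (ψ - ξ) < ε ^ 2) :
    ¬ IsFar ε (TTNS G d r) (ketbra ψ) := by
  intro hfar
  have hψ1 := (isUnitVector_iff ψ).1 hψ
  have hpos : 0 < sqNorm ξ := by
    refine (sqNorm_nonneg ξ).lt_of_ne fun h0 => ?_
    have : ξ = 0 := sqNorm_eq_zero.1 h0.symm
    rw [this, sub_zero, hψ1] at hlt
    nlinarith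
  obtain ⟨c, hc, hcu⟩ := exists_unit_smul hpos
  have h1 := hfar (ketbra (c • ξ)) ⟨c • ξ, hcu, fun u v huv =>
    (schmidtRank_le_iff _ _ _).2 ((hξ u v huv).smul c), rfl⟩
  rw [traceDist_ketbra hψ hcu] at h1
  have h2 := sqNorm_mul_one_sub_le hψ1 ξ
  have h3 : 1 - sqNorm (ψ - ξ) ≤ ‖star ψ ⬝ᵥ (c • ξ)‖ ^ 2 := by
    rw [dotProduct_smul, smul_eq_mul, norm_mul, mul_pow]
    calc _ = ‖c‖ ^ 2 * (sqNorm ξ * (1 - sqNorm (ψ - ξ))) := by rw [← mul_assoc, hc, one_mul]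
      _ ≤ _ := by gcongr
  have h4 : ε ^ 2 ≤ 1 - ‖star ψ ⬝ᵥ (c • ξ)‖ ^ 2 := by
    have h5 := Real.sq_sqrt (show 0 ≤ 1 - ‖star ψ ⬝ᵥ (c • ξ)‖ ^ 2 by
      linarith [norm_star_dotProduct_sq_le_one hψ hcu])
    rw [← h5]
    gcongr
  linarith

theorem tpow_comp_equiv {κ κ' : Type*} (e : κ ≃ κ') (ψ : κ → ℂ) {ℓ : ℕ} (y : Fin ℓ → κ) :
    tpow (ψ ∘ e.symm) ℓ (fun i => e (y i)) = tpow ψ ℓ y := by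
  simp [tpow]

/-- If the tail of the Schmidt spectrum across a cut is at least `δ`, then the antisymmetric
component of the tensor power is a witness against Schmidt rank at most `r`. -/
theorem exists_witness_of_tail {d : V → ℕ} (S : Set V) [DecidablePred (· ∈ S)] {r : ℕ} (hr : 1 ≤ r)
    {ψ : ProdIdx d → ℂ} (hψ : sqNorm ψ = 1) {δ : ℝ} (hδ : 0 < δ) (hδr : δ * (r + 1) ≤ 1)
    (w : ((v : {v // v ∈ S}) → Fin (d v)) → ℝ) (hw : ∀ s, 0 ≤ w s)
    (u : ((v : {v // v ∈ S}) → Fin (d v)) → ((v : {v // v ∈ S}) → Fin (d v)) → ℂ)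
    (hu : ∀ s s', star (u s) ⬝ᵥ u s' = if s = s' then 1 else 0)
    (hX : ∀ a a', ∑ b, ψ ((cutEquiv d S).symm (a, b)) * star (ψ ((cutEquiv d S).symm (a', b))) =
      ∑ s, w s * (u s a * star (u s a')))
    (htail : ∀ A : Finset ((v : {v // v ∈ S}) → Fin (d v)), A.card ≤ r → δ ≤ ∑ s ∈ Aᶜ, w s) :
    ∃ W : (Fin (r + 1) → ProdIdx d) → ℂ,
      (∀ ξ, HasCutRank S r ξ → star (tpow ξ (r + 1)) ⬝ᵥ W = 0) ∧ 0 < sqNorm W ∧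
        δ ^ r / (2 * r !) * sqNorm W ≤ ‖star W ⬝ᵥ tpow ψ (r + 1)‖ ^ 2 := by
  set e := cutEquiv d S
  set X := ψ ∘ e.symm with hXdef
  set E : (Fin (r + 1) → ProdIdx d) ≃ (Fin (r + 1) → _ × _) := (Equiv.refl _).arrowCongr e
  set W : (Fin (r + 1) → ProdIdx d) → ℂ := detForm X (r + 1) ∘ E with hW
  have hdot : ∀ ξ : ProdIdx d → ℂ, star W ⬝ᵥ tpow ξ (r + 1) =
      star (detForm X (r + 1)) ⬝ᵥ tpow (ξ ∘ e.symm) (r + 1) := by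
    intro ξ
    rw [dotProduct, dotProduct, ← E.sum_comp]
    exact Finset.sum_congr rfl fun y _ => by rw [← tpow_comp_equiv e]; rfl
  have hsum : ∑ s, w s = 1 := by
    rw [sum_singular_eq_sqNorm X w u hu hX, hXdef, sqNorm_comp_equiv, hψ]
  have hN := sqNorm_detForm (ℓ := r + 1) X w u hu hX
  have hWN : sqNorm W = sqNorm (detForm X (r + 1)) := sqNorm_comp_equiv E _
  have hlow := le_injSum_of_tail hw hsum hδ.le hr hδr htail
  have hp : δ ^ r / (2 * r !) ≤ sqNorm W := by
    rw [hWN, hN, div_le_div_iff₀ (by positivity) (by positivity)]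
    rw [Nat.factorial_succ]
    push_cast
    have : (0 : ℝ) < r ! := by positivity
    nlinarith
  refine ⟨W, fun ξ hξ => ?_, lt_of_lt_of_le (by positivity) hp, ?_⟩
  · rw [← star_dotProduct_comm, hdot, star_detForm_dotProduct_tpow,
      detForm_eq_zero (Nat.lt_succ_self r) hξ.hasRankLE, dotProduct_zero, star_zero]
  · rw [hdot, star_detForm_dotProduct_tpow, ← hXdef, star_dotProduct_self, ← hWN,
      Complex.norm_real, Real.norm_eq_abs, sq_abs, sq]
    exact mul_le_mul_of_nonneg_right hp (sqNorm_nonneg W)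

/-- If every cut had a tail below ε²/(n - 1), truncation over the n - 1 edges would give a tree
state closer than ε. A cut with a large tail supplies the witness of `exists_witness_of_tail`. -/
theorem exists_witness_of_isFar {d : V → ℕ} {G : SimpleGraph V} (hG : G.IsTree) {r : ℕ}
    (hr : 1 ≤ r) {ε : ℝ} (hε : 0 < ε) (hεr : ε * (r + 1) ≤ 1) (hcard : 2 ≤ Fintype.card V)
    {ψ : ProdIdx d → ℂ} (hψ : IsUnitVector ψ) (hfar : IsFar ε (TTNS G d r) (ketbra ψ)) :
    ∃ W : (Fin (r + 1) → ProdIdx d) → ℂ,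
      (∀ ξ, (∀ u v, G.Adj u v → schmidtRank (edgeSide G u v) ξ ≤ r) →
        star (tpow ξ (r + 1)) ⬝ᵥ W = 0) ∧ 0 < sqNorm W ∧
        (ε ^ 2 / ((Fintype.card V : ℝ) - 1)) ^ r / (2 * r !) * sqNorm W ≤
          ‖star W ⬝ᵥ tpow ψ (r + 1)‖ ^ 2 := by
  classical
  have hψ1 := (isUnitVector_iff ψ).1 hψ
  have hm : (1 : ℝ) ≤ (Fintype.card V : ℝ) - 1 := by
    have : (2 : ℝ) ≤ Fintype.card V := by exact_mod_cast hcard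
    linarith
  set δ := ε ^ 2 / ((Fintype.card V : ℝ) - 1) with hδdef
  have hr1 : (1 : ℝ) ≤ r := by exact_mod_cast hr
  have hε1 : ε < 1 := by nlinarith
  have hδ : 0 < δ := by positivity
  have hδr : δ * (r + 1) ≤ 1 := by
    have : δ ≤ ε := by
      rw [hδdef, div_le_iff₀ (by linarith)]
      nlinarith
    nlinarith
  obtain ⟨p, hadj, hp, hlam⟩ := exists_laminar_orientation hG
  set S : G.edgeSet → Set V := fun e => edgeSide G (p e).1 (p e).2
  have hsing := fun e => exists_singular_basis (ψ ∘ (cutEquiv d (S e)).symm)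
  choose w u hw hu hX using hsing
  by_cases h : ∃ e, ∀ A : Finset ((v : {v // v ∈ S e}) → Fin (d v)), A.card ≤ r →
      δ ≤ ∑ s ∈ Aᶜ, w e s
  · obtain ⟨e, he⟩ := h
    obtain ⟨W, hW1, hW2, hW3⟩ := exists_witness_of_tail (S e) hr hψ1 hδ hδr (w e) (hw e) (u e)
      (hu e) (hX e) he
    exact ⟨W, fun ξ hξ => hW1 ξ ((schmidtRank_le_iff _ _ _).1 (hξ _ _ (hadj e))), hW2, hW3⟩
  · exfalso
    push Not at h
    choose T hT hTδ using h
    obtain ⟨ξ, hξ, hrank⟩ := exists_hasCutRank_of_laminar (r := r) ψ S (fun e => (S e).ncard)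
      (fun e => ∑ s ∈ (T e)ᶜ, w e s) hlam (fun e => by
        obtain ⟨Q, h1, h2, h3, h4, h5⟩ := exists_cut_projection (S e) ψ (w e) (u e) (hu e) (hX e)
          (T e) (hT e)
        exact ⟨Q, h1, h2, h3.le, h4, h5⟩) Finset.univ
    have hcardE : (Fintype.card G.edgeSet : ℝ) = (Fintype.card V : ℝ) - 1 := by
      have := hG.card_edgeFinset
      rw [SimpleGraph.edgeFinset_card] at this
      rw [← this]
      push_cast
      ring
    have hne : (Finset.univ : Finset G.edgeSet).Nonempty := by
      rw [← Finset.card_pos, Finset.card_univ]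
      have : (0 : ℝ) < Fintype.card G.edgeSet := by rw [hcardE]; linarith
      exact_mod_cast this
    have hlt : ∑ e, ∑ s ∈ (T e)ᶜ, w e s < ε ^ 2 := by
      calc _ < ∑ _e : G.edgeSet, δ := Finset.sum_lt_sum_of_nonempty hne fun e _ => hTδ e
        _ = ε ^ 2 := by
          rw [Finset.sum_const, Finset.card_univ, nsmul_eq_mul, hcardE, hδdef,
            mul_div_cancel₀ _ (by linarith)]
    exact not_isFar_of_approx hε hε1 hψ (fun u v huv =>
      hasCutRank_edgeSide_of_orientation hG hp (fun e => hrank e (Finset.mem_univ e)) huv)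
      (hξ.trans_lt hlt) hfar

theorem exists_nonadaptive_tester_TTNS {G : SimpleGraph V} (hG : G.IsTree) {r : ℕ} (hr : 1 ≤ r)
    {ε : ℝ} (hε : 0 < ε) (hεr : ε * (r + 1) ≤ 1) (d : V → ℕ) :
    ∃ (k : ℕ) (T : AdaptiveTest (ProdIdx d) (r + 1) k),
      T.IsNonadaptive ∧ T.IsOneSidedTester (TTNS G d r) ε ∧
      (T.numCopies : ℝ) ≤
        4 * (((Fintype.card V : ℝ) - 1) ^ r * ((r + 1)! : ℝ) / ε ^ (2 * r)) := by
  have hV : 1 ≤ Fintype.card V := by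
    have := hG.connected.nonempty
    exact Fintype.card_pos
  rcases hV.eq_or_lt with hV1 | hV2
  -- On a single vertex every pure state is a tree tensor network state, so no state is far, and the
  -- claimed bound is 0.
  · refine ⟨0, .output true, ⟨[], rfl⟩, ⟨fun _ _ => by simp [AdaptiveTest.acceptProb], ?_⟩, ?_⟩
    · rintro _ ⟨ψ, hψ, rfl⟩ hfar
      exfalso
      have hsub : Subsingleton V := Fintype.card_le_one_iff_subsingleton.1 hV1.symm.le
      have := hfar (ketbra ψ) ⟨ψ, hψ, fun u v huv => (huv.ne (Subsingleton.elim u v)).elim, rfl⟩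
      rw [traceDist_ketbra hψ hψ, show star ψ ⬝ᵥ ψ = 1 from hψ] at this
      simp at this
      linarith
    · rw [← hV1]
      have hr0 : r ≠ 0 := by omega
      simp [AdaptiveTest.numCopies, hr0]
  · have hm : (1 : ℝ) ≤ (Fintype.card V : ℝ) - 1 := by
      have : (2 : ℝ) ≤ Fintype.card V := by exact_mod_cast hV2
      linarith
    set m : ℝ := (Fintype.card V : ℝ) - 1 with hmdef
    set p : ℝ := (ε ^ 2 / m) ^ r / (2 * r !) with hp
    have hp0 : 0 < p := by positivity
    have hr1 : (1 : ℝ) ≤ r := by exact_mod_cast hr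
    have hp1 : p ≤ 1 := by
      have h1 : ε ^ 2 / m ≤ 1 := by
        rw [div_le_one (by linarith)]
        nlinarith
      have h2 : (ε ^ 2 / m) ^ r ≤ 1 := pow_le_one₀ (by positivity) h1
      have h3 : (1 : ℝ) ≤ r ! := by exact_mod_cast Nat.one_le_iff_ne_zero.2 (Nat.factorial_ne_zero r)
      rw [hp, div_le_one (by positivity)]
      linarith
    -- This many rounds leave acceptance probability at most 1/e < 2/3; since p ≤ 1, rounding up at
    -- most doubles 1/p.
    set k := ⌈1 / p⌉₊ with hk
    have hk1 : 1 / p ≤ k := Nat.le_ceil _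
    have hk2 : (k : ℝ) < 1 / p + 1 := Nat.ceil_lt_add_one (by positivity)
    have hpow : (1 - p) ^ k ≤ 2 / 3 := by
      calc (1 - p) ^ k ≤ Real.exp (-p) ^ k := by
            refine pow_le_pow_left₀ (by linarith) ?_ k
            linarith [Real.add_one_le_exp (-p)]
        _ = Real.exp (-(k * p)) := by rw [← Real.exp_nat_mul]; congr 1; ring
        _ ≤ Real.exp (-1) := by
            rw [Real.exp_le_exp]
            rw [div_le_iff₀ hp0] at hk1
            linarith
        _ ≤ 2 / 3 := by linarith [Real.exp_neg_one_lt_d9]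
    obtain ⟨T, hT1, hT2⟩ := AdaptiveTest.exists_isOneSidedTester (ℓ := r + 1)
      {ξ | ∀ u v, G.Adj u v → schmidtRank (edgeSide G u v) ξ ≤ r} (TTNS G d r)
      (by rintro ρ ⟨ξ, h1, h2, h3⟩; exact ⟨ξ, h2, h1, h3⟩) ε p
      (fun ψ hψ hfar => exists_witness_of_isFar hG hr hε hεr hV2 hψ hfar) k hpow
    refine ⟨k, T, hT1, hT2, ?_⟩
    have hkp : (k : ℝ) ≤ 2 / p := by
      have : 1 ≤ 1 / p := by rw [le_div_iff₀ hp0]; linarith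
      have e : 2 / p = 1 / p + 1 / p := by ring
      linarith
    rw [AdaptiveTest.numCopies, Nat.factorial_succ]
    push_cast
    calc (k : ℝ) * (r + 1) ≤ 2 / p * (r + 1) := by gcongr
      _ = _ := by
        rw [hp, div_pow, ← pow_mul]
        field_simp
        ring

end upper

/-! ### Product vectors -/

/-- The product vector `⨂ e, η e`. -/
def prodVec {E κ : Type*} [Fintype E] (η : E → κ → ℂ) : (E → κ) → ℂ :=
  fun x => ∏ e, η e (x e)

theorem funSplitAt_symm_self {E κ : Type*} [DecidableEq E] (a : E) (p : κ) (v : {j // j ≠ a} → κ) :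
    (Equiv.funSplitAt a κ).symm (p, v) a = p := by
  simp [Equiv.funSplitAt, Equiv.piSplitAt]

theorem funSplitAt_symm_ne {E κ : Type*} [DecidableEq E] (a : E) (p : κ) (v : {j // j ≠ a} → κ) {j : E} (hj : j ≠ a) :
    (Equiv.funSplitAt a κ).symm (p, v) j = v ⟨j, hj⟩ := by
  simp [Equiv.funSplitAt, Equiv.piSplitAt, hj]

section prodVec

variable {E κ : Type*} [Fintype E]

theorem tpow_prodVec (η : E → κ → ℂ) (ℓ : ℕ) (y : Fin ℓ → E → κ) :
    tpow (prodVec η) ℓ y = prodVec (fun e => tpow (η e) ℓ) fun e i => y i e := by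
  simp only [tpow, prodVec]
  exact Finset.prod_comm

variable [DecidableEq E]

theorem star_prodVec_dotProduct_prodVec [Fintype κ] (η ζ : E → κ → ℂ) :
    star (prodVec η) ⬝ᵥ prodVec ζ = ∏ e, star (η e) ⬝ᵥ ζ e := by
  simp only [dotProduct, prodVec, Pi.star_apply, star_prod, ← Finset.prod_mul_distrib]
  exact sum_pi_prod fun e p => star (η e p) * ζ e p

theorem sqNorm_prodVec [Fintype κ] (η : E → κ → ℂ) : sqNorm (prodVec η) = ∏ e, sqNorm (η e) := by
  have h := star_prodVec_dotProduct_prodVec η η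
  simp only [star_dotProduct_self] at h
  exact_mod_cast h

/-- `prodVec` is linear in each factor, so the factors can be moved from the generators to their
spans one at a time. -/
theorem prodVec_mem_span {v : E → κ → ℂ} {S : E → Set (κ → ℂ)}
    (hv : ∀ e, v e ∈ Submodule.span ℂ (S e)) :
    prodVec v ∈ Submodule.span ℂ (prodVec '' {s | ∀ e, s e ∈ S e}) := by
  have key : ∀ (A : Finset E) (v : E → κ → ℂ), (∀ e ∈ A, v e ∈ Submodule.span ℂ (S e)) →
      (∀ e ∉ A, v e ∈ S e) →
      prodVec v ∈ Submodule.span ℂ (prodVec '' {s | ∀ e, s e ∈ S e}) := by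
    intro A
    induction A using Finset.induction_on with
    | empty => exact fun v _ h => Submodule.subset_span ⟨v, fun e => h e (Finset.notMem_empty e), rfl⟩
    | insert a A ha ih =>
      intro v h1 h2
      have hupd : ∀ z x, prodVec (Function.update v a z) x =
          z (x a) * ∏ e ∈ Finset.univ.erase a, v e (x e) := by
        intro z x
        rw [prodVec, ← Finset.mul_prod_erase _ _ (Finset.mem_univ a), Function.update_self]
        congr 1
        exact Finset.prod_congr rfl fun e he => by
          rw [Function.update_of_ne (Finset.ne_of_mem_erase he)]
      let f : (κ → ℂ) →ₗ[ℂ] ((E → κ) → ℂ) :=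
        { toFun := fun z => prodVec (Function.update v a z)
          map_add' := fun z z' => by
            ext x
            simp only [hupd, Pi.add_apply, add_mul]
          map_smul' := fun c z => by
            ext x
            simp only [hupd, Pi.smul_apply, smul_eq_mul, RingHom.id_apply, mul_assoc] }
      have hle : Submodule.span ℂ (S a) ≤
          (Submodule.span ℂ (prodVec '' {s | ∀ e, s e ∈ S e})).comap f := by
        rw [Submodule.span_le]
        intro z hz
        refine ih (Function.update v a z) (fun e he => ?_) fun e he => ?_
        · rw [Function.update_of_ne (by rintro rfl; exact ha he)]
          exact h1 e (Finset.mem_insert_of_mem he)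
        · by_cases hea : e = a
          · subst hea
            rwa [Function.update_self]
          · rw [Function.update_of_ne hea]
            exact h2 e (by simp [hea, he])
      have := hle (h1 a (Finset.mem_insert_self a A))
      simpa [f] using this
  exact key Finset.univ v (fun e _ => hv e) (by simp)

/-- The contraction of `ξ` with the vectors `ζ j`, `j ≠ a`. -/
def contractExcept [Fintype κ] (ζ : E → κ → ℂ) (ξ : (E → κ) → ℂ) (a : E) : κ → ℂ :=
  fun p => ∑ v : {j // j ≠ a} → κ,
    (∏ j : {j // j ≠ a}, star (ζ j (v j))) * ξ ((Equiv.funSplitAt a κ).symm (p, v))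

theorem star_prodVec_update_dotProduct [Fintype κ] (ζ : E → κ → ℂ) (ξ : (E → κ) → ℂ) (a : E)
    (z : κ → ℂ) : star (prodVec (Function.update ζ a z)) ⬝ᵥ ξ =
      star z ⬝ᵥ contractExcept ζ ξ a := by
  rw [dotProduct, ← (Equiv.funSplitAt a κ).symm.sum_comp, Fintype.sum_prod_type, dotProduct]
  refine Finset.sum_congr rfl fun p _ => ?_
  rw [contractExcept, Finset.mul_sum]
  refine Finset.sum_congr rfl fun v _ => ?_
  rw [Pi.star_apply, prodVec, star_prod, Fintype.prod_eq_mul_prod_subtype_ne _ a,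
    Function.update_self, funSplitAt_symm_self, mul_assoc, Pi.star_apply]
  congr 2
  refine Finset.prod_congr rfl fun j _ => ?_
  rw [Function.update_of_ne j.2, funSplitAt_symm_ne _ _ _ j.2]

theorem sum_mul_of_dependsOn {J : Type*} [Fintype J] [DecidableEq J] [Fintype κ] (P : J → Prop)
    [DecidablePred P] {f g : (J → κ) → ℂ} (hf : DependsOn f {j | P j})
    (hg : DependsOn g {j | ¬ P j}) (v₀ : J → κ) :
    ∑ v, f v * g v =
      (∑ u : {j // P j} → κ, f ((Equiv.piEquivPiSubtypeProd P fun _ => κ).symm (u, fun j => v₀ j))) *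
      ∑ u : {j // ¬ P j} → κ, g ((Equiv.piEquivPiSubtypeProd P fun _ => κ).symm (fun j => v₀ j, u)) := by
  rw [← (Equiv.piEquivPiSubtypeProd P fun _ => κ).symm.sum_comp, Fintype.sum_prod_type,
    Finset.sum_mul_sum]
  refine Finset.sum_congr rfl fun u _ => Finset.sum_congr rfl fun u' _ => ?_
  congr 1
  · refine hf fun j hj => ?_
    have hj' : P j := hj
    simp [Equiv.piEquivPiSubtypeProd, hj']
  · refine hg fun j hj => ?_
    have hj' : ¬ P j := hj
    simp [Equiv.piEquivPiSubtypeProd, hj']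

/-- `ξ` has rank at most `r` with respect to a bipartition of the halves of the edges that
separates the two halves of `a`, and keeps the two halves of any other edge together. -/
def HasEdgeRank {F : Type*} (r : ℕ) (ξ : (E → F × F) → ℂ) (a : E) : Prop :=
  ∃ (P : E → Prop) (A B : Fin r → (E → F × F) → ℂ),
    (∀ k x y, (∀ e, e ≠ a → P e → x e = y e) → (x a).1 = (y a).1 → A k x = A k y) ∧
    (∀ k x y, (∀ e, e ≠ a → ¬ P e → x e = y e) → (x a).2 = (y a).2 → B k x = B k y) ∧
    ∀ x, ξ x = ∑ k, A k x * B k x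

/-- Every contracted edge has both halves on the same side of the bipartition, so in each of the r
terms the contraction factors into a function of the first half of a times a function of the second.
-/
theorem HasEdgeRank.hasRankLE_contractExcept {F : Type*} [Fintype F] [Nonempty F] {r : ℕ}
    {ξ : (E → F × F) → ℂ} {a : E} (h : HasEdgeRank r ξ a) (ζ : E → F × F → ℂ) :
    HasRankLE r (contractExcept ζ ξ a) := by
  classical
  obtain ⟨P, A, B, hA, hB, h⟩ := h
  obtain ⟨f₀⟩ := ‹Nonempty F›
  let v₀ : {j // j ≠ a} → F × F := fun _ => (f₀, f₀)
  let P' : {j // j ≠ a} → Prop := fun j => P j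
  let e := Equiv.funSplitAt a (F × F)
  let gl := Equiv.piEquivPiSubtypeProd P' fun _ => F × F
  let f : Fin r → F × F → ({j // j ≠ a} → F × F) → ℂ := fun k p v =>
    (∏ j with P' j, star (ζ j (v j))) * A k (e.symm (p, v))
  let g : Fin r → F × F → ({j // j ≠ a} → F × F) → ℂ := fun k p v =>
    (∏ j with ¬ P' j, star (ζ j (v j))) * B k (e.symm (p, v))
  have hf : ∀ k p, DependsOn (f k p) {j | P' j} := by
    intro k p v v' hvv
    dsimp only [f]
    congr 1
    · exact Finset.prod_congr rfl fun j hj => by rw [hvv j (Finset.mem_filter.1 hj).2]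
    · refine hA k _ _ (fun j hj hPj => ?_) ?_
      · rw [funSplitAt_symm_ne _ _ _ hj, funSplitAt_symm_ne _ _ _ hj]
        exact hvv ⟨j, hj⟩ hPj
      · rw [funSplitAt_symm_self, funSplitAt_symm_self]
  have hg : ∀ k p, DependsOn (g k p) {j | ¬ P' j} := by
    intro k p v v' hvv
    dsimp only [g]
    congr 1
    · exact Finset.prod_congr rfl fun j hj => by rw [hvv j (Finset.mem_filter.1 hj).2]
    · refine hB k _ _ (fun j hj hPj => ?_) ?_
      · rw [funSplitAt_symm_ne _ _ _ hj, funSplitAt_symm_ne _ _ _ hj]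
        exact hvv ⟨j, hj⟩ hPj
      · rw [funSplitAt_symm_self, funSplitAt_symm_self]
  refine ⟨fun k i => ∑ u, f k (i, f₀) (gl.symm (u, fun j => v₀ j)),
    fun k i => ∑ u, g k (f₀, i) (gl.symm (fun j => v₀ j, u)), fun p => ?_⟩
  have h1 : contractExcept ζ ξ a p = ∑ k, ∑ v, f k p v * g k p v := by
    rw [contractExcept, Finset.sum_comm]
    refine Finset.sum_congr rfl fun v _ => ?_
    rw [h, Finset.mul_sum]
    refine Finset.sum_congr rfl fun k _ => ?_
    rw [← Finset.prod_filter_mul_prod_filter_not Finset.univ P']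
    dsimp only [f, g]
    ring
  rw [h1]
  refine Finset.sum_congr rfl fun k _ => ?_
  rw [sum_mul_of_dependsOn P' (hf k p) (hg k p) v₀]
  congr 1
  · refine Finset.sum_congr rfl fun u _ => ?_
    dsimp only [f]
    congr 1
    refine hA k _ _ (fun j hj _ => ?_) ?_
    · rw [funSplitAt_symm_ne _ _ _ hj, funSplitAt_symm_ne _ _ _ hj]
    · rw [funSplitAt_symm_self, funSplitAt_symm_self]
  · refine Finset.sum_congr rfl fun u _ => ?_
    dsimp only [g]
    congr 1
    refine hB k _ _ (fun j hj _ => ?_) ?_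
    · rw [funSplitAt_symm_ne _ _ _ hj, funSplitAt_symm_ne _ _ _ hj]
    · rw [funSplitAt_symm_self, funSplitAt_symm_self]

/-- The one-edge bound tensorizes: slots holding arbitrary unit vectors are replaced by χ one at a
time. Contracting every slot except a leaves X of rank at most r, so inserting χ costs the factor c
relative to ‖X‖². -/
theorem norm_star_prodVec_dotProduct_sq_le {F : Type*} [Fintype F] [Nonempty F] {r : ℕ} {c : ℝ}
    (hc : 0 ≤ c) {χ : F × F → ℂ}
    (hχ : ∀ X : F × F → ℂ, HasRankLE r X → ‖star χ ⬝ᵥ X‖ ^ 2 ≤ c * sqNorm X)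
    {ξ : (E → F × F) → ℂ} (hξ : ∀ e, HasEdgeRank r ξ e) (hχ1 : sqNorm χ = 1) :
    ‖star (prodVec fun _ : E => χ) ⬝ᵥ ξ‖ ^ 2 ≤ c ^ Fintype.card E * sqNorm ξ := by
  have key : ∀ (A : Finset E) (η : E → F × F → ℂ), (∀ e, sqNorm (η e) = 1) →
      ‖star (prodVec fun e => if e ∈ A then χ else η e) ⬝ᵥ ξ‖ ^ 2 ≤ c ^ A.card * sqNorm ξ := by
    intro A
    induction A using Finset.induction_on with
    | empty =>
      intro η hη
      refine (norm_star_dotProduct_sq_le _ _).trans_eq ?_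
      rw [sqNorm_prodVec]
      simp [hη]
    | insert a A ha ih =>
      intro η hη
      set ζ : E → F × F → ℂ := fun e => if e ∈ A then χ else η e with hζ
      have h1 : (fun e => if e ∈ insert a A then χ else η e) = Function.update ζ a χ := by
        ext1 e
        by_cases hea : e = a
        · subst hea
          simp
        · simp [hea, hζ]
      set X := contractExcept ζ ξ a with hX
      have h2 := hχ X ((hξ a).hasRankLE_contractExcept ζ)
      have h3 : sqNorm X ≤ c ^ A.card * sqNorm ξ := by
        rcases (sqNorm_nonneg X).eq_or_lt with h0 | h0
        · rw [← h0]
          exact mul_nonneg (pow_nonneg hc _) (sqNorm_nonneg ξ)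
        -- ‖X‖² is itself the squared overlap obtained with the unit vector X / ‖X‖ in slot a, which
        -- the induction hypothesis bounds.
        · obtain ⟨t, ht, htu⟩ := exists_unit_smul h0
          have h4 := ih (Function.update η a (t • X)) fun e => by
            by_cases hea : e = a
            · subst hea
              rw [Function.update_self, (isUnitVector_iff _).1 htu]
            · rw [Function.update_of_ne hea, hη]
          have h5 : (fun e => if e ∈ A then χ else Function.update η a (t • X) e) =
              Function.update ζ a (t • X) := by
            ext1 e
            by_cases hea : e = a
            · subst hea
              simp [ha]
            · simp [hea, hζ]
          rw [h5, star_prodVec_update_dotProduct, ← hX, star_smul, smul_dotProduct,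
            star_dotProduct_self, smul_eq_mul, norm_mul, norm_star, Complex.norm_real, mul_pow,
            Real.norm_eq_abs, sq_abs, sq (sqNorm X), ← mul_assoc, ht, one_mul] at h4
          exact h4
      rw [h1, star_prodVec_update_dotProduct, ← hX, Finset.card_insert_of_notMem ha, pow_succ' c]
      calc _ ≤ c * sqNorm X := h2
        _ ≤ c * (c ^ A.card * sqNorm ξ) := by gcongr
        _ = _ := by ring
  have := key Finset.univ (fun _ => χ) fun _ => hχ1
  simpa using this

/-- The component of `χ^{⊗ ℓ}`, `χ` a product over the edges, that is not antisymmetric for any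
edge. -/
theorem exists_approx_tpow_prodVec {F : Type*} [Fintype F] [DecidableEq F] {r : ℕ} {χ : F × F → ℂ}
    (hχ1 : sqNorm χ = 1) : ∃ v ∈ Submodule.span ℂ ((fun ζ => tpow (prodVec ζ) (r + 1)) ''
      {ζ : E → F × F → ℂ | ∀ e, HasRankLE r (ζ e)}),
    sqNorm (tpow (prodVec fun _ : E => χ) (r + 1) - v) ≤
      Fintype.card E * sqNorm (detForm χ (r + 1)) := by
  set p := sqNorm (detForm χ (r + 1)) with hp
  let sw : (Fin (r + 1) → E → F × F) ≃ (E → Fin (r + 1) → F × F) := Equiv.piComm fun _ _ => F × F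
  set u : (Fin (r + 1) → F × F) → ℂ := tpow χ (r + 1) - detForm χ (r + 1) with hu
  set t : (E → Fin (r + 1) → F × F) → ℂ := prodVec fun _ : E => tpow χ (r + 1) with ht
  have hdot : star (tpow χ (r + 1)) ⬝ᵥ detForm χ (r + 1) = (p : ℂ) := by
    rw [← star_dotProduct_comm, star_detForm_dotProduct_tpow, star_dotProduct_self,
      Complex.star_def, Complex.conj_ofReal]
  have htt : sqNorm (tpow χ (r + 1)) = 1 := by rw [sqNorm_tpow, hχ1, one_pow]
  have hu1 : star (tpow χ (r + 1)) ⬝ᵥ u = ((1 - p : ℝ) : ℂ) := by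
    rw [hu, dotProduct_sub, hdot, star_dotProduct_self, htt]
    push_cast
    ring
  have hu2 : sqNorm u = 1 - p := by
    rw [hu, sqNorm_sub, hdot, htt, Complex.ofReal_re, ← hp]
    ring
  refine ⟨prodVec (fun _ : E => u) ∘ sw, ?_, ?_⟩
  · have h1 := prodVec_mem_span (E := E) (v := fun _ => u)
      (S := fun _ => (fun Y => tpow Y (r + 1)) '' {Y : F × F → ℂ | HasRankLE r Y})
      fun _ => tpow_sub_detForm_mem_span χ
    have h2 := Submodule.mem_map_of_mem (f := LinearMap.funLeft ℂ ℂ sw) h1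
    rw [Submodule.map_span] at h2
    refine Submodule.span_mono ?_ h2
    rintro _ ⟨_, ⟨s, hs, rfl⟩, rfl⟩
    choose ζ hζ hζs using hs
    refine ⟨ζ, hζ, ?_⟩
    ext y
    have hs' : (fun e => tpow (ζ e) (r + 1)) = s := funext hζs
    change tpow (prodVec ζ) (r + 1) y = _
    rw [tpow_prodVec, hs']
    rfl
  · have h1 : tpow (prodVec fun _ : E => χ) (r + 1) = t ∘ sw := by
      ext y
      rw [tpow_prodVec]
      rfl
    have h2 : tpow (prodVec fun _ : E => χ) (r + 1) - prodVec (fun _ : E => u) ∘ sw =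
        (t - prodVec fun _ : E => u) ∘ sw := by
      rw [h1]; rfl
    have hp1 : p ≤ 1 := by
      have := sqNorm_nonneg u
      linarith
    rw [h2, sqNorm_comp_equiv, sqNorm_sub, ht, star_prodVec_dotProduct_prodVec, sqNorm_prodVec,
      sqNorm_prodVec, hu1, hu2, htt]
    simp only [Finset.prod_const, Finset.card_univ, one_pow]
    rw [← Complex.ofReal_pow, Complex.ofReal_re]
    -- Each factor u has squared norm 1 - p and overlap 1 - p with χ^{⊗(r+1)}, so the squared
    -- distance is 1 - (1 - p)^|E|, at most |E| p by Bernoulli.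
    have := one_add_mul_le_pow (a := -p) (by linarith) (Fintype.card E)
    rw [← sub_eq_add_neg] at this
    linarith

end prodVec

/-! ### Embedding the halves of the edges into the physical spaces -/

section embed

variable {V E F : Type*} {d : V → ℕ}

/-- The coordinates of the halves of the edges that sit at the vertex `v`; the others are set to
`f₀`. -/
def localHalves (p : E → V × V) (f₀ : F) (x : E → F × F) (v : V) [DecidableEq V] :
    E → F × F :=
  fun e => (if (p e).1 = v then (x e).1 else f₀, if (p e).2 = v then (x e).2 else f₀)

/-- The basis vector of the physical space given by the coordinates of the halves of the edges. -/
def halvesEmb [DecidableEq V] (p : E → V × V) (f₀ : F) (j : (v : V) → (E → F × F) ↪ Fin (d v))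
    (x : E → F × F) : ProdIdx d :=
  fun v => j v (localHalves p f₀ x v)

/-- Both recognizing the image and reading off a half-edge use the coordinate of a single vertex.
This locality lets indicator and decoding be split along a cut of V. -/
theorem exists_halves_decoding [DecidableEq V] [Nonempty F] (p : E → V × V) (f₀ : F)
    (j : (v : V) → (E → F × F) ↪ Fin (d v)) :
    ∃ (R : (v : V) → Fin (d v) → Prop) (D₁ D₂ : E → (v : V) → Fin (d v) → F),
      (∀ x v, R v (halvesEmb p f₀ j x v)) ∧
      (∀ x e, D₁ e (p e).1 (halvesEmb p f₀ j x (p e).1) = (x e).1) ∧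
      (∀ x e, D₂ e (p e).2 (halvesEmb p f₀ j x (p e).2) = (x e).2) ∧
      ∀ y : ProdIdx d, (∀ v, R v (y v)) →
        halvesEmb p f₀ j (fun e => (D₁ e (p e).1 (y (p e).1), D₂ e (p e).2 (y (p e).2))) = y := by
  have hinv : ∀ v z, Function.invFun (j v) (j v z) = z := fun v =>
    Function.leftInverse_invFun (j v).injective
  refine ⟨fun v c => ∃ x, c = j v (localHalves p f₀ x v),
    fun e v c => (Function.invFun (j v) c e).1, fun e v c => (Function.invFun (j v) c e).2,
    fun x v => ⟨x, rfl⟩, fun x e => ?_, fun x e => ?_, fun y hy => ?_⟩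
  · simp [halvesEmb, hinv, localHalves]
  · simp [halvesEmb, hinv, localHalves]
  · choose x hx using hy
    funext v
    rw [halvesEmb, hx v]
    congr 1
    funext e
    refine Prod.ext ?_ ?_
    · by_cases h : (p e).1 = v
      · subst h
        simp [localHalves, hx, hinv]
      · simp [localHalves, h]
    · by_cases h : (p e).2 = v
      · subst h
        simp [localHalves, hx, hinv]
      · simp [localHalves, h]

theorem halvesEmb_injective [DecidableEq V] [Nonempty F] (p : E → V × V) (f₀ : F)
    (j : (v : V) → (E → F × F) ↪ Fin (d v)) : Function.Injective (halvesEmb p f₀ j) := by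
  obtain ⟨-, D₁, D₂, -, h1, h2, -⟩ := exists_halves_decoding p f₀ j
  intro x x' h
  funext e
  refine Prod.ext ?_ ?_
  · rw [← h1 x e, ← h1 x' e, h]
  · rw [← h2 x e, ← h2 x' e, h]

theorem halvesEmb_apply_eq [DecidableEq V] (p : E → V × V) (f₀ : F)
    (j : (v : V) → (E → F × F) ↪ Fin (d v)) {x x' : E → F × F} {v : V}
    (h1 : ∀ e, (p e).1 = v → (x e).1 = (x' e).1) (h2 : ∀ e, (p e).2 = v → (x e).2 = (x' e).2) :
    halvesEmb p f₀ j x v = halvesEmb p f₀ j x' v := by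
  rw [halvesEmb, halvesEmb]
  congr 1
  funext e
  refine Prod.ext ?_ ?_
  · by_cases h : (p e).1 = v
    · simp [localHalves, h, h1 e h]
    · simp [localHalves, h]
  · by_cases h : (p e).2 = v
    · simp [localHalves, h, h2 e h]
    · simp [localHalves, h]

/-- Pulling back along the embedding turns cut rank into edge rank. -/
theorem HasCutRank.hasEdgeRank_comp [DecidableEq V] [DecidableEq E] {p : E → V × V} {f₀ : F}
    {j : (v : V) → (E → F × F) ↪ Fin (d v)} {S : Set V} {r : ℕ} {ξ : ProdIdx d → ℂ}
    (h : HasCutRank S r ξ) (a : E) (ha1 : (p a).1 ∈ S) (ha2 : (p a).2 ∉ S)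
    (hsep : ∀ e, e ≠ a → ((p e).1 ∈ S ↔ (p e).2 ∈ S)) :
    HasEdgeRank r (ξ ∘ halvesEmb p f₀ j) a := by
  obtain ⟨A, B, hA, hB, h⟩ := h
  refine ⟨fun e => (p e).1 ∈ S, fun k x => A k (halvesEmb p f₀ j x),
    fun k x => B k (halvesEmb p f₀ j x), fun k x y hxy hxya => ?_, fun k x y hxy hxya => ?_,
    fun x => h _⟩
  · refine hA k fun v hv => halvesEmb_apply_eq p f₀ j (fun e he => ?_) fun e he => ?_
    · by_cases hea : e = a
      · rw [hea, hxya]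
      · rw [hxy e hea (show (p e).1 ∈ S from he ▸ hv)]
    · by_cases hea : e = a
      · subst hea
        exact (ha2 (he ▸ hv)).elim
      · rw [hxy e hea ((hsep e hea).2 (he ▸ hv))]
  · refine hB k fun v hv => halvesEmb_apply_eq p f₀ j (fun e he => ?_) fun e he => ?_
    · by_cases hea : e = a
      · subst hea
        exact (hv (he ▸ ha1)).elim
      · rw [hxy e hea fun h' => hv (he ▸ h')]
    · by_cases hea : e = a
      · rw [hea, hxya]
      · rw [hxy e hea fun h' => hv (he ▸ (hsep e hea).1 h')]

/-- A product of vectors of rank at most `r` on the edges has cut rank at most `r` after the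
embedding. -/
theorem hasCutRank_extend_prodVec [Fintype V] [DecidableEq V] [Fintype E] [DecidableEq E]
    [Nonempty F] {p : E → V × V} {f₀ : F} {j : (v : V) → (E → F × F) ↪ Fin (d v)} {S : Set V}
    {r : ℕ} {ζ : E → F × F → ℂ} (a : E) (hζ : HasRankLE r (ζ a)) (ha1 : (p a).1 ∈ S)
    (ha2 : (p a).2 ∉ S) (hsep : ∀ e, e ≠ a → ((p e).1 ∈ S ↔ (p e).2 ∈ S)) :
    HasCutRank S r (Function.extend (halvesEmb p f₀ j) (prodVec ζ) 0) := by
  classical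
  obtain ⟨R, D₁, D₂, hR, hD₁, hD₂, hdec⟩ := exists_halves_decoding p f₀ j
  obtain ⟨A, B, hAB⟩ := hζ
  let dec : ProdIdx d → E → F × F := fun y e => (D₁ e (p e).1 (y (p e).1), D₂ e (p e).2 (y (p e).2))
  refine ⟨fun k y => if ∀ v ∈ S, R v (y v) then
      (∏ e ∈ Finset.univ.erase a with (p e).1 ∈ S, ζ e (dec y e)) * A k (dec y a).1 else 0,
    fun k y => if ∀ v ∉ S, R v (y v) then
      (∏ e ∈ Finset.univ.erase a with (p e).1 ∉ S, ζ e (dec y e)) * B k (dec y a).2 else 0,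
    fun k y y' hyy => ?_, fun k y y' hyy => ?_, fun y => ?_⟩
  · dsimp only
    refine if_congr (forall₂_congr fun v hv => by rw [hyy v hv]) ?_ rfl
    congr 1
    · refine Finset.prod_congr rfl fun e he => ?_
      obtain ⟨he1, he2⟩ := Finset.mem_filter.1 he
      dsimp only [dec]
      rw [hyy _ he2, hyy _ ((hsep e (Finset.ne_of_mem_erase he1)).1 he2)]
    · dsimp only [dec]
      rw [hyy _ ha1]
  · dsimp only
    refine if_congr (forall₂_congr fun v hv => by rw [hyy v hv]) ?_ rfl
    congr 1
    · refine Finset.prod_congr rfl fun e he => ?_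
      obtain ⟨he1, he2⟩ := Finset.mem_filter.1 he
      dsimp only [dec]
      rw [hyy _ he2, hyy (p e).2 fun h => he2 ((hsep e (Finset.ne_of_mem_erase he1)).2 h)]
    · dsimp only [dec]
      rw [hyy (p a).2 ha2]
  · by_cases hy : ∀ v, R v (y v)
    · have hy' : halvesEmb p f₀ j (dec y) = y := hdec y hy
      conv_lhs => rw [← hy']
      rw [(halvesEmb_injective p f₀ j).extend_apply, prodVec,
        ← Finset.mul_prod_erase _ _ (Finset.mem_univ a), hAB, Finset.sum_mul,
        ← Finset.prod_filter_mul_prod_filter_not (Finset.univ.erase a) fun e => (p e).1 ∈ S]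
      refine Finset.sum_congr rfl fun k _ => ?_
      dsimp only
      rw [if_pos fun v _ => hy v, if_pos fun v _ => hy v]
      ring
    · rw [Function.extend_apply', Pi.zero_apply]
      · symm
        refine Finset.sum_eq_zero fun k _ => ?_
        dsimp only
        by_cases h1 : ∀ v ∈ S, R v (y v)
        · rw [if_neg (c := ∀ v ∉ S, R v (y v)), mul_zero]
          exact fun h2 => hy fun v => if hv : v ∈ S then h1 v hv else h2 v hv
        · rw [if_neg h1, zero_mul]
      · rintro ⟨x, rfl⟩
        exact hy (hR x)

end embed

/-! ### Extension by zero along an injection. -/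

section extend

variable {κ κ' : Type*} [Fintype κ] [Fintype κ'] {i : κ → κ'}

theorem star_dotProduct_extend (hi : Function.Injective i) (ξ : κ' → ℂ) (f : κ → ℂ) :
    star (Function.extend i f 0) ⬝ᵥ ξ = star f ⬝ᵥ (ξ ∘ i) := by
  classical
  rw [dotProduct, dotProduct]
  symm
  refine Finset.sum_of_injOn i hi.injOn (by simp) (fun y _ hy => ?_) fun x _ => ?_
  · rw [Pi.star_apply, Function.extend_apply', Pi.zero_apply, star_zero, zero_mul]
    rintro ⟨x, rfl⟩
    exact hy ⟨x, by simp, rfl⟩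
  · rw [Pi.star_apply, Pi.star_apply, hi.extend_apply, Function.comp_apply]

theorem sqNorm_extend (hi : Function.Injective i) (f : κ → ℂ) :
    sqNorm (Function.extend i f 0) = sqNorm f := by
  have h := star_dotProduct_extend hi (Function.extend i f 0) f
  rw [Function.extend_comp hi, star_dotProduct_self, star_dotProduct_self] at h
  exact_mod_cast h

theorem sqNorm_comp_le (hi : Function.Injective i) (ξ : κ' → ℂ) : sqNorm (ξ ∘ i) ≤ sqNorm ξ := by
  classical
  rw [sqNorm, sqNorm]
  calc ∑ x, ‖(ξ ∘ i) x‖ ^ 2 = ∑ y ∈ Finset.univ.map ⟨i, hi⟩, ‖ξ y‖ ^ 2 := by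
        rw [Finset.sum_map]; rfl
    _ ≤ _ := Finset.sum_le_univ_sum_of_nonneg fun y => by positivity

omit [Fintype κ] [Fintype κ'] in
theorem tpow_extend (hi : Function.Injective i) (f : κ → ℂ) {ℓ : ℕ} :
    tpow (Function.extend i f 0) ℓ =
      Function.extend (fun (y : Fin ℓ → κ) k => i (y k)) (tpow f ℓ) 0 := by
  have hinj : Function.Injective fun (y : Fin ℓ → κ) k => i (y k) := hi.comp_left
  ext z
  by_cases hz : ∃ y : Fin ℓ → κ, (fun k => i (y k)) = z
  · obtain ⟨y, rfl⟩ := hz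
    rw [hinj.extend_apply (g := tpow f ℓ) (e' := 0) (a := y)]
    simp [tpow, hi.extend_apply]
  · rw [Function.extend_apply' _ _ _ hz, Pi.zero_apply]
    have : ∃ k, ¬ ∃ x, i x = z k := by
      by_contra hcon
      push Not at hcon
      choose y hy using hcon
      exact hz ⟨y, funext hy⟩
    obtain ⟨k, hk⟩ := this
    exact Finset.prod_eq_zero (Finset.mem_univ k) (Function.extend_apply' _ _ _ hk)

end extend

/-! ### A bipartite state with one large and many small Schmidt coefficients -/

/-- The Schmidt spectrum `1 - x, x / D, …, x / D`. -/
def spikedWeight (D : ℕ) (x : ℝ) : Option (Fin D) → ℝ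
  | none => 1 - x
  | some _ => x / D

/-- The vector with Schmidt spectrum `spikedWeight D x`. -/
def spikedVec (D : ℕ) (x : ℝ) : Option (Fin D) × Option (Fin D) → ℂ :=
  fun p => if p.1 = p.2 then (Real.sqrt (spikedWeight D x p.1) : ℂ) else 0

section spiked

variable {D : ℕ} {x : ℝ}

theorem spikedWeight_nonneg (hx0 : 0 ≤ x) (hx1 : x ≤ 1) (s : Option (Fin D)) :
    0 ≤ spikedWeight D x s := by
  cases s with
  | none => exact sub_nonneg.2 hx1
  | some i => exact div_nonneg hx0 (Nat.cast_nonneg D)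

theorem sum_spikedWeight (hD : D ≠ 0) : ∑ s, spikedWeight D x s = 1 := by
  have : (D : ℝ) ≠ 0 := by exact_mod_cast hD
  rw [Fintype.sum_option]
  simp only [spikedWeight, Finset.sum_const, Finset.card_univ, Fintype.card_fin, nsmul_eq_mul]
  field_simp
  ring

theorem spikedVec_singular (hx0 : 0 ≤ x) (hx1 : x ≤ 1) (a a' : Option (Fin D)) :
    ∑ b, spikedVec D x (a, b) * star (spikedVec D x (a', b)) =
      ∑ s, (spikedWeight D x s : ℂ) * ((Pi.single s 1 : Option (Fin D) → ℂ) a *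
        star ((Pi.single s 1 : Option (Fin D) → ℂ) a')) := by
  refine Finset.sum_congr rfl fun b _ => ?_
  by_cases h : a = b
  · by_cases h' : a' = b
    · subst h
      subst h'
      simp only [spikedVec, if_true, Pi.single_eq_same, star_one, mul_one, Complex.star_def,
        Complex.conj_ofReal]
      rw [← Complex.ofReal_mul, Real.mul_self_sqrt (spikedWeight_nonneg hx0 hx1 _)]
    · simp [spikedVec, h', Pi.single_apply]
  · simp [spikedVec, h, Pi.single_apply]

theorem star_single_dotProduct_single {ι : Type*} [Fintype ι] [DecidableEq ι] (s s' : ι) :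
    star (Pi.single s (1 : ℂ)) ⬝ᵥ Pi.single s' 1 = if s = s' then 1 else 0 := by
  rw [dotProduct_single, mul_one, Pi.star_apply, Pi.single_apply]
  by_cases h : s = s' <;> simp [h, eq_comm]

theorem sqNorm_spikedVec (hD : D ≠ 0) (hx0 : 0 ≤ x) (hx1 : x ≤ 1) :
    sqNorm (spikedVec D x) = 1 := by
  rw [← sum_singular_eq_sqNorm (spikedVec D x) (spikedWeight D x) (fun s => Pi.single s 1)
    star_single_dotProduct_single (spikedVec_singular hx0 hx1), sum_spikedWeight hD]

/-- Of r + 1 distinct Schmidt indices at most one is the large one, so at least r of them carry the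
small total weight x. -/
theorem sqNorm_detForm_spikedVec_le (hD : D ≠ 0) (hx0 : 0 ≤ x) (hx1 : x ≤ 1) (r : ℕ) :
    sqNorm (detForm (spikedVec D x) (r + 1)) ≤ x ^ r / r ! := by
  rw [sqNorm_detForm (spikedVec D x) (spikedWeight D x) (fun s => Pi.single s 1)
    star_single_dotProduct_single (spikedVec_singular hx0 hx1)]
  have h := injSum_le_mul_pow (spikedWeight_nonneg hx0 hx1) (sum_spikedWeight hD) none r ∅
  have hsum : ∑ i ∈ ({none} : Finset (Option (Fin D)))ᶜ, spikedWeight D x i = x := by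
    have h1 := Finset.sum_add_sum_compl {none} (spikedWeight D x)
    rw [sum_spikedWeight hD, Finset.sum_singleton] at h1
    simp only [spikedWeight] at h1 ⊢
    linarith
  rw [hsum] at h
  rw [div_le_div_iff₀ (by positivity) (by positivity), Nat.factorial_succ]
  push_cast
  have : (0 : ℝ) < r ! := by positivity
  nlinarith

/-- The flat part of the spectrum meets X only in the trace of the block Y, with |tr Y|² ≤ r‖Y‖²; a
weighted Cauchy–Schwarz combines it with the spike. For large D the rank r captures little more than
the spike. -/
theorem norm_star_spikedVec_dotProduct_sq_le (hx0 : 0 ≤ x) (hx1 : x ≤ 1) {r : ℕ} (hr : 1 ≤ r)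
    {X : Option (Fin D) × Option (Fin D) → ℂ} (hX : HasRankLE r X) :
    ‖star (spikedVec D x) ⬝ᵥ X‖ ^ 2 ≤ (1 - x + x * r / D) * sqNorm X := by
  set Y : Matrix (Fin D) (Fin D) ℂ := Matrix.of fun i j => X (some i, some j) with hY
  have hYrank : Y.rank ≤ r := by
    obtain ⟨A, B, h⟩ := hX
    have : Y = (Matrix.of fun (i : Fin D) (k : Fin r) => A k (some i)) *
        Matrix.of fun (k : Fin r) (j : Fin D) => B k (some j) := by
      ext i j
      simp [hY, h, Matrix.mul_apply]
    rw [this]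
    exact Matrix.rank_mul_le_card _ _
  set s : ℝ := ∑ i, ∑ j, ‖Y i j‖ ^ 2 with hs
  have hs0 : 0 ≤ s := Finset.sum_nonneg fun i _ => Finset.sum_nonneg fun j _ => by positivity
  have htr : ‖Y.trace‖ ^ 2 ≤ r * s := (Y.norm_trace_sq_le).trans
    (mul_le_mul_of_nonneg_right (by exact_mod_cast hYrank) hs0)
  have hdot : star (spikedVec D x) ⬝ᵥ X =
      (Real.sqrt (1 - x) : ℂ) * X (none, none) + (Real.sqrt (x / D) : ℂ) * Y.trace := by
    rw [dotProduct, Fintype.sum_prod_type, Fintype.sum_option, Fintype.sum_option]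
    simp [spikedVec, spikedWeight, Matrix.trace, Fintype.sum_option, hY, Finset.mul_sum]
    refine Finset.sum_congr rfl fun i _ => ?_
    rw [Finset.sum_eq_single i (fun j _ hj => by simp [Ne.symm hj]) (by simp)]
    simp
  have hnorm : ‖X (none, none)‖ ^ 2 + s ≤ sqNorm X := by
    rw [sqNorm, Fintype.sum_prod_type, Fintype.sum_option, Fintype.sum_option]
    refine add_le_add (le_add_of_nonneg_right (Finset.sum_nonneg fun _ _ => by positivity))
      (Finset.sum_le_sum fun i _ => ?_)
    rw [Fintype.sum_option]
    exact le_add_of_nonneg_left (by positivity)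
  set α := Real.sqrt (1 - x)
  set β := Real.sqrt (x / D)
  have hα : α ^ 2 = 1 - x := Real.sq_sqrt (by linarith)
  have hβ : β ^ 2 = x / D := Real.sq_sqrt (div_nonneg hx0 (Nat.cast_nonneg D))
  have hα0 : 0 ≤ α := Real.sqrt_nonneg _
  have hβ0 : 0 ≤ β := Real.sqrt_nonneg _
  set a := ‖X (none, none)‖
  set b := ‖Y.trace‖
  have htri : ‖star (spikedVec D x) ⬝ᵥ X‖ ≤ α * a + β * b := by
    rw [hdot]
    refine (norm_add_le _ _).trans_eq ?_
    rw [norm_mul, norm_mul, Complex.norm_real, Complex.norm_real, Real.norm_of_nonneg hα0,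
      Real.norm_of_nonneg hβ0]
  have hr0 : (0 : ℝ) < r := by exact_mod_cast hr
  have hmain : (α * a + β * b) ^ 2 ≤ (α ^ 2 + r * β ^ 2) * (a ^ 2 + s) := by
    have h1 : 2 * (α * a) * (β * b) * r ≤ (α ^ 2 * s + r * β ^ 2 * a ^ 2) * r := by
      have h2 : α ^ 2 * b ^ 2 ≤ α ^ 2 * (r * s) := mul_le_mul_of_nonneg_left htr (sq_nonneg α)
      nlinarith [sq_nonneg (α * b - r * β * a)]
    have h3 := le_of_mul_le_mul_right h1 hr0
    have h4 : β ^ 2 * b ^ 2 ≤ β ^ 2 * (r * s) := mul_le_mul_of_nonneg_left htr (sq_nonneg β)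
    nlinarith
  have hcoef : α ^ 2 + r * β ^ 2 = 1 - x + x * r / D := by rw [hα, hβ]; ring
  calc _ ≤ (α * a + β * b) ^ 2 := pow_le_pow_left₀ (norm_nonneg _) htri 2
    _ ≤ (α ^ 2 + r * β ^ 2) * (a ^ 2 + s) := hmain
    _ ≤ (α ^ 2 + r * β ^ 2) * sqNorm X := mul_le_mul_of_nonneg_left hnorm (by positivity)
    _ = _ := by rw [hcoef]

end spiked

/-! ### The lower bound -/

theorem tpow_extend_mem_span {κ κ' Θ : Type*} {i : κ → κ'} (hi : Function.Injective i) {ℓ : ℕ}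
    {f : Θ → κ → ℂ} {v : (Fin ℓ → κ) → ℂ}
    (hv : v ∈ Submodule.span ℂ (Set.range fun θ => tpow (f θ) ℓ)) :
    Function.extend (fun (y : Fin ℓ → κ) k => i (y k)) v 0 ∈
      Submodule.span ℂ (Set.range fun θ => tpow (Function.extend i (f θ) 0) ℓ) := by
  have h := Submodule.mem_map_of_mem
    (f := Function.ExtendByZero.linearMap ℂ fun (y : Fin ℓ → κ) k => i (y k)) hv
  rw [Submodule.map_span, ← Set.range_comp] at h
  refine Submodule.span_mono ?_ h
  rintro _ ⟨θ, rfl⟩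
  exact ⟨θ, tpow_extend hi (f θ)⟩

section lower

variable {V : Type*} [Fintype V] [DecidableEq V] {E : Type*} [Fintype E] [DecidableEq E]

/-- A product of spiked vectors on the edges is accepted by a perfectly complete test with
probability close to one. -/
theorem one_sub_le_acceptProb_spiked {G : SimpleGraph V} {d : V → ℕ} {r D : ℕ} {x : ℝ}
    (hr : 1 ≤ r) (hD : D ≠ 0) (hx0 : 0 ≤ x) (hx1 : x ≤ 1) {p : E → V × V}
    {j : (v : V) → (E → Option (Fin D) × Option (Fin D)) ↪ Fin (d v)}
    (hrank : ∀ ζ : E → Option (Fin D) × Option (Fin D) → ℂ, (∀ e, HasRankLE r (ζ e)) →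
      ∀ u v, G.Adj u v → HasCutRank (edgeSide G u v) r
        (Function.extend (halvesEmb p none j) (prodVec ζ) 0))
    {k : ℕ} (T : AdaptiveTest (ProdIdx d) (r + 1) k)
    (hT : ∀ ρ ∈ TTNS G d r, T.acceptProb ρ = 1) :
    1 - k * (Fintype.card E * (x ^ r / r !)) ≤ T.acceptProb
      (ketbra (Function.extend (halvesEmb p none j) (prodVec fun _ => spikedVec D x) 0)) := by
  have hi := halvesEmb_injective p none j
  set i := halvesEmb p none j
  set χ := spikedVec D x with hχ
  have hχ1 : sqNorm χ = 1 := sqNorm_spikedVec hD hx0 hx1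
  let F := Option (Fin D)
  -- Tensors of rank at most r are parametrized polynomially by their factors, which gives the
  -- holomorphic family Φ of tree tensor network vectors.
  let mat : (E → (Fin r → F → ℂ) × (Fin r → F → ℂ)) → E → F × F → ℂ :=
    fun θ e p => ∑ k, (θ e).1 k p.1 * (θ e).2 k p.2
  have hmat : ∀ θ e, HasRankLE r (mat θ e) := fun θ e => ⟨(θ e).1, (θ e).2, fun p => rfl⟩
  let Φ : (E → (Fin r → F → ℂ) × (Fin r → F → ℂ)) → ProdIdx d → ℂ :=
    fun θ => Function.extend i (prodVec (mat θ)) 0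
  have hdiff : ∀ y, Differentiable ℂ fun θ => Φ θ y := by
    intro y
    by_cases hy : ∃ z, i z = y
    · obtain ⟨z, rfl⟩ := hy
      have : (fun θ => Φ θ (i z)) = fun θ => ∏ e, ∑ k, (θ e).1 k (z e).1 * (θ e).2 k (z e).2 := by
        ext θ
        exact hi.extend_apply _ _ _
      rw [this]
      fun_prop
    · have : (fun θ => Φ θ y) = fun _ => 0 := by
        ext θ
        exact Function.extend_apply' _ _ _ hy
      rw [this]
      exact differentiable_const 0
  have hne : ∃ θ, Φ θ ≠ 0 := by
    refine ⟨fun _ => (fun _ _ => 1, fun _ _ => 1), Function.ne_iff.2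
      ⟨i fun _ => (none, none), ?_⟩⟩
    have : Φ (fun _ => (fun _ _ => 1, fun _ _ => 1)) (i fun _ => (none, none)) =
        ∏ _e : E, ∑ _k : Fin r, (1 : ℂ) * 1 := hi.extend_apply _ _ _
    rw [this]
    simp
    omega
  have hψ : IsUnitVector (Function.extend i (prodVec fun _ : E => χ) 0) := by
    rw [isUnitVector_iff, sqNorm_extend hi, sqNorm_prodVec]
    simp [hχ1]
  obtain ⟨v, hv, hdist⟩ := exists_approx_tpow_prodVec (E := E) (r := r) hχ1
  have hv' : v ∈ Submodule.span ℂ (Set.range fun θ => tpow (prodVec (mat θ)) (r + 1)) := by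
    refine Submodule.span_mono ?_ hv
    rintro _ ⟨ζ, hζ, rfl⟩
    choose A B hAB using hζ
    refine ⟨fun e => (A e, B e), ?_⟩
    have : mat (fun e => (A e, B e)) = ζ := by
      ext e p
      exact (hAB e p).symm
    simp only [this]
  have hmain := T.one_sub_mul_le_acceptProb hdiff hne hψ (tpow_extend_mem_span hi hv')
    isOpen_univ dense_univ fun θ _ c hc => hT _ ⟨c • Φ θ, hc, fun u v huv =>
      (schmidtRank_le_iff _ _ _).2 ((hrank (mat θ) (hmat θ) u v huv).smul c), rfl⟩
  refine le_trans ?_ hmain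
  have hsub : sqNorm (tpow (Function.extend i (prodVec fun _ : E => χ) 0) (r + 1) -
      Function.extend (fun (y : Fin (r + 1) → E → F × F) k => i (y k)) v 0) =
      sqNorm (tpow (prodVec fun _ : E => χ) (r + 1) - v) := by
    have hinj : Function.Injective fun (y : Fin (r + 1) → E → F × F) k => i (y k) := hi.comp_left
    rw [tpow_extend hi, ← sqNorm_extend hinj]
    congr 1
    exact ((Function.ExtendByZero.linearMap ℂ
      fun (y : Fin (r + 1) → E → F × F) k => i (y k)).map_sub _ _).symm
  rw [hsub]
  have h1 := sqNorm_detForm_spikedVec_le (x := x) hD hx0 hx1 r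
  have h2 : sqNorm (tpow (prodVec fun _ : E => χ) (r + 1) - v) ≤
      Fintype.card E * (x ^ r / r !) := hdist.trans (by gcongr)
  gcongr

/-- A product of spiked vectors on the edges is far from all tree tensor network states. -/
theorem isFar_spiked {G : SimpleGraph V} {d : V → ℕ} {r D : ℕ} {x ε : ℝ}
    (hr : 1 ≤ r) (hD : D ≠ 0) (hx0 : 0 ≤ x) (hx1 : x ≤ 1) {p : E → V × V}
    {j : (v : V) → (E → Option (Fin D) × Option (Fin D)) ↪ Fin (d v)}
    (hadj : ∀ e, G.Adj (p e).1 (p e).2)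
    (h1 : ∀ e, (p e).2 ∉ edgeSide G (p e).1 (p e).2)
    (hsep : ∀ a e, e ≠ a → ((p e).1 ∈ edgeSide G (p a).1 (p a).2 ↔
      (p e).2 ∈ edgeSide G (p a).1 (p a).2))
    (hε : (1 - x + x * r / D) ^ Fintype.card E ≤ 1 - ε ^ 2) :
    IsFar ε (TTNS G d r)
      (ketbra (Function.extend (halvesEmb p none j) (prodVec fun _ => spikedVec D x) 0)) := by
  have hi := halvesEmb_injective p none j
  have hχ1 : sqNorm (spikedVec D x) = 1 := sqNorm_spikedVec hD hx0 hx1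
  have hψ : IsUnitVector
      (Function.extend (halvesEmb p none j) (prodVec fun _ : E => spikedVec D x) 0) := by
    rw [isUnitVector_iff, sqNorm_extend hi, sqNorm_prodVec]
    simp [hχ1]
  rintro _ ⟨ξ, hξ, hrank, rfl⟩
  rw [traceDist_ketbra hψ hξ, star_dotProduct_extend hi]
  have hc : 0 ≤ 1 - x + x * r / D :=
    add_nonneg (by linarith) (div_nonneg (mul_nonneg hx0 (Nat.cast_nonneg r)) (Nat.cast_nonneg D))
  have h2 := norm_star_prodVec_dotProduct_sq_le hc
    (fun X hX => norm_star_spikedVec_dotProduct_sq_le hx0 hx1 hr hX)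
    (fun e => ((schmidtRank_le_iff _ _ _).1 (hrank _ _ (hadj e))).hasEdgeRank_comp
      (f₀ := none) (j := j) e (left_mem_edgeSide _ _) (h1 e) (hsep e)) hχ1
  have h3 : sqNorm (ξ ∘ halvesEmb p none j) ≤ 1 :=
    (sqNorm_comp_le hi ξ).trans_eq ((isUnitVector_iff ξ).1 hξ)
  have h4 : (1 - x + x * r / D) ^ Fintype.card E * sqNorm (ξ ∘ halvesEmb p none j) ≤ 1 - ε ^ 2 :=
    (mul_le_of_le_one_right (pow_nonneg hc _) h3).trans hε
  exact Real.le_sqrt_of_sq_le (by linarith)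

end lower

/-- (1 - t)^m ≤ (1 + t)^{-m} ≤ 1/(1 + mt), and the choice of t makes the last term equal 1 - e. -/
theorem one_sub_pow_le_one_sub {m : ℕ} {t e : ℝ} (ht0 : 0 ≤ t) (ht1 : t ≤ 1) (he : e < 1)
    (hmt : m * t = e / (1 - e)) : (1 - t) ^ m ≤ 1 - e := by
  have h1 := one_add_mul_le_pow (a := t) (by linarith) m
  have h2 : (1 - t) ^ m * (1 + t) ^ m ≤ 1 := by
    rw [← mul_pow]
    exact pow_le_one₀ (by nlinarith) (by nlinarith)
  have h3 : 0 ≤ (1 - t) ^ m := pow_nonneg (by linarith) m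
  have h4 : (1 - t) ^ m * (1 + m * t) ≤ 1 := (mul_le_mul_of_nonneg_left h1 h3).trans h2
  have he' : 0 < 1 - e := by linarith
  have h5 : 1 + m * t = (1 - e)⁻¹ := by
    rw [hmt]
    field_simp
    ring
  rw [h5, ← div_eq_mul_inv, div_le_one he'] at h4
  exact h4

theorem le_numCopies_of_isOneSidedTester {V : Type*} [Fintype V] [DecidableEq V]
    {G : SimpleGraph V} (hG : G.IsTree) {r : ℕ} (hr : 2 ≤ r) {ε : ℝ} (hε : 0 < ε)
    (hεr : ε < 1 / ((r : ℝ) + 2)) :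
    ∃ d₀ : ℕ, ∀ d : V → ℕ, (∀ v, d₀ ≤ d v) →
      ∀ (k : ℕ) (T : AdaptiveTest (ProdIdx d) (r + 1) k), T.IsOneSidedTester (TTNS G d r) ε →
        1 / 4 * (((Fintype.card V : ℝ) - 1) ^ (r - 1) * ((r + 1)! : ℝ) / ε ^ (2 * r)) ≤
          (T.numCopies : ℝ) := by
  classical
  -- This makes r / D = q = 1/(r + 2)², small enough that (1 - q)^(2r) ≥ 3/4.
  set D := r * (r + 2) ^ 2 with hDdef
  refine ⟨Fintype.card (G.edgeSet → Option (Fin D) × Option (Fin D)), fun d hd k T hT => ?_⟩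
  have hcardE : (Fintype.card G.edgeSet : ℝ) = (Fintype.card V : ℝ) - 1 := by
    have := hG.card_edgeFinset
    rw [SimpleGraph.edgeFinset_card] at this
    rw [← this]
    push_cast
    ring
  rw [← hcardE]
  set m := Fintype.card G.edgeSet
  rcases Nat.eq_zero_or_pos m with hm0 | hm
  · rw [hm0, Nat.cast_zero, zero_pow (by omega)]
    simp
  have hm1 : (1 : ℝ) ≤ m := by exact_mod_cast hm
  have hr2 : (2 : ℝ) ≤ r := by exact_mod_cast hr
  set q : ℝ := 1 / ((r : ℝ) + 2) ^ 2 with hq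
  have hq0 : 0 < q := by positivity
  have hq16 : q ≤ 1 / 16 := by
    rw [hq]
    exact one_div_le_one_div_of_le (by norm_num) (by nlinarith)
  have hqr : 2 * r * q ≤ 1 / 4 := by
    rw [hq, mul_one_div, div_le_div_iff₀ (by positivity) (by norm_num)]
    nlinarith [sq_nonneg ((r : ℝ) - 2)]
  have hεq : ε ^ 2 ≤ q := by
    rw [hq, ← one_div_pow]
    exact pow_le_pow_left₀ hε.le hεr.le 2
  have hε2 : 0 < ε ^ 2 := by positivity
  -- Chosen so that (1 - t)^m ≤ 1 - ε²; then x solves 1 - x + xq = 1 - t.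
  set t : ℝ := ε ^ 2 / (1 - ε ^ 2) / m with ht
  have ht0 : 0 < t := by
    have : 0 < 1 - ε ^ 2 := by linarith
    positivity
  have ht1 : t ≤ 1 / 15 := by
    rw [ht, div_div, div_le_iff₀ (mul_pos (by linarith) (by linarith))]
    nlinarith
  set x : ℝ := t / (1 - q) with hx
  have hx0 : 0 ≤ x := div_nonneg ht0.le (by linarith)
  have hx1 : x ≤ 1 := by
    rw [hx, div_le_one (by linarith)]
    linarith
  have hD : D ≠ 0 := by positivity
  have hDr : (r : ℝ) / D = q := by
    rw [hDdef, hq]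
    push_cast
    field_simp
  have hcoef : 1 - x + x * r / D = 1 - t := by
    rw [mul_div_assoc, hDr, hx]
    have : 1 - q ≠ 0 := by linarith
    field_simp
    ring
  obtain ⟨p, hadj, hp, -⟩ := exists_laminar_orientation hG
  have hright : ∀ e, (p e).2 ∉ edgeSide G (p e).1 (p e).2 :=
    fun e => right_notMem_edgeSide hG.isAcyclic (hadj e)
  have hsep : ∀ a e, e ≠ a → ((p e).1 ∈ edgeSide G (p a).1 (p a).2 ↔
      (p e).2 ∈ edgeSide G (p a).1 (p a).2) := fun a e hea =>
    mem_edgeSide_iff_of_adj (hadj e) (by rw [hp, hp]; exact fun h => hea (Subtype.ext h))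
  have hemb : ∀ v, Nonempty ((G.edgeSet → Option (Fin D) × Option (Fin D)) ↪ Fin (d v)) :=
    fun v => Function.Embedding.nonempty_of_card_le (by rw [Fintype.card_fin]; exact hd v)
  let j := fun v => (hemb v).some
  have hfar := isFar_spiked (d := d) (r := r) (j := j) (ε := ε) (by omega) hD hx0 hx1 hadj hright
    hsep (by
      rw [hcoef]
      refine one_sub_pow_le_one_sub ht0.le (by linarith) (by linarith) ?_
      rw [ht, mul_div_cancel₀ _ (by linarith)])
  have hacc := one_sub_le_acceptProb_spiked (G := G) (r := r) (j := j) (by omega) hD hx0 hx1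
    (fun ζ hζ u v huv => hasCutRank_edgeSide_of_orientation hG hp (fun a =>
      hasCutRank_extend_prodVec a (hζ a) (left_mem_edgeSide _ _) (hright a) (hsep a)) huv)
    T hT.1
  have hrej := hT.2 _ ⟨_, by
    rw [isUnitVector_iff, sqNorm_extend (halvesEmb_injective p none j), sqNorm_prodVec]
    simp [sqNorm_spikedVec hD hx0 hx1], rfl⟩ hfar
  have hk : 1 / 3 ≤ k * (m * (x ^ r / r !)) := by linarith
  -- x exceeds ε²/m by the factor 1/((1 - ε²)(1 - q)). Its r-th power is at most 4/3 because ε² ≤ q,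
  -- which is where ε < 1/(r + 2) matters. With rejection probability 1/3 this yields the constant
  -- 1/4.
  have hxr : x ^ r ≤ 4 / 3 * (ε ^ (2 * r) / (m : ℝ) ^ r) := by
    have h1 : x = ε ^ 2 / m / ((1 - ε ^ 2) * (1 - q)) := by
      rw [hx, ht]
      have : 1 - q ≠ 0 := by linarith
      have : 1 - ε ^ 2 ≠ 0 := by linarith
      field_simp
    have h2 : 3 / 4 ≤ ((1 - ε ^ 2) * (1 - q)) ^ r := by
      have h3 := one_add_mul_le_pow (a := -q) (by linarith) (2 * r)
      calc (3 : ℝ) / 4 ≤ 1 + (2 * r : ℕ) * -q := by push_cast; linarith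
        _ ≤ (1 + -q) ^ (2 * r) := h3
        _ = ((1 - q) * (1 - q)) ^ r := by rw [pow_mul]; congr 1; ring
        _ ≤ _ := by
          refine pow_le_pow_left₀ (mul_nonneg (by linarith) (by linarith)) ?_ r
          exact mul_le_mul_of_nonneg_right (by linarith) (by linarith)
    have h4 : 0 < ε ^ (2 * r) / (m : ℝ) ^ r := by positivity
    rw [h1, div_pow, div_pow, ← pow_mul, div_le_iff₀ (by linarith)]
    nlinarith
  have hmr : (m : ℝ) ^ r = m ^ (r - 1) * m := by rw [← pow_succ]; congr 1; omega
  have hk2 : 1 / 3 ≤ k * (4 / 3 * (ε ^ (2 * r) / ((m : ℝ) ^ (r - 1) * r !))) := by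
    refine hk.trans (mul_le_mul_of_nonneg_left ?_ (Nat.cast_nonneg k))
    calc (m : ℝ) * (x ^ r / r !) ≤ m * (4 / 3 * (ε ^ (2 * r) / (m : ℝ) ^ r) / r !) := by gcongr
      _ = _ := by
        rw [hmr]
        field_simp
  have hpos : 0 < ε ^ (2 * r) / ((m : ℝ) ^ (r - 1) * r !) := by positivity
  have hk3 : 1 / 4 * (((m : ℝ) ^ (r - 1) * r !) / ε ^ (2 * r)) ≤ k := by
    have h5 : ((m : ℝ) ^ (r - 1) * r !) / ε ^ (2 * r) =
        (ε ^ (2 * r) / ((m : ℝ) ^ (r - 1) * r !))⁻¹ := (inv_div _ _).symm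
    rw [h5, ← div_eq_mul_inv, div_le_iff₀ hpos]
    linarith
  rw [AdaptiveTest.numCopies, Nat.factorial_succ]
  push_cast
  calc _ = 1 / 4 * (((m : ℝ) ^ (r - 1) * r !) / ε ^ (2 * r)) * (r + 1) := by ring
    _ ≤ k * (r + 1) := by gcongr

end

theorem theorem3 :
    ∃ C : ℝ, 0 < C ∧ ∃ c : ℝ, 0 < c ∧
      ∀ (V : Type*) [Fintype V] [DecidableEq V] (G : SimpleGraph V), G.IsTree →
      ∀ (r : ℕ), 2 ≤ r → ∀ (ε : ℝ), 0 < ε → ε < 1 / ((r : ℝ) + 2) →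
        -- upper bound, for all physical dimensions, with measurements fixed in advance
        (∀ d : V → ℕ, ∃ (k : ℕ) (T : AdaptiveTest (ProdIdx d) (r + 1) k),
          T.IsNonadaptive ∧ T.IsOneSidedTester (TTNS G d r) ε ∧
          (T.numCopies : ℝ) ≤
            C * (((Fintype.card V : ℝ) - 1) ^ r * ((r + 1)! : ℝ) / ε ^ (2 * r))) ∧
        -- lower bound, for all sufficiently large physical dimensions, even with adaptivity
        (∃ d₀ : ℕ, ∀ d : V → ℕ, (∀ v, d₀ ≤ d v) →
          ∀ (k : ℕ) (T : AdaptiveTest (ProdIdx d) (r + 1) k),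
            T.IsOneSidedTester (TTNS G d r) ε →
            c * (((Fintype.card V : ℝ) - 1) ^ (r - 1) * ((r + 1)! : ℝ) / ε ^ (2 * r)) ≤
              (T.numCopies : ℝ)) := by
  refine ⟨4, by norm_num, 1 / 4, by norm_num, fun V _ _ G hG r hr ε hε hεr =>
    ⟨fun d => exists_nonadaptive_tester_TTNS hG (by omega) hε ?_ d,
      le_numCopies_of_isOneSidedTester hG hr hε hεr⟩⟩
  rw [lt_div_iff₀ (by positivity)] at hεr
  nlinarith
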